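/- Let $B$ be a smooth irreducible complex curve (separated and of finite type over $\mathbb{C}$), let $E$ be a locally free sheaf of rank $2$ on $B$, and let $\phi\colon E\to E\otimes\Omega^1_B$ be a Higgs field that is not central, i.e. not of the form $\mathrm{id}_E\otimes\eta$ with $\eta\in H^0(B,\Omega^1_B)$. Over an affine open $U\subseteq B$ with a frame $(e_1,e_2)$ of $E$, write $\phi(e_b)=\sum_a e_a\otimes\phi_{ab}$ with $\phi_{ab}\in\Omega^1(U)$. Let $\rho_1\colon \mathrm{HGr}_1(E,\phi)\to B$ be the Higgs Grassmannian of rank one Higgs subbundles, that is, the closed subscheme of $\mathbb{P}(E)$ (the bundle of lines in $E$) locally defined by $\phi_{21}z_1^2+(\phi_{22}-\phi_{11})z_1z_2-\phi_{12}z_2^2=0$. Let $\Delta_\phi=(\phi_{22}-\phi_{11})^2+4\phi_{12}\phi_{21}\in H^0(B,(\Omega^1_B)^{\otimes 2})$ be the discriminant of $\phi$. Say that "the gcd of $\phi$ on $U$ is $1$" if every function on $U$ that divides all of $\phi_{12}$, $\phi_{21}$ and $\phi_{22}-\phi_{11}$ (the entries of $\phi$ after normalizing $\phi_{11}=0$ by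 subtracting $\phi_{11}\cdot\mathrm{id}$) is invertible. (1) Suppose that the gcd of $\phi$ is $1$ on every such framed affine open $U$. Then $\rho_1$ is finite (and flat) of degree $2$. Moreover: - if $\Delta_\phi\neq 0$ and $\Delta_\phi$ is not the square of an element of $H^0(B,\Omega^1_B)$, then $\mathrm{HGr}_1(E,\phi)$ is irreducible and reduced, $\rho_1$ has no section, and $(E,\phi)$ has no Higgs line subbundle; - if $\Delta_\phi\neq 0$ is the square of an element of $H^0(B,\Omega^1_B)$, then $\mathrm{HGr}_1(E,\phi)$ is reducible, $\rho_1$ has exactly two sections, and $(E,\phi)$ has exactly two Higgs line subbundles; - if $\Delta_\phi=0$, then $\mathrm{HGr}_1(E,\phi)$ is nonreduced, the fibre of $\rho_1$ over every $\mathbb{C}$-point of $B$ is isomorphic to $\operatorname{Spec}\mathbb{C}[t]/(t^2)$, $\rho_1$ has exactly one section, and $(E,\phi)$ has exactly one Higgs line subbundle. Here a Higgs line subbundle is a rank one subbundle $L\subset E$ (with $E/L$ locally free) such that $\phi(L)\subseteq L\otimes\Omega^1_B$. (2) If the gcd of $\phi$ is not $1$ on some framed affine open $U$, then $\mathrm{HGr}_1(E,\phi)$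 has a vertical component: for some closed point $b\in B$ the fibre $\rho_1^{-1}(b)$ is the whole line $\pi^{-1}(b)\subset\mathbb{P}(E)$ and is an irreducible component of $\mathrm{HGr}_1(E,\phi)$. In particular $\rho_1$ is not finite. -/

import Mathlib

open CategoryTheory CategoryTheory.Limits AlgebraicGeometry TopologicalSpace TensorProduct

noncomputable section

namespace HiggsGrass

section Bundles

variable {X : Scheme.{0}} (E : X.Modules)

/-- Restriction of sections of a sheaf of modules. -/
def res {U V : X.Opens} (h : V ≤ U) : Γ(E, U) →+ Γ(E, V) :=
  (E.presheaf.map (homOfLE h).op).hom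

theorem res_smul {U V : X.Opens} (h : V ≤ U) (a : Γ(X, U)) (s : Γ(E, U)) :
    res E h (a • s) = X.presheaf.map (homOfLE h).op a • res E h s :=
  Scheme.Modules.map_smul E (homOfLE h) a s

theorem res_res {U V W : X.Opens} (h : V ≤ U) (h' : W ≤ V) (s : Γ(E, U)) :
    res E h' (res E h s) = res E (h'.trans h) s := by
  change (E.presheaf.map (homOfLE h).op ≫ E.presheaf.map (homOfLE h').op).hom s = _
  rw [← Functor.map_comp]
  rfl

/-- A frame of rank `r` of `E` over the open set `U`: sections `e₁, …, e_r` over `U` whose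
restrictions to every open subset `V` of `U` form a basis of `E(V)`; that is, an isomorphism
between the free module of rank `r` and `E` over `U`. -/
structure Frame (r : ℕ) (U : X.Opens) where
  vec : Fin r → Γ(E, U)
  linearIndependent : ∀ (V : X.Opens) (h : V ≤ U),
    LinearIndependent Γ(X, V) (fun a => res E h (vec a))
  span_eq_top : ∀ (V : X.Opens) (h : V ≤ U),
    ⊤ ≤ Submodule.span Γ(X, V) (Set.range fun a => res E h (vec a))

/-- `E` is locally free of rank `r`. -/
def IsLocallyFreeOfRank (r : ℕ) : Prop :=
  ∀ x : X, ∃ U : X.Opens, x ∈ U ∧ Nonempty (Frame E r U)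

variable {E}

/-- The basis of `E(V)` given by a frame over `U ⊇ V`. -/
def Frame.basis {r : ℕ} {U : X.Opens} (e : Frame E r U) {V : X.Opens} (h : V ≤ U) :
    Module.Basis (Fin r) Γ(X, V) Γ(E, V) :=
  Module.Basis.mk (e.linearIndependent V h) (e.span_eq_top V h)

theorem Frame.basis_apply {r : ℕ} {U : X.Opens} (e : Frame E r U) {V : X.Opens} (h : V ≤ U)
    (a : Fin r) : e.basis h a = res E h (e.vec a) := by
  simp [Frame.basis]

variable (E) in
/-- An affine open subset of `X` together with a frame of rank two of `E` over it. -/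
structure FramedAffine where
  U : X.affineOpens
  frame : Frame E 2 U

/-- The transition matrix `g` over `Uᵢ ∩ Uⱼ`: the columns of `g` are the coordinates of the frame
`i` with respect to the frame `j`, `eᵢ,ₐ = ∑ b, g b a • eⱼ,b`. -/
def transition (i j : FramedAffine E) : Matrix (Fin 2) (Fin 2) Γ(X, i.U.1 ⊓ j.U.1) :=
  fun b a => (j.frame.basis inf_le_right).repr (res E inf_le_left (i.frame.vec a)) b

theorem vec_eq (i j : FramedAffine E) (V : X.Opens) (h : V ≤ i.U.1 ⊓ j.U.1) (a : Fin 2) :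
    res E (h.trans inf_le_left) (i.frame.vec a) =
      ∑ b, (X.presheaf.map (homOfLE h).op (transition i j b a)) •
        res E (h.trans inf_le_right) (j.frame.vec b) := by
  have := (j.frame.basis (V := i.U.1 ⊓ j.U.1) inf_le_right).sum_repr
    (res E inf_le_left (i.frame.vec a))
  rw [← res_res E inf_le_left h, ← this, map_sum]
  refine Finset.sum_congr rfl fun b _ => ?_
  rw [res_smul, Frame.basis_apply, res_res]
  rfl

theorem transition_unique (i j : FramedAffine E) (V : X.Opens) (h : V ≤ i.U.1 ⊓ j.U.1)
    (g : Matrix (Fin 2) (Fin 2) Γ(X, V))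
    (hg : ∀ a, res E (h.trans inf_le_left) (i.frame.vec a) =
      ∑ b, g b a • res E (h.trans inf_le_right) (j.frame.vec b)) :
    (transition i j).map (X.presheaf.map (homOfLE h).op) = g := by
  ext b a
  have h1 := (j.frame.linearIndependent V (h.trans inf_le_right))
  have h2 := (hg a).symm.trans (vec_eq i j V h a)
  rw [Fintype.linearIndependent_iff] at h1
  have h3 := h1 (fun b => g b a - X.presheaf.map (homOfLE h).op (transition i j b a)) (by
    simp only [sub_smul, Finset.sum_sub_distrib, h2, sub_self]) b
  exact (sub_eq_zero.mp h3).symm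

theorem transition_self (i : FramedAffine E) (V : X.Opens) (h : V ≤ i.U.1 ⊓ i.U.1) :
    (transition i i).map (X.presheaf.map (homOfLE h).op) = 1 := by
  refine transition_unique i i V h 1 fun a => ?_
  simp [Matrix.one_apply]

theorem transition_mul (i j k : FramedAffine E) (V : X.Opens) (hij : V ≤ i.U.1 ⊓ j.U.1)
    (hjk : V ≤ j.U.1 ⊓ k.U.1) (hik : V ≤ i.U.1 ⊓ k.U.1) :
    (transition i k).map (X.presheaf.map (homOfLE hik).op) =
      (transition j k).map (X.presheaf.map (homOfLE hjk).op) *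
        (transition i j).map (X.presheaf.map (homOfLE hij).op) := by
  refine transition_unique i k V hik _ fun a => ?_
  rw [vec_eq i j V hij a]
  have := fun b => vec_eq j k V hjk b
  simp only [Fin.sum_univ_two, Matrix.mul_apply, Matrix.map_apply] at this ⊢
  rw [this 0, this 1]
  module


/-- The affine chart `{e₁ + t e₂}` of the projective bundle attached to a framed affine open set:
the affine line over it. -/
abbrev chart (i : FramedAffine E) : Scheme.{0} := 𝔸(Unit; (i.U.1 : Scheme.{0}))

/-- The projection of a chart to `X`. -/
def chartProj (i : FramedAffine E) : chart i ⟶ X :=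
  (𝔸(Unit; (i.U.1 : Scheme.{0})) ↘ (i.U.1 : Scheme.{0})) ≫ i.U.1.ι

/-- The coordinate `t` of a chart. -/
def chartCoord (i : FramedAffine E) : Γ(chart i, ⊤) :=
  AffineSpace.coord (i.U.1 : Scheme.{0}) ()

theorem chart_hom_ext {i : FramedAffine E} {T : Scheme.{0}} {x y : T ⟶ chart i}
    (h₁ : x ≫ chartProj i = y ≫ chartProj i)
    (h₂ : x.appTop (chartCoord i) = y.appTop (chartCoord i)) : x = y := by
  refine AffineSpace.hom_ext ?_ fun _ => h₂
  rw [← cancel_mono i.U.1.ι]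
  simpa only [chartProj, Category.assoc] using h₁

/-- A point `x` of the chart `i` and a point `y` of the chart `j` with values in `T` lie over the
same point of `X` and are given by the same line:
`e₁ + x t • e₂` is a unit multiple of `e'₁ + y t • e'₂`. -/
structure SameLine (i j : FramedAffine E) {T : Scheme.{0}} (x : T ⟶ chart i) (y : T ⟶ chart j) :
    Prop where
  base : x ≫ chartProj i = y ≫ chartProj j
  line : ∃ (h : ⊤ ≤ (x ≫ chartProj i) ⁻¹ᵁ (i.U.1 ⊓ j.U.1)) (u : Γ(T, ⊤)ˣ),
    ((transition i j).map ((x ≫ chartProj i).appLE (i.U.1 ⊓ j.U.1) ⊤ h)).mulVec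
      ![1, x.appTop (chartCoord i)] = u.1 • ![1, y.appTop (chartCoord j)]

theorem le_preimage (i : FramedAffine E) {T : Scheme.{0}} (x : T ⟶ chart i) :
    ⊤ ≤ (x ≫ chartProj i) ⁻¹ᵁ i.U.1 := by
  intro t _
  change (x ≫ chartProj i) t ∈ i.U.1
  simp only [chartProj, ← Category.assoc]
  rw [Scheme.Hom.comp_apply]
  exact Subtype.prop _

theorem map_transition (i j : FramedAffine E) {T : Scheme.{0}} (b : T ⟶ X) (V : X.Opens)
    (hV : V ≤ i.U.1 ⊓ j.U.1) (h : ⊤ ≤ b ⁻¹ᵁ V) (h' : ⊤ ≤ b ⁻¹ᵁ (i.U.1 ⊓ j.U.1)) :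
    (transition i j).map (b.appLE (i.U.1 ⊓ j.U.1) ⊤ h') =
      ((transition i j).map (X.presheaf.map (homOfLE hV).op)).map (b.appLE V ⊤ h) := by
  ext a c
  simp only [Matrix.map_apply]
  rw [← Scheme.Hom.map_appLE b h (homOfLE hV).op]
  rfl

theorem SameLine.refl (i : FramedAffine E) {T : Scheme.{0}} (x : T ⟶ chart i) :
    SameLine i i x x where
  base := rfl
  line := by
    have h : ⊤ ≤ (x ≫ chartProj i) ⁻¹ᵁ (i.U.1 ⊓ i.U.1) := by
      simpa only [inf_idem] using le_preimage i x
    refine ⟨h, 1, ?_⟩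
    rw [map_transition i i _ _ le_rfl h, transition_self]
    simp

theorem SameLine.trans {i j k : FramedAffine E} {T : Scheme.{0}} {x : T ⟶ chart i}
    {y : T ⟶ chart j} {z : T ⟶ chart k} (hxy : SameLine i j x y) (hyz : SameLine j k y z) :
    SameLine i k x z where
  base := hxy.base.trans hyz.base
  line := by
    obtain ⟨h₁, h₂⟩ := hxy
    obtain ⟨h₃, h₄⟩ := hyz
    rw [← h₁] at h₄
    obtain ⟨h, u, hu⟩ := h₂
    obtain ⟨h', v, hv⟩ := h₄
    have hV : ⊤ ≤ (x ≫ chartProj i) ⁻¹ᵁ (i.U.1 ⊓ j.U.1 ⊓ k.U.1) := fun t ht =>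
      ⟨h ht, (h' ht).2⟩
    have hik : ⊤ ≤ (x ≫ chartProj i) ⁻¹ᵁ (i.U.1 ⊓ k.U.1) := fun t ht => ⟨(h ht).1, (h' ht).2⟩
    have e₁ : i.U.1 ⊓ j.U.1 ⊓ k.U.1 ≤ i.U.1 ⊓ j.U.1 := inf_le_left
    have e₂ : i.U.1 ⊓ j.U.1 ⊓ k.U.1 ≤ j.U.1 ⊓ k.U.1 := inf_le_inf_right _ inf_le_right
    have e₃ : i.U.1 ⊓ j.U.1 ⊓ k.U.1 ≤ i.U.1 ⊓ k.U.1 := inf_le_inf_right _ inf_le_left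
    refine ⟨hik, u * v, ?_⟩
    rw [map_transition i k _ _ e₃ hV, transition_mul i j k _ e₁ e₂ e₃, Matrix.map_mul,
      ← map_transition i j _ _ e₁ hV h, ← map_transition j k _ _ e₂ hV h', ← Matrix.mulVec_mulVec, hu,
      Matrix.mulVec_smul, hv, smul_smul]
    rfl

theorem SameLine.symm {i j : FramedAffine E} {T : Scheme.{0}} {x : T ⟶ chart i}
    {y : T ⟶ chart j} (hxy : SameLine i j x y) : SameLine j i y x where
  base := hxy.base.symm
  line := by
    obtain ⟨h₁, h, u, hu⟩ := hxy
    rw [← h₁]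
    have h' : ⊤ ≤ (x ≫ chartProj i) ⁻¹ᵁ (j.U.1 ⊓ i.U.1) := fun t ht => ⟨(h ht).2, (h ht).1⟩
    refine ⟨h', u⁻¹, ?_⟩
    have e₂ : i.U.1 ⊓ j.U.1 ≤ j.U.1 ⊓ i.U.1 := by rw [inf_comm]
    have e₃ : i.U.1 ⊓ j.U.1 ≤ i.U.1 ⊓ i.U.1 := by simp
    have key := transition_mul i j i (i.U.1 ⊓ j.U.1) le_rfl e₂ e₃
    rw [transition_self] at key
    have hm := congrArg (fun M => (M.map ((x ≫ chartProj i).appLE _ ⊤ h)).mulVec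
      ![1, x.appTop (chartCoord i)]) key
    simp only [Matrix.map_mul] at hm
    rw [← map_transition i j _ _ le_rfl h h, ← map_transition j i _ _ e₂ h h', ← Matrix.mulVec_mulVec, hu,
      Matrix.mulVec_smul] at hm
    have : ![1, x.appTop (chartCoord i)] = ((1 : Matrix (Fin 2) (Fin 2) Γ(X, i.U.1 ⊓ j.U.1)).map
      ((x ≫ chartProj i).appLE _ ⊤ h)).mulVec ![1, x.appTop (chartCoord i)] := by
      simp
    rw [this, hm, smul_smul]
    simp

theorem SameLine.comp {i j : FramedAffine E} {T T' : Scheme.{0}} {x : T ⟶ chart i}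
    {y : T ⟶ chart j} (hxy : SameLine i j x y) (g : T' ⟶ T) :
    SameLine i j (g ≫ x) (g ≫ y) where
  base := by simp [hxy.base]
  line := by
    obtain ⟨h₁, h, u, hu⟩ := hxy
    have h' : ⊤ ≤ ((g ≫ x) ≫ chartProj i) ⁻¹ᵁ (i.U.1 ⊓ j.U.1) := by
      intro t _
      have := h (show g t ∈ (⊤ : T.Opens) from trivial)
      change ((g ≫ x) ≫ chartProj i) t ∈ i.U.1 ⊓ j.U.1
      rw [Category.assoc, Scheme.Hom.comp_apply]
      exact this
    refine ⟨h', Units.map g.appTop.hom.toMonoidHom u, ?_⟩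
    have key := congrArg (fun v => g.appTop.hom ∘ v) hu
    have e : ((transition i j).map (((g ≫ x) ≫ chartProj i).appLE (i.U.1 ⊓ j.U.1) ⊤ h')) =
        ((transition i j).map ((x ≫ chartProj i).appLE (i.U.1 ⊓ j.U.1) ⊤ h)).map g.appTop.hom := by
      ext a b
      simp only [Matrix.map_apply]
      have : ((g ≫ x) ≫ chartProj i).appLE (i.U.1 ⊓ j.U.1) ⊤ h' =
        (x ≫ chartProj i).appLE (i.U.1 ⊓ j.U.1) ⊤ h ≫ g.appTop := by
        have hg : ⊤ ≤ g ⁻¹ᵁ ⊤ := fun _ _ => trivial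
        have e₁ : g.appTop = g.appLE ⊤ ⊤ hg := Scheme.Hom.app_eq_appLE g
        rw [e₁, Scheme.Hom.appLE_comp_appLE g (x ≫ chartProj i) _ _ _ h hg]
        simp only [Category.assoc]
      rw [this]
      rfl
    rw [e, Scheme.Hom.comp_appTop, Scheme.Hom.comp_appTop, CommRingCat.comp_apply,
      CommRingCat.comp_apply]
    ext a
    have := congrFun key a
    fin_cases a <;>
    simpa [Matrix.mulVec, dotProduct, Fin.sum_univ_two] using this

theorem SameLine.unique {i j : FramedAffine E} {T : Scheme.{0}} {x : T ⟶ chart i}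
    {y y' : T ⟶ chart j} (h : SameLine i j x y) (h' : SameLine i j x y') : y = y' := by
  refine chart_hom_ext (h.base.symm.trans h'.base) ?_
  obtain ⟨-, h, u, hu⟩ := h
  obtain ⟨-, h', u', hu'⟩ := h'
  have := hu.symm.trans hu'
  have h0 := congrFun this 0
  have h1 := congrFun this 1
  simp at h0 h1
  rw [h0] at h1
  exact (Units.mul_right_inj u').mp h1

/-- The function `g₀₀ + g₀₁ t` on the part of the chart `i` over `Uᵢ ∩ Uⱼ`. -/
def denom (i j : FramedAffine E) : Γ(chart i, chartProj i ⁻¹ᵁ (i.U.1 ⊓ j.U.1)) :=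
  (chartProj i).app _ (transition i j 0 0) +
    (chartProj i).app _ (transition i j 0 1) *
      (chart i).presheaf.map (homOfLE le_top).op (chartCoord i)

/-- The open subset of the chart `i` on which the line `e₁ + t e₂` also belongs to the
chart `j`. -/
def overlap (i j : FramedAffine E) : (chart i).Opens := (chart i).basicOpen (denom i j)

theorem le_preimage_comp {i : FramedAffine E} {V : X.Opens} {T : Scheme.{0}} {x : T ⟶ chart i}
    (h : ⊤ ≤ (x ≫ chartProj i) ⁻¹ᵁ V) : ⊤ ≤ x ⁻¹ᵁ (chartProj i ⁻¹ᵁ V) := h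

theorem mulVec_zero (i j : FramedAffine E) {T : Scheme.{0}} (x : T ⟶ chart i)
    (h : ⊤ ≤ (x ≫ chartProj i) ⁻¹ᵁ (i.U.1 ⊓ j.U.1)) :
    ((transition i j).map ((x ≫ chartProj i).appLE (i.U.1 ⊓ j.U.1) ⊤ h)).mulVec
      ![1, x.appTop (chartCoord i)] 0 =
    x.appLE (chartProj i ⁻¹ᵁ (i.U.1 ⊓ j.U.1)) ⊤ (le_preimage_comp h) (denom i j) := by
  have h1 := Scheme.Hom.comp_appLE x (chartProj i) (i.U.1 ⊓ j.U.1) ⊤ h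
  have hg : ⊤ ≤ x ⁻¹ᵁ ⊤ := fun _ _ => trivial
  have h2 : x.appTop = (chart i).presheaf.map (homOfLE le_top).op ≫
      x.appLE (chartProj i ⁻¹ᵁ (i.U.1 ⊓ j.U.1)) ⊤ (le_preimage_comp h) := by
    rw [Scheme.Hom.map_appLE]
    exact Scheme.Hom.app_eq_appLE x
  rw [h1, h2, denom, map_add, map_mul]
  simp only [Matrix.mulVec, dotProduct, Fin.sum_univ_two, Matrix.map_apply, Matrix.cons_val_zero,
    Matrix.cons_val_one, mul_one]
  rfl

theorem SameLine.top_le {i j : FramedAffine E} {T : Scheme.{0}} {x : T ⟶ chart i}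
    {y : T ⟶ chart j} (hxy : SameLine i j x y) : ⊤ ≤ x ⁻¹ᵁ overlap i j := by
  obtain ⟨-, h, u, hu⟩ := hxy
  have h0 := congrFun hu 0
  rw [mulVec_zero] at h0
  have hU : IsUnit (x.appLE (chartProj i ⁻¹ᵁ (i.U.1 ⊓ j.U.1)) ⊤ (le_preimage_comp h)
      (denom i j)) := by
    rw [h0]; simp
  have := Scheme.basicOpen_of_isUnit _ hU
  rw [Scheme.basicOpen_appLE] at this
  exact this.ge.trans inf_le_right

/-- The lift of a point of the chart `i` to the overlap with the chart `j`. -/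
def liftOverlap {i j : FramedAffine E} {T : Scheme.{0}} (x : T ⟶ chart i)
    (h : ⊤ ≤ x ⁻¹ᵁ overlap i j) : T ⟶ overlap i j :=
  IsOpenImmersion.lift (overlap i j).ι x (by
    rintro _ ⟨t, rfl⟩
    simpa using h (show t ∈ (⊤ : T.Opens) from trivial))

theorem liftOverlap_ι {i j : FramedAffine E} {T : Scheme.{0}} (x : T ⟶ chart i)
    (h : ⊤ ≤ x ⁻¹ᵁ overlap i j) : liftOverlap x h ≫ (overlap i j).ι = x :=
  IsOpenImmersion.lift_fac _ _ _

theorem overlap_le (i j : FramedAffine E) :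
    ⊤ ≤ ((overlap i j).ι ≫ chartProj i) ⁻¹ᵁ (i.U.1 ⊓ j.U.1) := by
  intro t _
  have h := (chart i).basicOpen_le (denom i j) t.2
  exact h

theorem isUnit_denom (i j : FramedAffine E) :
    IsUnit ((overlap i j).ι.appLE (chartProj i ⁻¹ᵁ (i.U.1 ⊓ j.U.1)) ⊤
      (le_preimage_comp (overlap_le i j)) (denom i j)) := by
  have h : IsUnit ((chart i).presheaf.map (homOfLE ((chart i).basicOpen_le (denom i j))).op
    (denom i j)) := (chart i).toRingedSpace.isUnit_res_basicOpen (denom i j)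
  have h2 : ⊤ ≤ (overlap i j).ι ⁻¹ᵁ (chart i).basicOpen (denom i j) := fun t _ => t.2
  have h' := h.map ((overlap i j).ι.appLE ((chart i).basicOpen (denom i j)) ⊤ h2).hom
  have e := Scheme.Hom.map_appLE (overlap i j).ι h2
    (homOfLE ((chart i).basicOpen_le (denom i j))).op
  rw [← e]
  exact h'

/-- The transition map `t ↦ (g₁₀ + g₁₁ t) / (g₀₀ + g₀₁ t)` from the overlap to the chart `j`. -/
def overlapMap (i j : FramedAffine E) : (overlap i j : Scheme.{0}) ⟶ chart j :=
  AffineSpace.homOfVector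
    (IsOpenImmersion.lift j.U.1.ι ((overlap i j).ι ≫ chartProj i) (by
      rintro _ ⟨t, rfl⟩
      simpa using (overlap_le i j (show t ∈ (⊤ : Scheme.Opens _) from trivial)).2))
    (fun _ => ((isUnit_denom i j).unit⁻¹ : Γ((overlap i j : Scheme.{0}), ⊤)ˣ) *
      ((transition i j).map (((overlap i j).ι ≫ chartProj i).appLE _ ⊤
        (overlap_le i j))).mulVec ![1, (overlap i j).ι.appTop (chartCoord i)] 1)

theorem sameLine_overlap (i j : FramedAffine E) :
    SameLine i j (overlap i j).ι (overlapMap i j) where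
  base := by
    have h := fun (f : (overlap i j : Scheme.{0}) ⟶ (j.U.1 : Scheme.{0})) v =>
      AffineSpace.homOfVector_over_assoc (n := Unit) f v j.U.1.ι
    exact ((h _ _).trans (IsOpenImmersion.lift_fac _ _ _)).symm
  line := by
    refine ⟨overlap_le i j, (isUnit_denom i j).unit, ?_⟩
    have hc : (overlapMap i j).appTop (chartCoord j) = _ :=
      AffineSpace.homOfVector_appTop_coord _ _ _
    rw [hc]
    ext a
    fin_cases a
    · refine (mulVec_zero i j _ (overlap_le i j)).trans ?_
      exact (mul_one _).symm
    · exact (Units.mul_inv_cancel_left _ _).symm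

theorem mono_overlap {i j : FramedAffine E} {T : Scheme.{0}} {a b : T ⟶ overlap i j}
    (h : a ≫ (overlap i j).ι = b ≫ (overlap i j).ι) : a = b :=
  (cancel_mono _).mp h

/-- The transition isomorphism between overlaps. -/
def overlapSwap (i j : FramedAffine E) : (overlap i j : Scheme.{0}) ⟶ overlap j i :=
  liftOverlap (overlapMap i j) (sameLine_overlap i j).symm.top_le

theorem overlapSwap_ι (i j : FramedAffine E) :
    overlapSwap i j ≫ (overlap j i).ι = overlapMap i j :=
  liftOverlap_ι _ _

/-- If `x` and `y` are the same line, then `y` is determined by the lift of `x` to the overlap. -/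
theorem SameLine.lift_map {i j : FramedAffine E} {T : Scheme.{0}} {z : T ⟶ overlap i j}
    {y : T ⟶ chart j} (h : SameLine i j (z ≫ (overlap i j).ι) y) : z ≫ overlapMap i j = y :=
  ((sameLine_overlap i j).comp z).unique h

/-- The transition morphism on triple overlaps. -/
def tripleSwap (i j k : FramedAffine E) :
    pullback (overlap i j).ι (overlap i k).ι ⟶ pullback (overlap j k).ι (overlap j i).ι :=
  pullback.lift
    (liftOverlap (pullback.fst (overlap i j).ι (overlap i k).ι ≫ overlapMap i j)
      ((((sameLine_overlap i j).comp (pullback.fst _ _)).symm.trans (by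
        have := (sameLine_overlap i k).comp (pullback.snd (overlap i j).ι (overlap i k).ι)
        rwa [← pullback.condition] at this)).top_le))
    (pullback.fst _ _ ≫ overlapSwap i j)
    (by rw [liftOverlap_ι, Category.assoc, overlapSwap_ι])

theorem tripleSwap_fst (i j k : FramedAffine E) :
    tripleSwap i j k ≫ pullback.fst _ _ ≫ (overlap j k).ι =
      pullback.fst _ _ ≫ overlapMap i j := by
  rw [tripleSwap, pullback.lift_fst_assoc, liftOverlap_ι]

theorem tripleSwap_map (i j k : FramedAffine E) :
    tripleSwap i j k ≫ pullback.fst _ _ ≫ overlapMap j k =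
      pullback.snd _ _ ≫ overlapMap i k := by
  rw [← Category.assoc]
  refine SameLine.lift_map ?_
  rw [Category.assoc, tripleSwap_fst]
  refine ((sameLine_overlap i j).comp (pullback.fst _ _)).symm.trans ?_
  have := (sameLine_overlap i k).comp (pullback.snd (overlap i j).ι (overlap i k).ι)
  rwa [← pullback.condition] at this

theorem tripleSwap_snd_map (i j k : FramedAffine E) :
    tripleSwap i j k ≫ pullback.snd _ _ ≫ overlapMap j i =
      pullback.fst _ _ ≫ (overlap i j).ι := by
  rw [← Category.assoc]
  refine SameLine.lift_map ?_
  rw [Category.assoc, ← pullback.condition, tripleSwap_fst]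
  exact ((sameLine_overlap i j).comp (pullback.fst _ _)).symm

variable (E) in
/-- The gluing data of the projective bundle. -/
def glueData : Scheme.GlueData.{0} where
  J := FramedAffine E
  U := chart
  V := fun p => (overlap p.1 p.2 : Scheme.{0})
  f := fun i j => (overlap i j).ι
  f_open := fun i j => inferInstance
  f_id := fun i => by
    have : overlap i i = ⊤ := by
      have := (SameLine.refl i (𝟙 (chart i))).top_le
      exact top_le_iff.mp this
    have h : SameLine i i (𝟙 (chart i)) (𝟙 _) := SameLine.refl i _
    exact ⟨liftOverlap (𝟙 _) h.top_le, mono_overlap (by simp [liftOverlap_ι]),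
      liftOverlap_ι _ _⟩
  t := overlapSwap
  t_id := fun i => by
    refine mono_overlap ?_
    rw [overlapSwap_ι, Category.id_comp]
    exact (sameLine_overlap i i).unique (SameLine.refl i _)
  t' := tripleSwap
  t_fac := fun i j k => pullback.lift_snd _ _ _
  cocycle := fun i j k => by
    have key : ∀ {T : Scheme.{0}} {a b : T ⟶ pullback (overlap i j).ι (overlap i k).ι},
        a ≫ pullback.fst _ _ ≫ (overlap i j).ι = b ≫ pullback.fst _ _ ≫ (overlap i j).ι →
          a = b := by
      intro T a b h
      have h1 : a ≫ pullback.fst _ _ = b ≫ pullback.fst _ _ := mono_overlap (by simpa using h)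
      refine pullback.hom_ext h1 (mono_overlap ?_)
      rw [Category.assoc, Category.assoc, ← pullback.condition]
      exact h
    refine key ?_
    simp only [Category.assoc, Category.id_comp]
    rw [tripleSwap_fst k i j, tripleSwap_map j k i, tripleSwap_snd_map i j k]

variable (E) in
/-- The projective bundle `ℙ(E)` of lines in a locally free sheaf `E` of rank two, glued from
the charts `{e₁ + t e₂}` of all frames over affine open sets. -/
def projBundle : Scheme.{0} := (glueData E).glued

variable (E) in
/-- The projection `π : ℙ(E) ⟶ X`. -/
def projBundleProj : projBundle E ⟶ X :=
  Multicoequalizer.desc (glueData E).diagram X (fun i => chartProj i) (by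
    rintro ⟨i, j⟩
    exact (sameLine_overlap i j).base.trans
      (congrArg (fun f => f ≫ chartProj j) (overlapSwap_ι i j).symm))

/-- The inclusion of a chart in `ℙ(E)`. -/
def chartι (i : FramedAffine E) : chart i ⟶ projBundle E := (glueData E).ι i

theorem chartι_proj (i : FramedAffine E) : chartι i ≫ projBundleProj E = chartProj i :=
  Multicoequalizer.π_desc _ _ _ _ _

end Bundles

section Forms

variable (X : Scheme.{0}) [X.Over (Spec (.of ℂ))]

/-- The structure map `ℂ → 𝒪(U)` of a complex scheme. -/
def scalars (U : X.Opens) : CommRingCat.of ℂ ⟶ Γ(X, U) :=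
  (Scheme.ΓSpecIso (.of ℂ)).inv ≫ (X ↘ Spec (.of ℂ)).appTop ≫
    X.presheaf.map (homOfLE le_top).op

theorem scalars_map {U V : X.Opens} (h : V ≤ U) :
    𝟙 _ ≫ scalars X V = scalars X U ≫ X.presheaf.map (homOfLE h).op := by
  rw [scalars, scalars, Category.id_comp, Category.assoc, Category.assoc, ← Functor.map_comp]
  rfl

/-- The `𝒪(U)`-module of Kähler differentials of `𝒪(U)` over `ℂ`; for `U` affine, this is the
module of sections over `U` of the cotangent sheaf of `X`. -/
abbrev Forms (U : X.Opens) : Type := CommRingCat.KaehlerDifferential (scalars X U)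

/-- Restriction of differential forms. -/
def resForm {U V : X.Opens} (h : V ≤ U) : Forms X U →+ Forms X V :=
  (CommRingCat.KaehlerDifferential.map (scalars_map X h)).hom.toAddMonoidHom

theorem resForm_smul {U V : X.Opens} (h : V ≤ U) (a : Γ(X, U)) (s : Forms X U) :
    resForm X h (a • s) = X.presheaf.map (homOfLE h).op a • resForm X h s :=
  (CommRingCat.KaehlerDifferential.map (scalars_map X h)).hom.map_smul a s

/-- A global differential form, an element of `H⁰(X, Ω¹)`: a compatible family of forms on the
affine open subsets. -/
structure GlobalForm where
  app : ∀ U : X.affineOpens, Forms X U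
  res_app : ∀ (U V : X.affineOpens) (h : V.1 ≤ U.1), resForm X h (app U) = app V

variable {X} (E : X.Modules)

/-- The restriction map of `E ⊗ Ω¹`. -/
def resTensor {U V : X.Opens} (h : V ≤ U) :
    Γ(E, U) ⊗[Γ(X, U)] Forms X U →+ Γ(E, V) ⊗[Γ(X, V)] Forms X V :=
  TensorProduct.liftAddHom
    (AddMonoidHom.mk' (fun s => ((TensorProduct.mk Γ(X, V) Γ(E, V) (Forms X V)
      (res E h s)).toAddMonoidHom.comp (resForm X h))) (fun s s' => by
        ext; simp))
    (fun a s ω => by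
      simp [res_smul, resForm_smul])

/-- A Higgs field `φ : E ⟶ E ⊗ Ω¹` (the integrability condition `φ ∧ φ = 0` is void on a curve),
given by its action on sections over affine open subsets. -/
structure HiggsField where
  app : ∀ U : X.affineOpens, Γ(E, U.1) →ₗ[Γ(X, U.1)] Γ(E, U.1) ⊗[Γ(X, U.1)] Forms X U
  res_app : ∀ (U V : X.affineOpens) (h : V.1 ≤ U.1) (s : Γ(E, U.1)),
    resTensor E h (app U s) = app V (res E h s)

variable {E} (φ : HiggsField E)

/-- `φ` is in the center: `φ = id ⊗ η` for a global form `η`. -/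
def HiggsField.IsCentral : Prop :=
  ∃ η : GlobalForm X, ∀ (U : X.affineOpens) (s : Γ(E, U.1)), φ.app U s = s ⊗ₜ η.app U

/-- The matrix of one-forms of `φ` in a frame: `φ(e_b) = ∑ a, e_a ⊗ φ_ab`. -/
def HiggsField.matrix (i : FramedAffine E) : Matrix (Fin 2) (Fin 2) (Forms X i.U) :=
  fun a b => TensorProduct.lid Γ(X, i.U.1) (Forms X i.U)
    (((i.frame.basis le_rfl).coord a).rTensor (Forms X i.U) (φ.app i.U (i.frame.vec b)))

/-- The greatest common divisor of the entries of `φ`, normalized to `φ₁₁ = 0` by subtracting a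
multiple of the identity, is `1` in this frame: every function that divides all of `φ₁₂`, `φ₂₁`
and `φ₂₂ - φ₁₁` is invertible. -/
def HiggsField.GcdEqOne (i : FramedAffine E) : Prop :=
  ∀ d : Γ(X, i.U.1),
    (∃ η : Forms X i.U, φ.matrix i 0 1 = d • η) →
    (∃ η : Forms X i.U, φ.matrix i 1 0 = d • η) →
    (∃ η : Forms X i.U, φ.matrix i 1 1 - φ.matrix i 0 0 = d • η) → IsUnit d

/-- The discriminant `Δ = (φ₂₂ - φ₁₁)² + 4 φ₁₂ φ₂₁` of the characteristic polynomial of `φ` in a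
frame, a section of `Ω¹ ⊗ Ω¹`. -/
def HiggsField.disc (i : FramedAffine E) : Forms X i.U ⊗[Γ(X, i.U.1)] Forms X i.U :=
  (φ.matrix i 1 1 - φ.matrix i 0 0) ⊗ₜ (φ.matrix i 1 1 - φ.matrix i 0 0) +
    (4 : Γ(X, i.U.1)) • (φ.matrix i 0 1 ⊗ₜ φ.matrix i 1 0)

/-- The discriminant is zero. -/
def HiggsField.DiscEqZero : Prop := ∀ i : FramedAffine E, φ.disc i = 0

/-- The discriminant is the square of a global section of `Ω¹`. -/
def HiggsField.DiscIsSquare : Prop :=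
  ∃ η : GlobalForm X, ∀ i : FramedAffine E, φ.disc i = η.app i.U ⊗ₜ η.app i.U

/-- The local equations `φ₂₁ + t (φ₂₂ - φ₁₁) - t² φ₁₂ = 0` of the Higgs Grassmannian in a chart
`{e₁ + t e₂}` of `ℙ(E)`, contracted with the vector fields on the base. They say that
`φ(e₁ + t e₂)` is a multiple of `e₁ + t e₂`. -/
def HiggsField.equations (i : FramedAffine E) : Ideal Γ(chart i, ⊤) :=
  Ideal.span (Set.range fun v : Module.Dual Γ(X, i.U.1) (Forms X i.U) =>
    let c : Γ(X, i.U.1) → Γ(chart i, ⊤) :=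
      (chartProj i).appLE i.U.1 ⊤ (by simpa using le_preimage i (𝟙 (chart i)))
    c (v (φ.matrix i 1 0)) + chartCoord i * c (v (φ.matrix i 1 1 - φ.matrix i 0 0)) -
      chartCoord i ^ 2 * c (v (φ.matrix i 0 1)))

/-- The ideal sheaf of the Higgs Grassmannian in `ℙ(E)`: the smallest ideal sheaf that contains
the local equations in all charts. -/
def HiggsField.idealSheaf : (projBundle E).IdealSheafData :=
  sInf {I | ∀ i : FramedAffine E,
    Scheme.IdealSheafData.ofIdealTop (φ.equations i) ≤ I.comap (chartι i)}

/-- The Higgs Grassmannian of rank one Higgs subbundles, a closed subscheme of `ℙ(E)`. -/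
def HiggsField.grass : Scheme.{0} := φ.idealSheaf.subscheme

/-- The closed immersion of the Higgs Grassmannian in `ℙ(E)`. -/
def HiggsField.grassι : φ.grass ⟶ projBundle E := φ.idealSheaf.subschemeι

/-- The projection `ρ₁` of the Higgs Grassmannian to the base. -/
def HiggsField.grassProj : φ.grass ⟶ X := φ.grassι ≫ projBundleProj E

/-- The sections of `ρ₁`. -/
def HiggsField.Sections : Type := {σ : X ⟶ φ.grass // σ ≫ φ.grassProj = 𝟙 X}

variable (E) in
/-- A line subbundle of `E`: a subsheaf of modules which is locally generated by the first vector
of a frame of `E`, that is, locally free of rank one with locally free quotient. -/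
@[ext]
structure LineSubbundle where
  carrier : ∀ U : X.Opens, Submodule Γ(X, U) Γ(E, U)
  res_mem : ∀ (U V : X.Opens) (h : V ≤ U), ∀ s ∈ carrier U, res E h s ∈ carrier V
  mem_of_local : ∀ (U : X.Opens) (s : Γ(E, U)),
    (∀ x ∈ U, ∃ (V : X.Opens) (h : V ≤ U), x ∈ V ∧ res E h s ∈ carrier V) → s ∈ carrier U
  locally_span : ∀ x : X, ∃ (U : X.Opens) (e : Frame E 2 U), x ∈ U ∧
    ∀ (V : X.Opens) (h : V ≤ U), carrier V = Submodule.span Γ(X, V) {res E h (e.vec 0)}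

/-- The line subbundles `L` of `E` with `φ(L) ⊆ L ⊗ Ω¹`. -/
def HiggsField.LineSubbundles : Type :=
  {L : LineSubbundle E // ∀ (U : X.affineOpens), ∀ s ∈ L.carrier U.1,
    φ.app U s ∈ LinearMap.range ((L.carrier U.1).subtype.rTensor (Forms X U))}

end Forms

end HiggsGrass
end

/-!
The Higgs Grassmannian is studied through frames `(e₁, e₂)` in which it becomes an explicit curve.

*The base.* The module of differentials of a smooth curve is locally generated by one form. By
`exists_localParameter`, every closed point has a neighbourhood whose ring of functions is reduced
and in which the ideal of the point is generated by one function, a local parameter. So the curve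
is integral (`isIntegral_of_smooth`) and normal (`isIntegrallyClosed_of_smooth`). Differentials on
an affine open set localize (`span_and_extend_forms`); this makes the equations of the Higgs
Grassmannian, which are indexed by vector fields, independent of the chart
(`SameLine.map_equations_eq`), so that the Higgs Grassmannian is cut out by these equations in each
chart (`exists_lift_grass`, `map_equations_eq_bot`).

*Greatest common divisor one.* At a closed point, one of `φ₁₂`, `φ₂₁`, `φ₂₂ - φ₁₁` does not vanish:
otherwise a local parameter divides all of them. Exchanging the two vectors of the frame or
replacing `e₂` by `e₁ + e₂` makes `φ₁₂` a generator `ω` of the differentials near the point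
(`exists_isAdapted`). In such an adapted frame, `φ₂₂ - φ₁₁ = α ω` and `φ₂₁ = β ω`, the line spanned
by `e₂` is not invariant, and the Higgs Grassmannian is the curve `t² = α t + β` in the chart
`{e₁ + t e₂}` (`IsAdapted.exists_isPullback`). So `ρ₁` is finite and flat of degree two.

Fix one adapted frame, with domain `U`. Sections of `ρ₁` and Higgs line subbundles restrict to
roots of `t² - α t - β` in `𝒪(U)`. Conversely such a root extends to all of the curve: in an adapted
frame near another point it becomes a root on a dense open subset of a quadratic polynomial, and
these roots extend because the curve is normal (`exists_root_extension`). Hence both sets are in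
bijection with the roots (`IsAdapted.nonempty_roots_equiv_sections`, `IsAdapted.bijective_line`).
By completing the square, roots correspond to square roots of `δ = α² + 4 β` (`rootsEquiv`). The
discriminant of `φ` is `δ ω ⊗ ω`, so it vanishes if and only if `δ = 0`
(`IsAdapted.discEqZero_iff`), and it is a square if and only if `δ` is one
(`IsAdapted.discIsSquare_iff`, again by normality). If there is no root, the quadratic polynomials
of all adapted frames are prime (`prime_curvePoly`), and the Higgs Grassmannian is covered by
spectra of domains that meet each other. Two roots factor the polynomial and make the Higgs
Grassmannian reducible. If `δ = 0`, there is one double root, and translating it to zero turns the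
equation into `t² = 0`.

*Greatest common divisor not one.* The entries are divisible by a local parameter `π` at a closed
point `b` (`exists_parameter_dvd`), so all lines over `b` belong to the Higgs Grassmannian. The
fibre over `b` is the closure of the point given by the prime ideal `π R[t]` of a chart, and this
prime ideal contains no smaller nonzero prime ideal (`eq_map_C_of_le`). Since `φ` is not central,
the equations are not all zero (`isCentral_of_matrix`); therefore the fibre is an irreducible
component. It has more than one point and is irreducible, so it is not discrete and `ρ₁` is not
finite (`exists_vertical_component`).
-/

noncomputable section

namespace HiggsGrass

/-! ### Local parameters: commutative algebra -/

section SmoothCurveAlgebra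

variable {k R : Type*} [Field k] [CommRing R] [Algebra k R]

/-- The Nullstellensatz: a maximal ideal of an algebra of finite type over an algebraically closed
field is the kernel of the evaluation at a rational point. -/
theorem exists_algHom_ker_eq [IsAlgClosed k] [Algebra.FiniteType k R] (m : Ideal R)
    [hm : m.IsMaximal] :
    ∃ c : R →ₐ[k] k, ∀ f, f ∈ m ↔ c f = 0 := by
  let := Ideal.Quotient.field m
  have h1 : Algebra.FiniteType k (R ⧸ m) := inferInstance
  have h2 : Module.Finite k (R ⧸ m) := finite_of_finite_type_of_isJacobsonRing k (R ⧸ m)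
  have h3 := IsAlgClosed.algebraMap_bijective_of_isIntegral (k := k) (K := R ⧸ m)
  let e : k ≃ₐ[k] (R ⧸ m) := AlgEquiv.ofBijective (Algebra.ofId k (R ⧸ m)) h3
  refine ⟨e.symm.toAlgHom.comp (Ideal.Quotient.mkₐ k m), fun f => ?_⟩
  change _ ↔ e.symm (Ideal.Quotient.mk m f) = 0
  rw [map_eq_zero_iff _ e.symm.injective, Ideal.Quotient.eq_zero_iff_mem]

/-- Subtracting the value at a closed point is a derivation modulo the square of the maximal
ideal. -/
def valueDerivation (m : Ideal R) (c : R →ₐ[k] k) (hc : ∀ f, f ∈ m ↔ c f = 0) :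
    Derivation k R (R ⧸ m ^ 2) :=
  Derivation.mk'
    ((Ideal.Quotient.mkₐ k (m ^ 2)).toLinearMap ∘ₗ
      (LinearMap.id - (Algebra.linearMap k R) ∘ₗ c.toLinearMap))
    (fun a b => by
      have ha : a - algebraMap k R (c a) ∈ m := by simp [hc]
      have hb : b - algebraMap k R (c b) ∈ m := by simp [hc]
      have h := (Ideal.Quotient.eq_zero_iff_mem (I := m ^ 2)).mpr
        (pow_two m ▸ Ideal.mul_mem_mul ha hb)
      simp only [Algebra.smul_def, LinearMap.coe_comp, Function.comp_apply, LinearMap.sub_apply,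
        LinearMap.id_coe, id_eq, AlgHom.toLinearMap_apply, map_mul, Algebra.linearMap_apply,
        Ideal.Quotient.mkₐ_eq_mk, map_sub, Ideal.Quotient.algebraMap_eq] at h ⊢
      linear_combination -h)

theorem valueDerivation_apply (m : Ideal R) (c : R →ₐ[k] k) (hc : ∀ f, f ∈ m ↔ c f = 0) (f : R) :
    valueDerivation m c hc f = Ideal.Quotient.mk (m ^ 2) (f - algebraMap k R (c f)) := rfl

/-- If the module of differentials is generated by one element, every maximal ideal is generated
by one element near the corresponding point. -/
theorem exists_smul_maximal_le_span [IsAlgClosed k] [Algebra.FiniteType k R]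
    (ω : Ω[R⁄k]) (hω : ∀ η : Ω[R⁄k], ∃ r : R, η = r • ω)
    (m : Ideal R) [hm : m.IsMaximal] :
    ∃ r π : R, r - 1 ∈ m ∧ π ∈ m ∧ ∀ x ∈ m, ∃ y, r * x = π * y := by
  obtain ⟨c, hc⟩ := exists_algHom_ker_eq (k := k) m
  have : IsNoetherianRing R := Algebra.FiniteType.isNoetherianRing k R
  let l := (valueDerivation m c hc).liftKaehlerDifferential
  have hl : ∀ f, l (KaehlerDifferential.D k R f) =
      Ideal.Quotient.mk (m ^ 2) (f - algebraMap k R (c f)) := fun f =>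
    (Derivation.liftKaehlerDifferential_comp_D _ f).trans (valueDerivation_apply m c hc f)
  have hrange : ∀ η, ∃ π ∈ m, l η = Ideal.Quotient.mk (m ^ 2) π := by
    intro η
    have hη : η ∈ Submodule.span R (Set.range (KaehlerDifferential.D k R)) := by
      rw [KaehlerDifferential.span_range_derivation]; trivial
    induction hη using Submodule.span_induction with
    | mem x hx =>
      obtain ⟨f, rfl⟩ := hx
      exact ⟨_, by simp [hc], hl f⟩
    | zero => exact ⟨0, m.zero_mem, by simp⟩
    | add x y _ _ hx hy =>
      obtain ⟨a, ha, ha'⟩ := hx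
      obtain ⟨b, hb, hb'⟩ := hy
      exact ⟨a + b, m.add_mem ha hb, by rw [map_add, map_add, ha', hb']⟩
    | smul r x _ hx =>
      obtain ⟨a, ha, ha'⟩ := hx
      exact ⟨r * a, m.mul_mem_left r ha, by rw [map_smul, ha', Algebra.smul_def, map_mul]; rfl⟩
  obtain ⟨π, hπ, hπ'⟩ := hrange ω
  -- the map `Ω → R / m²` sends `df` to `f` for `f ∈ m`, so `π` generates `m / m²`; then apply
  -- Nakayama's lemma
  have hle : m ≤ Ideal.span {π} ⊔ m • m := by
    intro f hf
    obtain ⟨r, hr⟩ := hω (KaehlerDifferential.D k R f)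
    have h1 : Ideal.Quotient.mk (m ^ 2) f = Ideal.Quotient.mk (m ^ 2) (r * π) := by
      have h2 := hl f
      rw [hr, map_smul, hπ', (hc f).mp hf] at h2
      simpa [Algebra.smul_def] using h2.symm
    rw [Ideal.Quotient.eq] at h1
    have : f = r * π + (f - r * π) := by ring
    rw [this, smul_eq_mul, ← pow_two]
    exact Submodule.add_mem_sup (Ideal.mem_span_singleton'.mpr ⟨r, rfl⟩) h1
  obtain ⟨r, hr, hr'⟩ := Submodule.exists_sub_one_mem_and_smul_le_of_fg_of_le_sup
    (IsNoetherian.noetherian m) le_rfl hle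
  refine ⟨r, π, hr, hπ, fun x hx => ?_⟩
  obtain ⟨y, hy⟩ := Ideal.mem_span_singleton'.mp (hr' (Submodule.smul_mem_pointwise_smul x r m hx))
  exact ⟨y, by rw [mul_comm π y, hy]; rfl⟩

/-- A smooth irreducible curve is reduced near every closed point, and the maximal ideal of the
point is principal there. If the local parameter `π` were nilpotent with `π ^ n = 0`, the relation
`n π ^ (n - 1) dπ = 0` would contradict that `dπ` is a local generator of the differentials. -/
theorem exists_reduced_principal [IsAlgClosed k] [CharZero k] [Algebra.FiniteType k R]
    (ω : Ω[R⁄k])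
    (hω : Function.Bijective fun r : R => r • ω) (m : Ideal R) [hm : m.IsMaximal]
    (hN : (nilradical R).IsPrime) :
    ∃ f π : R, f ∉ m ∧ π ∈ m ∧ (∀ x ∈ m, ∃ y, f * x = π * y) ∧
      ∀ x ∈ nilradical R, f * x = 0 := by
  obtain ⟨c, hc⟩ := exists_algHom_ker_eq (k := k) m
  have : IsNoetherianRing R := Algebra.FiniteType.isNoetherianRing k R
  obtain ⟨r, π, hr, hπ, hπ'⟩ := exists_smul_maximal_le_span ω
    (fun η => (hω.2 η).imp fun _ h => h.symm) m
  have hinj : ∀ a b : R, a • ω = b • ω → a = b := fun a b h => hω.1 h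
  have hone : (1 : R) ∉ m := (Ideal.ne_top_iff_one m).mp hm.ne_top
  have hrm : r ∉ m := fun h => hone (by simpa using m.sub_mem h hr)
  let d := KaehlerDifferential.D k R
  have hNm : nilradical R ≤ m := by
    intro x hx
    obtain ⟨n, hn⟩ := mem_nilradical.mp hx
    exact hm.isPrime.mem_of_pow_mem n (hn ▸ m.zero_mem)
  have hnil : ¬ IsNilpotent π := by
    intro hnil
    obtain ⟨a, ha⟩ := hω.2 (d π)
    have ha : a • ω = d π := ha
    -- if `dπ ∈ m Ω`, then `r Ω ⊆ m Ω` because `π` generates `r m`, but `Ω` is free of rank one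
    have ham : a ∉ m := by
      intro ham
      have hdf : ∀ η : Ω[R⁄k], ∃ x ∈ m, r • η = x • ω := by
        intro η
        have hη : η ∈ Submodule.span R (Set.range (KaehlerDifferential.D k R)) := by
          rw [KaehlerDifferential.span_range_derivation]; trivial
        induction hη using Submodule.span_induction with
        | mem x hx =>
          obtain ⟨f, rfl⟩ := hx
          have hg : f - algebraMap k R (c f) ∈ m := by simp [hc]
          set g := f - algebraMap k R (c f) with hgdef
          have hdg : d g = d f := by simp [hgdef]
          obtain ⟨y, hy⟩ := hπ' g hg
          have h1 := congrArg d hy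
          rw [Derivation.leibniz, Derivation.leibniz, hdg, ← ha] at h1
          obtain ⟨u, hu⟩ := hω.2 (d r)
          obtain ⟨v, hv⟩ := hω.2 (d y)
          simp only at hu hv
          rw [← hu, ← hv] at h1
          refine ⟨π * v + y * a - g * u, m.sub_mem (m.add_mem (m.mul_mem_right _ hπ)
            (m.mul_mem_left _ ham)) (m.mul_mem_right _ hg), ?_⟩
          rw [← eq_sub_iff_add_eq] at h1
          rw [show KaehlerDifferential.D k R f = d f from rfl, h1]
          module
        | zero => exact ⟨0, m.zero_mem, by simp⟩
        | add x y _ _ hx hy =>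
          obtain ⟨s, hs, hs'⟩ := hx
          obtain ⟨t, ht, ht'⟩ := hy
          exact ⟨s + t, m.add_mem hs ht, by rw [smul_add, hs', ht', add_smul]⟩
        | smul b x _ hx =>
          obtain ⟨s, hs, hs'⟩ := hx
          exact ⟨b * s, m.mul_mem_left b hs, by rw [smul_comm, hs', smul_smul]⟩
      obtain ⟨x, hx, hx'⟩ := hdf ω
      exact hrm (hinj _ _ hx' ▸ hx)
    -- since `π` is nilpotent, `m` is the only maximal ideal, and so `a` is a unit
    have hmN : m ≤ nilradical R := by
      intro x hx
      obtain ⟨y, hy⟩ := hπ' x hx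
      refine (hN.mem_or_mem (hy ▸ Ideal.mul_mem_right y _ (mem_nilradical.mpr hnil))).resolve_left
        fun h => hrm (hNm h)
    have hau : IsUnit a := by
      by_contra h
      obtain ⟨M, hM, haM⟩ := exists_max_ideal_of_mem_nonunits h
      have : m ≤ M := hmN.trans (nilradical_le_prime M)
      exact ham (hm.eq_of_le hM.ne_top this ▸ haM)
    classical
    obtain ⟨n, hn, hmin⟩ : ∃ n, π ^ n = 0 ∧ ∀ l < n, π ^ l ≠ 0 :=
      ⟨Nat.find hnil, Nat.find_spec hnil, fun l hl => Nat.find_min hnil hl⟩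
    rcases n with _ | n
    · exact hone (by rw [show (1 : R) = 0 by simpa using hn]; exact m.zero_mem)
    · have h1 := congrArg d hn
      rw [Derivation.leibniz_pow, map_zero, ← ha, Nat.add_sub_cancel, ← Nat.cast_smul_eq_nsmul R,
        smul_smul, smul_smul] at h1
      have h2 : ((n + 1 : ℕ) : R) * (π ^ n * a) = 0 := hinj _ 0 (by rw [zero_smul, ← h1, mul_assoc])
      have h3 : IsUnit ((n + 1 : ℕ) : R) := by
        have : IsUnit (algebraMap k R ((n + 1 : ℕ) : k)) :=
          (IsUnit.mk0 _ (Nat.cast_ne_zero.mpr n.succ_ne_zero)).map _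
        simpa using this
      rw [h3.mul_right_eq_zero, hau.mul_left_eq_zero] at h2
      exact hmin n n.lt_succ_self h2
  -- a nilpotent function is a multiple of `π`, with nilpotent cofactor since the nilradical is
  -- prime; by Nakayama's lemma the nilradical vanishes near the point
  have hNle : nilradical R ≤ m • nilradical R := by
    intro x hx
    obtain ⟨y, hy⟩ := hπ' x (hNm hx)
    have hyN : y ∈ nilradical R :=
      (hN.mem_or_mem (hy ▸ Ideal.mul_mem_left _ r hx)).resolve_left
        fun h => hnil (mem_nilradical.mp h)
    have : x = π * y - (r - 1) * x := by rw [← hy]; ring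
    rw [this]
    exact sub_mem (Submodule.smul_mem_smul hπ hyN) (Submodule.smul_mem_smul hr hx)
  obtain ⟨s, hs, hs'⟩ := Submodule.exists_sub_one_mem_and_smul_eq_zero_of_fg_of_le_smul m _
    (IsNoetherian.noetherian (nilradical R)) hNle
  have hsm : s ∉ m := fun h => hone (by simpa using m.sub_mem h hs)
  refine ⟨r * s, π, fun h => (hm.isPrime.mem_or_mem h).elim hrm hsm, hπ, fun x hx => ?_,
    fun x hx => ?_⟩
  · obtain ⟨y, hy⟩ := hπ' x hx
    exact ⟨s * y, by linear_combination s * hy⟩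
  · have : s * x = 0 := hs' x hx
    rw [mul_assoc, this, mul_zero]

end SmoothCurveAlgebra

/-- In a Noetherian domain with a principal maximal ideal `m = (π)`, a nonzero prime ideal of the
polynomial ring contained in `m R[X]` is equal to it. -/
theorem eq_map_C_of_le {R : Type*} [CommRing R] [IsDomain R] [IsNoetherianRing R] (π : R)
    (hπ : (Ideal.span {π}).IsMaximal) (P : Ideal (Polynomial R)) [P.IsPrime]
    (hP : P ≤ (Ideal.span {π}).map Polynomial.C) (hP0 : P ≠ ⊥) :
    P = (Ideal.span {π}).map Polynomial.C := by
  refine le_antisymm hP ?_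
  rw [Ideal.map_span, Set.image_singleton] at hP ⊢
  rw [Ideal.span_singleton_le_iff_mem]
  by_contra hπP
  refine hP0 (le_bot_iff.mp ?_)
  -- if `π ∉ P`, elements of `P` can be divided by `π` within `P`, so that `P` is contained in all
  -- powers of `(π)`; apply Krull's intersection theorem
  rw [← Ideal.iInf_pow_eq_bot_of_isDomain (Ideal.span {Polynomial.C π}) ?_]
  · refine le_iInf fun n => ?_
    rw [Ideal.span_singleton_pow]
    induction n with
    | zero => simp
    | succ n ih =>
      intro p hp
      obtain ⟨q, hq⟩ := Ideal.mem_span_singleton'.mp (ih hp)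
      have hq' : q ∈ P := (Ideal.IsPrime.mem_or_mem ‹_› (hq ▸ hp)).resolve_right
        fun h => hπP (Ideal.IsPrime.mem_of_pow_mem ‹_› n h)
      obtain ⟨q', hq'⟩ := Ideal.mem_span_singleton'.mp (hP hq')
      exact Ideal.mem_span_singleton'.mpr ⟨q', by rw [← hq, ← hq']; ring⟩
  · intro h
    rw [Ideal.span_singleton_eq_top] at h
    exact hπ.ne_top (Ideal.span_singleton_eq_top.mpr (Polynomial.isUnit_C.mp h))

/-! ### Dual bases of projective modules -/

section DualBasis

variable {R M : Type*} [CommRing R] [AddCommGroup M] [Module R M]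

theorem exists_dual_basis [Module.Finite R M] [Module.Projective R M] :
    ∃ (n : ℕ) (v : Fin n → Module.Dual R M) (m : Fin n → M), ∀ x, x = ∑ k, v k x • m k := by
  obtain ⟨n, f, g, -, -, h⟩ := Module.Finite.exists_comp_eq_id_of_projective R M
  refine ⟨n, fun k => LinearMap.proj k ∘ₗ g, fun k => f (Pi.single k 1), fun x => ?_⟩
  have h1 : f (g x) = x := LinearMap.congr_fun h x
  conv_lhs => rw [← h1, pi_eq_sum_univ' (g x), map_sum]
  refine Finset.sum_congr rfl fun k _ => ?_
  rw [map_smul]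
  rfl

theorem eq_zero_of_forall_dual [Module.Finite R M] [Module.Projective R M] {x : M}
    (h : ∀ v : Module.Dual R M, v x = 0) : x = 0 := by
  obtain ⟨n, v, m, hv⟩ := exists_dual_basis (R := R) (M := M)
  rw [hv x]
  simp [h]

end DualBasis

/-! ### Differentials and local rings of a smooth curve -/

section FormsLocal

variable {X : Scheme.{0}} [X.Over (Spec (.of ℂ))]

theorem smooth_scalars [Smooth (X ↘ Spec (.of ℂ))] (U : X.affineOpens) :
    (scalars X U.1).hom.Smooth := by
  have h := (X ↘ Spec (.of ℂ)).smooth_appLE (isAffineOpen_top _) U.2 le_top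
  have h2 : (Scheme.ΓSpecIso (.of ℂ)).inv.hom.Smooth := by
    let := (Scheme.ΓSpecIso (.of ℂ)).inv.hom.toAlgebra
    have : Algebra.Etale (CommRingCat.of ℂ) Γ(Spec (.of ℂ), ⊤) :=
      RingHom.Etale.of_bijective (f := (Scheme.ΓSpecIso (.of ℂ)).inv.hom)
        (ConcreteCategory.bijective_of_isIso (Scheme.ΓSpecIso (.of ℂ)).inv)
    exact inferInstanceAs (Algebra.Smooth (CommRingCat.of ℂ) Γ(Spec (.of ℂ), ⊤))
  exact RingHom.Smooth.comp h2 h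

theorem finite_projective_forms [Smooth (X ↘ Spec (.of ℂ))] (U : X.affineOpens) :
    Module.Finite Γ(X, U.1) (Forms X U) ∧ Module.Projective Γ(X, U.1) (Forms X U) := by
  let := (scalars X U.1).hom.toAlgebra
  have h : Algebra.Smooth (CommRingCat.of ℂ) Γ(X, U.1) := smooth_scalars U
  exact ⟨inferInstanceAs (Module.Finite Γ(X, U.1) (Ω[Γ(X, U.1)⁄(CommRingCat.of ℂ)])),
    inferInstanceAs (Module.Projective Γ(X, U.1) (Ω[Γ(X, U.1)⁄(CommRingCat.of ℂ)]))⟩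

instance [Smooth (X ↘ Spec (.of ℂ))] (U : X.affineOpens) : Module.Finite Γ(X, U.1) (Forms X U) :=
  (finite_projective_forms U).1

instance [Smooth (X ↘ Spec (.of ℂ))] (U : X.affineOpens) :
    Module.Projective Γ(X, U.1) (Forms X U) :=
  (finite_projective_forms U).2

omit [X.Over (Spec (.of ℂ))] in
theorem etale_restriction {U V : X.affineOpens} (h : V.1 ≤ U.1) :
    (X.presheaf.map (homOfLE h).op).hom.Etale := by
  have h1 := (𝟙 X : X ⟶ X).etale_appLE U.2 V.2 h
  simpa [Scheme.Hom.appLE] using! h1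

/-- Differential forms on an affine open subset are obtained by base change from a larger affine
open subset: they are spanned by the restrictions, and functionals extend. -/
theorem span_and_extend_forms {U V : X.affineOpens} (h : V.1 ≤ U.1) :
    Submodule.span Γ(X, V.1) (Set.range (resForm X h)) = ⊤ ∧
    ∀ v : Module.Dual Γ(X, U.1) (Forms X U), ∃ v' : Module.Dual Γ(X, V.1) (Forms X V),
      ∀ η, v' (resForm X h η) = X.presheaf.map (homOfLE h).op (v η) := by
  let a1 : Algebra (CommRingCat.of ℂ) Γ(X, U.1) := (scalars X U.1).hom.toAlgebra
  let a2 : Algebra (CommRingCat.of ℂ) Γ(X, V.1) := (scalars X V.1).hom.toAlgebra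
  let a3 : Algebra Γ(X, U.1) Γ(X, V.1) := (X.presheaf.map (homOfLE h).op).hom.toAlgebra
  have t : IsScalarTower (CommRingCat.of ℂ) Γ(X, U.1) Γ(X, V.1) :=
    IsScalarTower.of_algebraMap_eq' (congrArg CommRingCat.Hom.hom (scalars_map X h))
  have he : Algebra.Etale Γ(X, U.1) Γ(X, V.1) := etale_restriction h
  have hb := KaehlerDifferential.isBaseChange_of_formallyEtale (CommRingCat.of ℂ) Γ(X, U.1)
    Γ(X, V.1)
  constructor
  · refine eq_top_iff.mpr fun ξ _ => ?_
    refine hb.inductionOn ξ (motive := fun ξ => ξ ∈ Submodule.span Γ(X, V.1)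
      (Set.range (resForm X h))) (zero_mem _) (fun η => Submodule.subset_span ⟨η, rfl⟩)
      (fun s η hη => Submodule.smul_mem _ s hη) (fun η η' hη hη' => add_mem hη hη')
  · intro v
    let w : Ω[Γ(X, U.1)⁄(CommRingCat.of ℂ)] →ₗ[Γ(X, U.1)] Γ(X, V.1) :=
      (Algebra.linearMap Γ(X, U.1) Γ(X, V.1)) ∘ₗ v
    exact ⟨hb.lift w, fun η => hb.lift_eq w η⟩

/-- A differential form that is a basis of the module of differential forms. -/
def IsGenerator {U : X.Opens} (ω : Forms X U) : Prop :=
  Function.Bijective fun r : Γ(X, U) => r • ω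

theorem IsGenerator.res {U V : X.affineOpens} (h : V.1 ≤ U.1) {ω : Forms X U}
    (hω : IsGenerator ω) : IsGenerator (resForm X h ω) := by
  obtain ⟨h1, h2⟩ := span_and_extend_forms h
  let e : Γ(X, U.1) ≃ₗ[Γ(X, U.1)] Forms X U :=
    LinearEquiv.ofBijective (LinearMap.toSpanSingleton _ _ ω) hω
  have he : ∀ r, e.symm (r • ω) = r := fun r => e.symm_apply_apply r
  constructor
  · obtain ⟨v, hv⟩ := h2 e.symm.toLinearMap
    have hv1 : v (resForm X h ω) = 1 := by
      have h3 : e.symm ω = 1 := by simpa using he 1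
      rw [hv, LinearEquiv.coe_coe, h3, map_one]
    intro a b hab
    simpa [hv1] using congrArg v hab
  · intro ξ
    have hξ : ξ ∈ Submodule.span Γ(X, V.1) (Set.range (resForm X h)) := h1 ▸ trivial
    induction hξ using Submodule.span_induction with
    | mem x hx =>
      obtain ⟨η, rfl⟩ := hx
      obtain ⟨r, rfl⟩ := hω.2 η
      exact ⟨_, (resForm_smul X h r ω).symm⟩
    | zero => exact ⟨0, zero_smul _ _⟩
    | add x y _ _ hx hy =>
      obtain ⟨a, rfl⟩ := hx
      obtain ⟨b, rfl⟩ := hy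
      exact ⟨a + b, add_smul _ _ _⟩
    | smul r x _ hx =>
      obtain ⟨a, rfl⟩ := hx
      exact ⟨r * a, mul_smul _ _ _⟩

/-- The structure morphism is locally standard smooth of relative dimension one, so the
differentials are locally free of rank one. -/
theorem exists_generator [SmoothOfRelativeDimension 1 (X ↘ Spec (.of ℂ))] (x : X) :
    ∃ (V : X.affineOpens) (ω : Forms X V), x ∈ V.1 ∧ IsGenerator ω := by
  obtain ⟨U, hU, V, hV, hx, e, h⟩ :=
    SmoothOfRelativeDimension.exists_isStandardSmoothOfRelativeDimension
      (n := 1) (f := X ↘ Spec (.of ℂ)) x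
  have hU' : U = ⊤ := by
    refine top_le_iff.mp fun y _ => ?_
    have : y = (X ↘ Spec (.of ℂ)) x := Subsingleton.elim (α := PrimeSpectrum ℂ) _ _
    rw [this]
    exact e hx
  subst hU'
  have : Nonempty V := ⟨⟨x, hx⟩⟩
  have h2 : (Scheme.ΓSpecIso (.of ℂ)).inv.hom.IsStandardSmoothOfRelativeDimension 0 :=
    RingHom.IsStandardSmoothOfRelativeDimension.equiv
      (Scheme.ΓSpecIso (.of ℂ)).symm.commRingCatIsoToRingEquiv
  have h3 : (scalars X V).hom.IsStandardSmoothOfRelativeDimension 1 := h.comp h2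
  let := (scalars X V).hom.toAlgebra
  have h4 : Algebra.IsStandardSmoothOfRelativeDimension 1 (CommRingCat.of ℂ) Γ(X, V) := h3
  have h5 := Algebra.IsStandardSmoothOfRelativeDimension.rank_kaehlerDifferential
    (R := CommRingCat.of ℂ) (S := Γ(X, V)) 1
  have := h4.isStandardSmooth
  have h6 : Module.finrank Γ(X, V) (Ω[Γ(X, V)⁄(CommRingCat.of ℂ)]) = 1 := by
    rw [Module.finrank, h5]; simp
  let b := Module.finBasisOfFinrankEq Γ(X, V) (Ω[Γ(X, V)⁄(CommRingCat.of ℂ)]) h6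
  refine ⟨⟨V, hV⟩, b 0, hx, fun r s hrs => ?_, fun η => ⟨b.repr η 0, ?_⟩⟩
  · have := congrArg (fun ξ => b.repr ξ 0) (show r • b 0 = s • b 0 from hrs)
    simpa using this
  · have := b.sum_repr η
    rwa [Fin.sum_univ_one] at this

omit [X.Over (Spec (.of ℂ))] in
theorem mem_primeIdealOf {U : X.Opens} (hU : IsAffineOpen U) {x : X} (hx : x ∈ U) (f : Γ(X, U)) :
    f ∈ (hU.primeIdealOf ⟨x, hx⟩).asIdeal ↔ x ∉ X.basicOpen f := by
  rw [Scheme.mem_basicOpen X f x hx, ← mem_nonunits_iff, ← IsLocalRing.mem_maximalIdeal]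
  let := TopCat.Presheaf.algebra_section_stalk X.presheaf (⟨x, hx⟩ : U)
  have := hU.isLocalization_stalk ⟨x, hx⟩
  exact (IsLocalization.AtPrime.to_map_mem_maximal_iff
    (X.presheaf.stalk ((⟨x, hx⟩ : U) : X))
    (hU.primeIdealOf ⟨x, hx⟩).asIdeal f).symm

omit [X.Over (Spec (.of ℂ))] in
theorem nilradical_isPrime [IrreducibleSpace X] {U : X.Opens} (hU : IsAffineOpen U)
    (hne : (U : Set X).Nonempty) : (nilradical Γ(X, U)).IsPrime := by
  rw [← PrimeSpectrum.irreducibleSpace_iff_isPrime_nilradical]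
  have h1 : IrreducibleSpace U :=
    (isIrreducible_iff_irreducibleSpace (s := (U : Set X))).mp
      ⟨hne, (IrreducibleSpace.isIrreducible_univ X).2.open_subset U.2 (Set.subset_univ _)⟩
  have h2 := (Scheme.homeoOfIso hU.isoSpec)
  exact h2.surjective.irreducibleSpace h2.continuous

/-- On a smooth irreducible curve every closed point has arbitrarily small affine neighbourhoods
with reduced ring of functions on which the differentials are free of rank one and the ideal of the
point is principal. -/
theorem exists_localParameter [SmoothOfRelativeDimension 1 (X ↘ Spec (.of ℂ))]
    [IrreducibleSpace X] {y : X} (hy : IsClosed {y}) (W : X.Opens) (hyW : y ∈ W) :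
    ∃ V : X.affineOpens, V.1 ≤ W ∧ y ∈ V.1 ∧ _root_.IsReduced Γ(X, V.1) ∧
      (∃ ω : Forms X V, IsGenerator ω) ∧
      ∃ π : Γ(X, V.1), ∀ f, y ∉ X.basicOpen f ↔ f ∈ Ideal.span {π} := by
  have hsm : Smooth (X ↘ Spec (.of ℂ)) := SmoothOfRelativeDimension.smooth 1 _
  obtain ⟨V₀, ω₀, hy₀, hω₀⟩ := exists_generator y
  obtain ⟨V₁, hV₁, hy₁, hle⟩ := (Opens.isBasis_iff_nbhd.mp X.isBasis_affineOpens)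
    (show y ∈ V₀.1 ⊓ W from ⟨hy₀, hyW⟩)
  let U : X.affineOpens := ⟨V₁, hV₁⟩
  have hUV : U.1 ≤ V₀.1 := hle.trans inf_le_left
  have hω := hω₀.res hUV
  let := (scalars X U.1).hom.toAlgebra
  have : Algebra.Smooth (CommRingCat.of ℂ) Γ(X, U.1) := smooth_scalars U
  have : Algebra.FiniteType (CommRingCat.of ℂ) Γ(X, U.1) := inferInstance
  have hm := hV₁.primeIdealOf_isMaximal_of_isClosed ⟨y, hy₁⟩ hy
  have : IsAlgClosed (CommRingCat.of ℂ) := inferInstanceAs (IsAlgClosed ℂ)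
  have : CharZero (CommRingCat.of ℂ) := inferInstanceAs (CharZero ℂ)
  obtain ⟨f, π, hf, hπ, h1, h2⟩ := exists_reduced_principal (k := CommRingCat.of ℂ) _ hω
    (hV₁.primeIdealOf ⟨y, hy₁⟩).asIdeal (nilradical_isPrime hV₁ ⟨y, hy₁⟩)
  have hloc := U.2.isLocalization_basicOpen f
  have hunit : IsUnit (algebraMap Γ(X, U.1) Γ(X, X.basicOpen f) f) :=
    IsLocalization.Away.algebraMap_isUnit f
  have hsurj : ∀ x : Γ(X, X.basicOpen f), ∃ (n : ℕ) (a : Γ(X, U.1)),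
      x * algebraMap Γ(X, U.1) Γ(X, X.basicOpen f) f ^ n = algebraMap Γ(X, U.1) _ a :=
    IsLocalization.Away.surj f
  have hfy : y ∈ X.basicOpen f := by
    by_contra h
    exact hf ((mem_primeIdealOf hV₁ hy₁ f).mpr h)
  have main : _root_.IsReduced Γ(X, X.basicOpen f) ∧ ∃ π : Γ(X, X.basicOpen f),
      ∀ x, y ∉ X.basicOpen x ↔ x ∈ Ideal.span {π} := by
    refine ⟨⟨?_⟩, algebraMap Γ(X, U.1) Γ(X, X.basicOpen f) π, fun x => ?_⟩
    · rintro x ⟨k, hk⟩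
      obtain ⟨n, a, ha⟩ := hsurj x
      have h3 : algebraMap Γ(X, U.1) Γ(X, X.basicOpen f) (a ^ (k + 1)) = 0 := by
        rw [map_pow, ← ha, mul_pow, pow_succ, hk, zero_mul, zero_mul]
      obtain ⟨l, hl⟩ := IsLocalization.Away.exists_of_eq (S := Γ(X, X.basicOpen f)) f
        (h3.trans (map_zero _).symm)
      have h4 : f ^ l * a ∈ nilradical Γ(X, U.1) := mem_nilradical.mpr
        ⟨k + 1, by rw [mul_pow, pow_succ (f ^ l), mul_assoc, hl]; ring⟩
      have h5 := congrArg (algebraMap Γ(X, U.1) Γ(X, X.basicOpen f)) (h2 _ h4)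
      rw [map_mul, map_mul, map_zero, hunit.mul_right_eq_zero, map_pow,
        (hunit.pow l).mul_right_eq_zero, ← ha, (hunit.pow n).mul_left_eq_zero] at h5
      exact h5
    · have hres : ∀ a : Γ(X, U.1),
          X.basicOpen (algebraMap Γ(X, U.1) Γ(X, X.basicOpen f) a) =
            X.basicOpen f ⊓ X.basicOpen a :=
        fun a => X.basicOpen_res a (homOfLE (X.basicOpen_le f)).op
      constructor
      · intro hx
        obtain ⟨n, a, ha⟩ := hsurj x
        have h3 : y ∉ X.basicOpen a := by
          intro hya
          have : y ∈ X.basicOpen (algebraMap Γ(X, U.1) Γ(X, X.basicOpen f) a) := by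
            rw [hres]; exact ⟨hfy, hya⟩
          rw [← ha, Scheme.basicOpen_mul] at this
          exact hx this.1
        obtain ⟨b, hb⟩ := h1 a ((mem_primeIdealOf hV₁ hy₁ a).mpr h3)
        obtain ⟨w, hw⟩ := (hunit.pow (n + 1)).exists_right_inv
        refine Ideal.mem_span_singleton.mpr ⟨algebraMap Γ(X, U.1) Γ(X, X.basicOpen f) b * w, ?_⟩
        have hb' := congrArg (algebraMap Γ(X, U.1) Γ(X, X.basicOpen f)) hb
        rw [map_mul, map_mul, ← ha] at hb'
        rw [← mul_assoc, ← hb']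
        linear_combination -x * hw
      · intro hx hyx
        obtain ⟨z, rfl⟩ := Ideal.mem_span_singleton'.mp hx
        rw [Scheme.basicOpen_mul, hres] at hyx
        exact (mem_primeIdealOf hV₁ hy₁ π).mp hπ hyx.2.2
  exact ⟨⟨X.basicOpen f, U.2.basicOpen f⟩, (X.basicOpen_le f).trans (hle.trans inf_le_right), hfy,
    main.1, ⟨_, hω.res (V := ⟨X.basicOpen f, U.2.basicOpen f⟩) (X.basicOpen_le f)⟩, main.2⟩

theorem exists_isClosed_specializes [QuasiCompact (X ↘ Spec (.of ℂ))] (x : X) :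
    ∃ y : X, IsClosed {y} ∧ x ⤳ y := by
  have : CompactSpace X := QuasiCompact.compactSpace_of_compactSpace (X ↘ Spec (.of ℂ))
  obtain ⟨y, hy, hy'⟩ := (isClosed_closure (s := {x})).exists_closed_singleton
    ⟨x, subset_closure rfl⟩
  exact ⟨y, hy', specializes_iff_mem_closure.mpr hy⟩

/-- Every point specializes to a closed point, near which the curve is reduced. -/
theorem isIntegral_of_smooth [SmoothOfRelativeDimension 1 (X ↘ Spec (.of ℂ))]
    [QuasiCompact (X ↘ Spec (.of ℂ))] [IrreducibleSpace X] : IsIntegral X := by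
  have (x : X) : _root_.IsReduced (X.presheaf.stalk x) := by
    obtain ⟨y, hy, hxy⟩ := exists_isClosed_specializes x
    obtain ⟨V, -, hyV, h, -⟩ := exists_localParameter hy ⊤ trivial
    have hx : x ∈ V.1 := hxy.mem_open V.1.2 hyV
    let := TopCat.Presheaf.algebra_section_stalk X.presheaf (⟨x, hx⟩ : V.1)
    have := V.2.isLocalization_stalk ⟨x, hx⟩
    exact isReduced_localizationPreserves (V.2.primeIdealOf ⟨x, hx⟩).asIdeal.primeCompl _ h
  have := isReduced_of_isReduced_stalk X
  exact isIntegral_of_irreducibleSpace_of_isReduced X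

theorem isNoetherianRing_of_smooth [Smooth (X ↘ Spec (.of ℂ))] (U : X.affineOpens) :
    IsNoetherianRing Γ(X, U.1) := by
  let := (scalars X U.1).hom.toAlgebra
  have : Algebra.Smooth (CommRingCat.of ℂ) Γ(X, U.1) := smooth_scalars U
  have : IsNoetherianRing (CommRingCat.of ℂ) := inferInstanceAs (IsNoetherianRing ℂ)
  exact Algebra.FiniteType.isNoetherianRing (CommRingCat.of ℂ) _

/-- A smooth curve is normal: its local rings at closed points are Noetherian domains with
principal maximal ideal. -/
theorem isIntegrallyClosed_of_smooth [SmoothOfRelativeDimension 1 (X ↘ Spec (.of ℂ))]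
    [IsIntegral X] (U : X.affineOpens) (hU : (U.1 : Set X).Nonempty) :
    IsIntegrallyClosed Γ(X, U.1) := by
  have hUa : IsAffineOpen U.1 := U.2
  have hsm : Smooth (X ↘ Spec (.of ℂ)) := SmoothOfRelativeDimension.smooth 1 _
  have : Nonempty U.1 := hU.to_subtype
  have hnoeth : IsNoetherianRing Γ(X, U.1) := isNoetherianRing_of_smooth U
  have : JacobsonSpace X := LocallyOfFiniteType.jacobsonSpace (X ↘ Spec (.of ℂ))
  refine IsIntegrallyClosed.of_localization_maximal fun p _ hp => ?_
  let p' : PrimeSpectrum Γ(X, U.1) := ⟨p, hp.isPrime⟩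
  let y : X := hUa.fromSpec p'
  have hyU : y ∈ U.1 := by
    have : y ∈ Set.range hUa.fromSpec := ⟨p', rfl⟩
    rwa [hUa.range_fromSpec] at this
  have hyc : IsClosed {y} := by
    have h1 : IsClosed {p'} := (PrimeSpectrum.isClosed_singleton_iff_isMaximal p').mpr hp
    have h2 := (h1.isLocallyClosed.image hUa.fromSpec.isOpenEmbedding.isInducing
      hUa.fromSpec.isOpenEmbedding.isOpen_range.isLocallyClosed)
    refine isClosed_singleton_of_isLocallyClosed_singleton ?_
    convert h2 using 1
    ext z
    constructor
    · rintro rfl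
      exact ⟨p', rfl, rfl⟩
    · rintro ⟨_, rfl, rfl⟩
      rfl
  let := TopCat.Presheaf.algebra_section_stalk X.presheaf (⟨y, hyU⟩ : U.1)
  have h3 : hUa.primeIdealOf ⟨y, hyU⟩ = p' :=
    hUa.fromSpec.isOpenEmbedding.injective (hUa.fromSpec_primeIdealOf ⟨y, hyU⟩)
  have h4 := hUa.isLocalization_stalk ⟨y, hyU⟩
  rw [h3] at h4
  have h4 : IsLocalization.AtPrime (X.presheaf.stalk y) p := h4
  let e := IsLocalization.algEquiv p.primeCompl (X.presheaf.stalk y) (Localization.AtPrime p)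
  have : IsNoetherianRing (X.presheaf.stalk y) :=
    IsLocalization.isNoetherianRing p.primeCompl _ hnoeth
  have hprin : (IsLocalRing.maximalIdeal (X.presheaf.stalk y)).IsPrincipal := by
    obtain ⟨V, -, hyV, -, -, π, hπ⟩ := exists_localParameter hyc ⊤ trivial
    have hVa : IsAffineOpen V.1 := V.2
    let := TopCat.Presheaf.algebra_section_stalk X.presheaf (⟨y, hyV⟩ : V.1)
    have h5 := hVa.isLocalization_stalk ⟨y, hyV⟩
    have h6 := IsLocalization.AtPrime.map_eq_maximalIdeal (hVa.primeIdealOf ⟨y, hyV⟩).asIdeal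
      (X.presheaf.stalk y)
    have h7 : (hVa.primeIdealOf ⟨y, hyV⟩).asIdeal = Ideal.span {π} := by
      ext f
      exact (mem_primeIdealOf hVa hyV f).trans (hπ f)
    rw [← h6, h7, Ideal.map_span, Set.image_singleton]
    exact ⟨_, rfl⟩
  have := ((tfae_of_isNoetherianRing_of_isLocalRing_of_isDomain (X.presheaf.stalk y)).out 4 3).mp
    hprin
  have := this.1
  exact IsIntegrallyClosed.of_equiv e.toRingEquiv

end FormsLocal

/-! ### Contraction of a Higgs field with a vector field -/

section Contraction

variable {X : Scheme.{0}} [X.Over (Spec (.of ℂ))] {E : X.Modules}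

variable (E) in
/-- Contraction of the second factor of `E ⊗ Ω¹` with a vector field. -/
def contract {U : X.Opens} (v : Module.Dual Γ(X, U) (Forms X U)) :
    Γ(E, U) ⊗[Γ(X, U)] Forms X U →ₗ[Γ(X, U)] Γ(E, U) :=
  (TensorProduct.rid Γ(X, U) Γ(E, U)).toLinearMap ∘ₗ v.lTensor Γ(E, U)

theorem contract_tmul {U : X.Opens} (v : Module.Dual Γ(X, U) (Forms X U)) (s : Γ(E, U))
    (η : Forms X U) : contract E v (s ⊗ₜ η) = v η • s := by
  simp [contract]

theorem resTensor_tmul {U V : X.Opens} (h : V ≤ U) (s : Γ(E, U)) (η : Forms X U) :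
    resTensor E h (s ⊗ₜ η) = res E h s ⊗ₜ resForm X h η := by
  simp [resTensor]

theorem contract_resTensor {U V : X.Opens} (h : V ≤ U) (v : Module.Dual Γ(X, U) (Forms X U))
    (v' : Module.Dual Γ(X, V) (Forms X V))
    (hv : ∀ η, v' (resForm X h η) = X.presheaf.map (homOfLE h).op (v η))
    (x : Γ(E, U) ⊗[Γ(X, U)] Forms X U) :
    contract E v' (resTensor E h x) = res E h (contract E v x) := by
  induction x with
  | zero => simp
  | tmul s η => rw [resTensor_tmul, contract_tmul, contract_tmul, res_smul, hv]
  | add x y hx hy => rw [map_add, map_add, hx, hy, map_add, map_add]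

/-- A dual basis of the differentials: a section of `E ⊗ Ω¹` is reconstructed from its contractions
with finitely many vector fields. -/
theorem exists_eq_sum_contract_tmul [Smooth (X ↘ Spec (.of ℂ))] (U : X.affineOpens) :
    ∃ (n : ℕ) (v : Fin n → Module.Dual Γ(X, U.1) (Forms X U.1)) (m : Fin n → Forms X U.1),
      ∀ x : Γ(E, U.1) ⊗[Γ(X, U.1)] Forms X U.1, x = ∑ k, contract E (v k) x ⊗ₜ m k := by
  obtain ⟨n, v, m, hv⟩ := exists_dual_basis (R := Γ(X, U.1)) (M := Forms X U.1)
  refine ⟨n, v, m, fun x => ?_⟩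
  induction x with
  | zero => simp
  | tmul s η =>
    conv_lhs => rw [hv η, TensorProduct.tmul_sum]
    exact Finset.sum_congr rfl fun k _ => by rw [contract_tmul, TensorProduct.smul_tmul]
  | add x y hx hy =>
    conv_lhs => rw [hx, hy, ← Finset.sum_add_distrib]
    exact Finset.sum_congr rfl fun k _ => by rw [map_add, TensorProduct.add_tmul]

/-- A section of `E ⊗ Ω¹` over an affine open set is determined by its contractions. -/
theorem eq_of_forall_contract [Smooth (X ↘ Spec (.of ℂ))] {U : X.affineOpens}
    {x y : Γ(E, U.1) ⊗[Γ(X, U.1)] Forms X U.1} (h : ∀ v, contract E v x = contract E v y) :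
    x = y := by
  obtain ⟨n, v, m, hv⟩ := exists_eq_sum_contract_tmul (E := E) U
  rw [hv x, hv y]
  simp [h]

variable (φ : HiggsField E)

/-- The defining property `φ(e_b) = ∑ a, e_a ⊗ φ_ab` of the matrix of `φ`. -/
theorem app_vec (i : FramedAffine E) (b : Fin 2) :
    φ.app i.U (i.frame.vec b) = ∑ a, i.frame.vec a ⊗ₜ φ.matrix i a b := by
  have key : ∀ x : Γ(E, i.U.1) ⊗[Γ(X, i.U.1)] Forms X i.U.1,
      x = ∑ a, i.frame.vec a ⊗ₜ[Γ(X, i.U.1)] TensorProduct.lid Γ(X, i.U.1) (Forms X i.U)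
        (((i.frame.basis le_rfl).coord a).rTensor (Forms X i.U) x) := by
    intro x
    induction x with
    | zero => simp
    | tmul s η =>
      simp only [LinearMap.rTensor_tmul, TensorProduct.lid_tmul, TensorProduct.tmul_smul,
        TensorProduct.smul_tmul']
      rw [← TensorProduct.sum_tmul]
      congr 1
      conv_lhs => rw [← (i.frame.basis le_rfl).sum_repr s]
      refine Finset.sum_congr rfl fun a _ => ?_
      rw [Frame.basis_apply]
      congr 1
      simp [res]
    | add x y hx hy =>
      conv_lhs => rw [hx, hy, ← Finset.sum_add_distrib]
      exact Finset.sum_congr rfl fun k _ => by rw [map_add, map_add, TensorProduct.tmul_add]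
  exact key _

/-- The matrix of the contraction of `φ` with a vector field on an affine open subset of the domain
of a frame. -/
def contractedMatrix (i : FramedAffine E) {V : X.Opens} (h : V ≤ i.U.1)
    (v : Module.Dual Γ(X, V) (Forms X V)) : Matrix (Fin 2) (Fin 2) Γ(X, V) :=
  fun a b => v (resForm X h (φ.matrix i a b))

theorem contract_app_res_vec (i : FramedAffine E) {V : X.affineOpens} (h : V.1 ≤ i.U.1)
    (v : Module.Dual Γ(X, V.1) (Forms X V.1)) (b : Fin 2) :
    contract E v (φ.app V (res E h (i.frame.vec b))) =
      ∑ a, contractedMatrix φ i h v a b • res E h (i.frame.vec a) := by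
  rw [← φ.res_app i.U V h, app_vec, map_sum, map_sum]
  exact Finset.sum_congr rfl fun a _ => by rw [resTensor_tmul, contract_tmul]; rfl

/-- Change of frame: the contracted matrices are conjugate under the transition matrix. -/
theorem contractedMatrix_mul_transition (i j : FramedAffine E) {V : X.affineOpens}
    (h : V.1 ≤ i.U.1 ⊓ j.U.1) (v : Module.Dual Γ(X, V.1) (Forms X V.1)) :
    contractedMatrix φ j (h.trans inf_le_right) v *
        (transition i j).map (X.presheaf.map (homOfLE h).op) =
      (transition i j).map (X.presheaf.map (homOfLE h).op) *
        contractedMatrix φ i (h.trans inf_le_left) v := by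
  ext c a
  have h1 := contract_app_res_vec φ i (h.trans inf_le_left) v a
  rw [vec_eq i j V.1 h a, map_sum, map_sum] at h1
  simp only [map_smul, contract_app_res_vec φ j (h.trans inf_le_right), vec_eq i j V.1 h] at h1
  simp only [← Frame.basis_apply] at h1
  have h2 := congrArg (fun s => (j.frame.basis (h.trans inf_le_right)).repr s c) h1
  simp only [map_sum, map_smul, Finsupp.coe_finsetSum, Finset.sum_apply, Finsupp.smul_apply,
    Module.Basis.repr_self, smul_eq_mul] at h2
  have h3 (f : Fin 2 → Γ(X, V.1)) : ∑ k, f k * (Finsupp.single k (1 : Γ(X, V.1))) c = f c := by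
    simp [Finsupp.single_apply]
  simp only [h3] at h2
  rw [Matrix.mul_apply, Matrix.mul_apply]
  simp only [Matrix.map_apply]
  refine Eq.trans (Finset.sum_congr rfl fun b _ => mul_comm _ _) (h2.trans ?_)
  exact Finset.sum_congr rfl fun b _ => mul_comm _ _

end Contraction

/-! ### Change of frame -/

section Frames

variable {X : Scheme.{0}} {E : X.Modules}

/-- The frame obtained from a frame by an invertible change of basis. -/
def Frame.change {r : ℕ} {U : X.Opens} (e : Frame E r U) (A : Matrix (Fin r) (Fin r) Γ(X, U))
    (hA : IsUnit A.det) : Frame E r U :=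
  have key (V : X.Opens) (h : V ≤ U) : ∃ b : Module.Basis (Fin r) Γ(X, V) Γ(E, V),
      ∀ a, b a = res E h (∑ c, A c a • e.vec c) := by
    have hB : IsUnit (A.map (X.presheaf.map (homOfLE h).op)).det := by
      have := hA.map (X.presheaf.map (homOfLE h).op).hom
      rwa [RingHom.map_det] at this
    refine ⟨(e.basis h).map (Matrix.toLinearEquiv (e.basis h) _ hB), fun a => ?_⟩
    rw [Module.Basis.map_apply]
    refine (Matrix.toLin_self (e.basis h) (e.basis h) _ a).trans ?_
    rw [map_sum]
    exact Finset.sum_congr rfl fun c _ => by rw [res_smul, Frame.basis_apply]; rfl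
  { vec := fun a => ∑ c, A c a • e.vec c
    linearIndependent := fun V h => by
      obtain ⟨b, hb⟩ := key V h
      rw [← funext hb]
      exact b.linearIndependent
    span_eq_top := fun V h => by
      obtain ⟨b, hb⟩ := key V h
      rw [← funext hb]
      exact b.span_eq.ge }

/-- The restriction of a frame to a smaller open set. -/
def Frame.restrict {r : ℕ} {U V : X.Opens} (e : Frame E r U) (h : V ≤ U) : Frame E r V where
  vec a := res E h (e.vec a)
  linearIndependent W hW := by simpa only [res_res] using e.linearIndependent W (hW.trans h)
  span_eq_top W hW := by simpa only [res_res] using e.span_eq_top W (hW.trans h)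

/-- The restriction of a framed affine open set to a smaller affine open set. -/
def FramedAffine.restrict (i : FramedAffine E) (V : X.affineOpens) (h : V.1 ≤ i.U.1) :
    FramedAffine E :=
  ⟨V, i.frame.restrict h⟩

/-- The framed affine open set with the two vectors of the frame exchanged. -/
def FramedAffine.swap (i : FramedAffine E) : FramedAffine E :=
  ⟨i.U, i.frame.change !![0, 1; 1, 0] (by simp [Matrix.det_fin_two])⟩

/-- The framed affine open set with the frame `(e₁, e₂)` replaced by `(e₁, e₁ + e₂)`. -/
def FramedAffine.shear (i : FramedAffine E) : FramedAffine E :=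
  ⟨i.U, i.frame.change !![1, 1; 0, 1] (by simp [Matrix.det_fin_two])⟩

theorem FramedAffine.swap_vec_zero (i : FramedAffine E) : i.swap.frame.vec 0 = i.frame.vec 1 := by
  simp [FramedAffine.swap, Frame.change, Fin.sum_univ_two]

theorem FramedAffine.swap_vec_one (i : FramedAffine E) : i.swap.frame.vec 1 = i.frame.vec 0 := by
  simp [FramedAffine.swap, Frame.change, Fin.sum_univ_two]

theorem FramedAffine.shear_vec_zero (i : FramedAffine E) :
    i.shear.frame.vec 0 = i.frame.vec 0 := by
  simp [FramedAffine.shear, Frame.change, Fin.sum_univ_two]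

theorem FramedAffine.shear_vec_one (i : FramedAffine E) :
    i.shear.frame.vec 1 = i.frame.vec 0 + i.frame.vec 1 := by
  simp [FramedAffine.shear, Frame.change, Fin.sum_univ_two]

theorem isUnit_det_transition (i j : FramedAffine E) : IsUnit (transition i j).det := by
  have h : i.U.1 ⊓ j.U.1 ≤ j.U.1 ⊓ i.U.1 := by rw [inf_comm]
  have h' : i.U.1 ⊓ j.U.1 ≤ i.U.1 ⊓ i.U.1 := by simp
  have key := transition_mul i j i (i.U.1 ⊓ j.U.1) le_rfl h h'
  rw [transition_self] at key
  have e : (transition i j).map (X.presheaf.map (homOfLE (le_refl (i.U.1 ⊓ j.U.1))).op) =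
      transition i j := by
    ext a b
    simp
  rw [e] at key
  have := congrArg Matrix.det key
  rw [Matrix.det_one, Matrix.det_mul] at this
  exact IsUnit.of_mul_eq_one_right _ this.symm

end Frames

/-! ### The matrix of a Higgs field in different frames -/

section FrameMatrix

variable {X : Scheme.{0}} [X.Over (Spec (.of ℂ))] {E : X.Modules} (φ : HiggsField E)

theorem matrix_unique (i : FramedAffine E) (N : Matrix (Fin 2) (Fin 2) (Forms X i.U)) (b : Fin 2)
    (hN : φ.app i.U (i.frame.vec b) = ∑ a, i.frame.vec a ⊗ₜ N a b) (a : Fin 2) :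
    φ.matrix i a b = N a b := by
  have h1 : ∀ c, (i.frame.basis le_rfl).repr (i.frame.vec c) a = if c = a then 1 else 0 := by
    intro c
    have : i.frame.vec c = i.frame.basis le_rfl c := by
      rw [Frame.basis_apply]; simp [res]
    rw [this, Module.Basis.repr_self, Finsupp.single_apply]
  rw [HiggsField.matrix, hN]
  simp only [map_sum, LinearMap.rTensor_tmul, TensorProduct.lid_tmul, Module.Basis.coord_apply, h1]
  simp

theorem matrix_restrict (i : FramedAffine E) (V : X.affineOpens) (h : V.1 ≤ i.U.1) (a b : Fin 2) :
    φ.matrix (i.restrict V h) a b = resForm X h (φ.matrix i a b) := by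
  refine matrix_unique φ (i.restrict V h) (fun a b => resForm X h (φ.matrix i a b)) b ?_ a
  change φ.app V (res E h (i.frame.vec b)) = _
  rw [← φ.res_app i.U V h, app_vec, map_sum]
  exact Finset.sum_congr rfl fun a _ => resTensor_tmul h _ _

theorem matrix_swap (i : FramedAffine E) (a b : Fin 2) :
    φ.matrix i.swap a b = φ.matrix i (1 - a) (1 - b) := by
  refine matrix_unique φ i.swap (fun a b => φ.matrix i (1 - a) (1 - b)) b ?_ a
  rw [Fin.sum_univ_two, i.swap_vec_zero, i.swap_vec_one]
  fin_cases b
  · exact (congrArg (φ.app i.U) i.swap_vec_zero).trans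
      ((app_vec φ i 1).trans ((Fin.sum_univ_two _).trans (add_comm _ _)))
  · exact (congrArg (φ.app i.U) i.swap_vec_one).trans
      ((app_vec φ i 0).trans ((Fin.sum_univ_two _).trans (add_comm _ _)))

theorem matrix_shear_zero_one (i : FramedAffine E) :
    φ.matrix i.shear 0 1 =
      φ.matrix i 0 0 + φ.matrix i 0 1 - φ.matrix i 1 0 - φ.matrix i 1 1 := by
  have h : φ.app i.U (i.frame.vec 0 + i.frame.vec 1) =
      i.frame.vec 0 ⊗ₜ[Γ(X, i.U.1)] (φ.matrix i 0 0 + φ.matrix i 0 1 - φ.matrix i 1 0 -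
        φ.matrix i 1 1) + (i.frame.vec 0 + i.frame.vec 1) ⊗ₜ (φ.matrix i 1 0 + φ.matrix i 1 1) := by
    rw [map_add, app_vec, app_vec, Fin.sum_univ_two, Fin.sum_univ_two]
    simp only [TensorProduct.tmul_add, TensorProduct.tmul_sub, TensorProduct.add_tmul]
    abel
  refine matrix_unique φ i.shear (fun a _ => ![φ.matrix i 0 0 + φ.matrix i 0 1 -
    φ.matrix i 1 0 - φ.matrix i 1 1, φ.matrix i 1 0 + φ.matrix i 1 1] a) 1 ?_ 0
  rw [Fin.sum_univ_two, i.shear_vec_zero, i.shear_vec_one]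
  exact h

end FrameMatrix

/-! ### The quadratic form of the eigenlines -/

section Quadratic

/-- The quadratic form `z ↦ z ∧ N z`, whose zeros are the eigenlines of the matrix `N`. -/
def eigenForm {A : Type*} [CommRing A] (N : Matrix (Fin 2) (Fin 2) A) (z w : A) : A :=
  N 1 0 * z ^ 2 + (N 1 1 - N 0 0) * z * w - N 0 1 * w ^ 2

theorem eigenForm_conj {A : Type*} [CommRing A] {N N' g : Matrix (Fin 2) (Fin 2) A}
    (h : N' * g = g * N) (z w : A) :
    eigenForm N' (g 0 0 * z + g 0 1 * w) (g 1 0 * z + g 1 1 * w) = g.det * eigenForm N z w := by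
  have h' := fun a b => congrFun (congrFun h a) b
  simp only [Matrix.mul_apply, Fin.sum_univ_two] at h'
  rw [Matrix.det_fin_two, eigenForm, eigenForm]
  linear_combination (g 0 0 * z + g 0 1 * w) * (z * h' 1 0 + w * h' 1 1) -
    (g 1 0 * z + g 1 1 * w) * (z * h' 0 0 + w * h' 0 1)

end Quadratic

/-! ### Independence of the equations of the chart -/

section EvalIdeal

variable {X : Scheme.{0}} [X.Over (Spec (.of ℂ))] {E : X.Modules} (φ : HiggsField E)

/-- The value of the equations of the Higgs Grassmannian at the line `e₁ + z e₂`, where the vector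
fields are taken on an affine open subset of the domain of the frame. -/
def evalIdeal (i : FramedAffine E) {V : X.Opens} (hV : V ≤ i.U.1) {T : Scheme.{0}} (b : T ⟶ X)
    (h : ⊤ ≤ b ⁻¹ᵁ V) (z : Γ(T, ⊤)) : Ideal Γ(T, ⊤) :=
  Ideal.span (Set.range fun v : Module.Dual Γ(X, V) (Forms X V) =>
    eigenForm ((contractedMatrix φ i hV v).map (b.appLE V ⊤ h)) 1 z)

theorem resForm_d {U V : X.Opens} (h : V ≤ U) (f : Γ(X, U)) :
    resForm X h (CommRingCat.KaehlerDifferential.d f) =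
      CommRingCat.KaehlerDifferential.d (X.presheaf.map (homOfLE h).op f) :=
  CommRingCat.KaehlerDifferential.map_d (scalars_map X h) f

theorem Forms.induction {U : X.Opens} {P : Forms X U → Prop} (zero : P 0)
    (add : ∀ η η', P η → P η' → P (η + η'))
    (smul_d : ∀ r f : Γ(X, U), P (r • CommRingCat.KaehlerDifferential.d f)) (η : Forms X U) :
    P η := by
  let := (scalars X U).hom.toAlgebra
  have h : η ∈ Submodule.span Γ(X, U) (Set.range (KaehlerDifferential.D ℂ Γ(X, U))) := by
    rw [KaehlerDifferential.span_range_derivation]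
    trivial
  induction h using Submodule.closure_induction with
  | zero => exact zero
  | add x y _ _ hx hy => exact add x y hx hy
  | smul_mem r x hx =>
    obtain ⟨f, rfl⟩ := hx
    exact smul_d r f

theorem resForm_self (U : X.Opens) (η : Forms X U) : resForm X (le_refl U) η = η := by
  induction η using Forms.induction with
  | zero => simp
  | add η η' h h' => rw [map_add, h, h']
  | smul_d r f =>
    rw [resForm_smul, resForm_d]
    simp

theorem resForm_resForm {U V W : X.Opens} (h : V ≤ U) (h' : W ≤ V) (η : Forms X U) :
    resForm X h' (resForm X h η) = resForm X (h'.trans h) η := by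
  induction η using Forms.induction with
  | zero => simp
  | add η η' h h' => rw [map_add, map_add, map_add, h, h']
  | smul_d r f =>
    have e : ∀ a, X.presheaf.map (homOfLE h').op (X.presheaf.map (homOfLE h).op a) =
        X.presheaf.map (homOfLE (h'.trans h)).op a := fun a => by
      rw [← CommRingCat.comp_apply, ← Functor.map_comp]
      rfl
    rw [resForm_smul, resForm_smul, resForm_d, resForm_d, resForm_smul, resForm_d, e, e]

theorem map_equations (i : FramedAffine E) {T : Scheme.{0}} (x : T ⟶ chart i) :
    (φ.equations i).map x.appTop.hom =
      evalIdeal φ i le_rfl (x ≫ chartProj i) (le_preimage i x) (x.appTop (chartCoord i)) := by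
  rw [HiggsField.equations, evalIdeal, Ideal.map_span, ← Set.range_comp]
  congr 2
  ext v
  have hc : ∀ a, x.appTop ((chartProj i).appLE i.U.1 ⊤
      (by simpa using le_preimage i (𝟙 (chart i))) a) =
      (x ≫ chartProj i).appLE i.U.1 ⊤ (le_preimage i x) a := by
    intro a
    have hx : ⊤ ≤ x ⁻¹ᵁ ⊤ := fun _ _ => trivial
    have e := Scheme.Hom.appLE_comp_appLE x (chartProj i) i.U.1 ⊤ ⊤
      (by simpa using le_preimage i (𝟙 (chart i))) hx
    have e₁ : x.appTop = x.appLE ⊤ ⊤ hx := Scheme.Hom.app_eq_appLE x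
    rw [e₁]
    exact congrArg (fun f => f.hom a) e
  simp only [Function.comp_apply, eigenForm, Matrix.map_apply, contractedMatrix, resForm_self]
  refine (map_sub _ _ _).trans ?_
  rw [map_add, map_mul, map_mul, map_pow]
  have hc' := fun a => (hc a)
  simp only [hc', map_sub]
  ring

/-- The ideal can be computed with the vector fields on a smaller affine open set, because a vector
field restricts, and a vector field on the smaller set is a combination of restricted ones. -/
theorem evalIdeal_restrict [Smooth (X ↘ Spec (.of ℂ))] (i : FramedAffine E) {V V' : X.affineOpens}
    (hV : V.1 ≤ i.U.1) (hV' : V'.1 ≤ V.1) {T : Scheme.{0}} (b : T ⟶ X) (h : ⊤ ≤ b ⁻¹ᵁ V.1)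
    (h' : ⊤ ≤ b ⁻¹ᵁ V'.1) (z : Γ(T, ⊤)) :
    evalIdeal φ i hV b h z = evalIdeal φ i (hV'.trans hV) b h' z := by
  have hext := (span_and_extend_forms hV').2
  have key (v : Module.Dual Γ(X, V.1) (Forms X V.1)) (v' : Module.Dual Γ(X, V'.1) (Forms X V'.1))
      (hv : ∀ η, v' (resForm X hV' η) = X.presheaf.map (homOfLE hV').op (v η)) :
      (contractedMatrix φ i (hV'.trans hV) v').map (b.appLE V'.1 ⊤ h') =
        (contractedMatrix φ i hV v).map (b.appLE V.1 ⊤ h) := by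
    ext a c
    simp only [Matrix.map_apply, contractedMatrix]
    rw [← resForm_resForm hV hV', hv, ← Scheme.Hom.map_appLE b h' (homOfLE hV').op]
    rfl
  apply le_antisymm
  · refine Ideal.span_le.2 ?_
    rintro _ ⟨v, rfl⟩
    obtain ⟨v', hv⟩ := hext v
    exact Ideal.subset_span ⟨v', by simp only [key v v' hv]⟩
  · refine Ideal.span_le.2 ?_
    rintro _ ⟨v', rfl⟩
    obtain ⟨n, v, m, hm⟩ := exists_dual_basis (R := Γ(X, V.1)) (M := Forms X V.1)
    choose w hw using fun k => hext (v k)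
    have hsum : (contractedMatrix φ i (hV'.trans hV) v').map (b.appLE V'.1 ⊤ h') =
        ∑ k, b.appLE V'.1 ⊤ h' (v' (resForm X hV' (m k))) •
          (contractedMatrix φ i hV (v k)).map (b.appLE V.1 ⊤ h) := by
      simp only [← key _ _ (hw _)]
      ext a c
      simp only [Matrix.map_apply, contractedMatrix, Matrix.sum_apply, Matrix.smul_apply,
        smul_eq_mul, ← map_mul, ← map_sum]
      congr 1
      conv_lhs => rw [← resForm_resForm hV hV', hm (resForm X hV (φ.matrix i a c)), map_sum,
        map_sum]
      refine Finset.sum_congr rfl fun k _ => ?_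
      rw [resForm_smul, map_smul, smul_eq_mul, ← hw, resForm_resForm, mul_comm]
    simp only [hsum]
    have hlin : eigenForm (∑ k, b.appLE V'.1 ⊤ h' (v' (resForm X hV' (m k))) •
          (contractedMatrix φ i hV (v k)).map (b.appLE V.1 ⊤ h)) 1 z =
        ∑ k, b.appLE V'.1 ⊤ h' (v' (resForm X hV' (m k))) *
          eigenForm ((contractedMatrix φ i hV (v k)).map (b.appLE V.1 ⊤ h)) 1 z := by
      simp only [eigenForm, Matrix.sum_apply, Matrix.smul_apply, smul_eq_mul]
      rw [← Finset.sum_sub_distrib, Finset.sum_mul, Finset.sum_mul, Finset.sum_mul,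
        Finset.sum_mul, ← Finset.sum_add_distrib, ← Finset.sum_sub_distrib]
      exact Finset.sum_congr rfl fun k _ => by ring
    rw [hlin]
    exact Ideal.sum_mem _ fun k _ => Ideal.mul_mem_left _ _ (Ideal.subset_span ⟨v k, rfl⟩)

/-- The equations in two charts, evaluated at the same line, differ by the determinant of the
transition matrix and by the square of the factor between the two vectors, which are units. -/
theorem SameLine.evalIdeal_eq {i j : FramedAffine E} {T : Scheme.{0}} {x : T ⟶ chart i}
    {y : T ⟶ chart j} (hxy : SameLine i j x y) {V : X.affineOpens} (hV : V.1 ≤ i.U.1 ⊓ j.U.1)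
    (h : ⊤ ≤ (x ≫ chartProj i) ⁻¹ᵁ V.1) (h' : ⊤ ≤ (y ≫ chartProj j) ⁻¹ᵁ V.1) :
    evalIdeal φ i (hV.trans inf_le_left) (x ≫ chartProj i) h (x.appTop (chartCoord i)) =
      evalIdeal φ j (hV.trans inf_le_right) (y ≫ chartProj j) h' (y.appTop (chartCoord j)) := by
  obtain ⟨hb, hi, u, hu⟩ := hxy
  generalize x.appTop (chartCoord i) = z at hu
  generalize y.appTop (chartCoord j) = z' at hu
  generalize y ≫ chartProj j = b at hb h'
  subst hb
  generalize x ≫ chartProj i = b at hi hu h h'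
  rw [map_transition i j b V.1 hV h hi] at hu
  set g := ((transition i j).map (X.presheaf.map (homOfLE hV).op)).map (b.appLE V.1 ⊤ h) with hg
  have hdet : IsUnit g.det := by
    have := ((isUnit_det_transition i j).map (X.presheaf.map (homOfLE hV).op).hom).map
      (b.appLE V.1 ⊤ h).hom
    rwa [RingHom.map_det, RingHom.map_det] at this
  have h0 : g 0 0 * 1 + g 0 1 * z = u.1 := by
    simpa [Matrix.mulVec, dotProduct, Fin.sum_univ_two] using congrFun hu 0
  have h1 : g 1 0 * 1 + g 1 1 * z = u.1 * z' := by
    simpa [Matrix.mulVec, dotProduct, Fin.sum_univ_two] using congrFun hu 1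
  have key (v : Module.Dual Γ(X, V.1) (Forms X V.1)) :
      u.1 ^ 2 * eigenForm ((contractedMatrix φ j (hV.trans inf_le_right) v).map
        (b.appLE V.1 ⊤ h)) 1 z' =
      g.det * eigenForm ((contractedMatrix φ i (hV.trans inf_le_left) v).map
        (b.appLE V.1 ⊤ h)) 1 z := by
    have hN := congrArg (fun M => M.map (b.appLE V.1 ⊤ h))
      (contractedMatrix_mul_transition φ i j hV v)
    simp only [Matrix.map_mul] at hN
    rw [← eigenForm_conj hN, h0, h1]
    simp only [eigenForm]
    ring
  have hu2 : IsUnit (u.1 ^ 2) := u.isUnit.pow 2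
  refine le_antisymm (Ideal.span_le.2 ?_) (Ideal.span_le.2 ?_)
  · rintro _ ⟨v, rfl⟩
    refine (Ideal.unit_mul_mem_iff_mem _ hdet).1 ?_
    rw [← key]
    exact Ideal.mul_mem_left _ _ (Ideal.subset_span ⟨v, rfl⟩)
  · rintro _ ⟨v, rfl⟩
    refine (Ideal.unit_mul_mem_iff_mem _ hu2).1 ?_
    simp only
    rw [key]
    exact Ideal.mul_mem_left _ _ (Ideal.subset_span ⟨v, rfl⟩)

theorem isAffineOpen_inf [IsSeparated (X ↘ Spec (.of ℂ))] (U V : X.affineOpens) :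
    IsAffineOpen (U.1 ⊓ V.1) := by
  have : X.IsSeparated := ⟨by
    rw [← terminal.comp_from (X ↘ Spec (.of ℂ))]
    infer_instance⟩
  have hU : IsAffineOpen U.1 := U.2
  exact hU.inf V.2

/-- The equations of two charts define the same closed subscheme of the intersection. -/
theorem SameLine.map_equations_eq [Smooth (X ↘ Spec (.of ℂ))] [IsSeparated (X ↘ Spec (.of ℂ))]
    {i j : FramedAffine E} {T : Scheme.{0}} {x : T ⟶ chart i}
    {y : T ⟶ chart j} (hxy : SameLine i j x y) :
    (φ.equations i).map x.appTop.hom = (φ.equations j).map y.appTop.hom := by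
  have h := hxy.line.1
  have h' : ⊤ ≤ (y ≫ chartProj j) ⁻¹ᵁ (i.U.1 ⊓ j.U.1) := hxy.base ▸ h
  rw [map_equations, map_equations,
    evalIdeal_restrict φ i (V := i.U) (V' := ⟨_, isAffineOpen_inf i.U j.U⟩) le_rfl inf_le_left
      _ _ h,
    evalIdeal_restrict φ j (V := j.U) (V' := ⟨_, isAffineOpen_inf i.U j.U⟩) le_rfl inf_le_right
      _ _ h']
  exact hxy.evalIdeal_eq φ (V := ⟨_, isAffineOpen_inf i.U j.U⟩) le_rfl h h'

end EvalIdeal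

/-! ### Points of the projective bundle with values in a scheme -/

section Charts

variable {X : Scheme.{0}} {E : X.Modules}

instance isAffine_chart (i : FramedAffine E) : IsAffine (chart i) := by
  have : IsAffine (i.U.1 : Scheme.{0}) := i.U.2
  infer_instance

instance isOpenImmersion_chartι (i : FramedAffine E) : IsOpenImmersion (chartι i) :=
  (glueData E).ι_isOpenImmersion i

theorem exists_chartι_eq (p : projBundle E) :
    ∃ (i : FramedAffine E) (q : chart i), chartι i q = p :=
  (glueData E).ι_jointly_surjective p

/-- If `x` and `y` are the same line, they are equal as points of `ℙ(E)`; the converse is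
`sameLine_of_comp_chartι_eq`. -/
theorem SameLine.comp_chartι_eq {i j : FramedAffine E} {T : Scheme.{0}} {x : T ⟶ chart i}
    {y : T ⟶ chart j} (h : SameLine i j x y) : x ≫ chartι i = y ≫ chartι j := by
  have h1 := liftOverlap_ι x h.top_le
  have h2 : liftOverlap x h.top_le ≫ overlapMap i j = y :=
    SameLine.lift_map (by rwa [h1])
  have h3 := (glueData E).glue_condition i j
  change overlapSwap i j ≫ (overlap j i).ι ≫ chartι j = (overlap i j).ι ≫ chartι i at h3
  rw [← Category.assoc, overlapSwap_ι] at h3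
  calc x ≫ chartι i = (liftOverlap x h.top_le ≫ (overlap i j).ι) ≫ chartι i := by rw [h1]
    _ = (liftOverlap x h.top_le ≫ overlapMap i j) ≫ chartι j := by
      rw [Category.assoc, Category.assoc, h3]
    _ = y ≫ chartι j := by rw [h2]

theorem sameLine_of_comp_chartι_eq {i j : FramedAffine E} {T : Scheme.{0}} {x : T ⟶ chart i}
    {y : T ⟶ chart j} (h : x ≫ chartι i = y ≫ chartι j) : SameLine i j x y := by
  obtain ⟨l, hl, hl'⟩ := PullbackCone.IsLimit.lift' ((glueData E).vPullbackConeIsLimit i j) x y h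
  change T ⟶ (overlap i j : Scheme.{0}) at l
  change l ≫ (overlap i j).ι = x at hl
  change l ≫ overlapSwap i j ≫ (overlap j i).ι = y at hl'
  rw [overlapSwap_ι] at hl'
  rw [← hl, ← hl']
  exact (sameLine_overlap i j).comp l

/-- The `T`-valued point `e₁ + z e₂` of a chart over the `T`-valued point `b` of the base. -/
def chartPt (i : FramedAffine E) {T : Scheme.{0}} (b : T ⟶ X) (h : ⊤ ≤ b ⁻¹ᵁ i.U.1)
    (z : Γ(T, ⊤)) : T ⟶ chart i :=
  AffineSpace.homOfVector (IsOpenImmersion.lift i.U.1.ι b (by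
    rintro _ ⟨t, rfl⟩
    simpa using h (show t ∈ (⊤ : T.Opens) from trivial))) (fun _ => z)

@[simp]
theorem chartPt_proj (i : FramedAffine E) {T : Scheme.{0}} (b : T ⟶ X) (h : ⊤ ≤ b ⁻¹ᵁ i.U.1)
    (z : Γ(T, ⊤)) : chartPt i b h z ≫ chartProj i = b := by
  have h := fun (f : T ⟶ (i.U.1 : Scheme.{0})) v =>
      AffineSpace.homOfVector_over_assoc (n := Unit) f v i.U.1.ι
  exact (h _ _).trans (IsOpenImmersion.lift_fac _ _ _)

@[simp]
theorem chartPt_coord (i : FramedAffine E) {T : Scheme.{0}} (b : T ⟶ X) (h : ⊤ ≤ b ⁻¹ᵁ i.U.1)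
    (z : Γ(T, ⊤)) : (chartPt i b h z).appTop (chartCoord i) = z :=
  AffineSpace.homOfVector_appTop_coord _ _ _

theorem comp_chartPt (i : FramedAffine E) {T T' : Scheme.{0}} (f : T' ⟶ T) (b : T ⟶ X)
    (h : ⊤ ≤ b ⁻¹ᵁ i.U.1) (h' : ⊤ ≤ (f ≫ b) ⁻¹ᵁ i.U.1) (z : Γ(T, ⊤)) :
    f ≫ chartPt i b h z = chartPt i (f ≫ b) h' (f.appTop z) :=
  chart_hom_ext (by simp) (by
    rw [chartPt_coord, Scheme.Hom.comp_appTop, CommRingCat.comp_apply, chartPt_coord])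

theorem transition_swap (j i : FramedAffine E) (c a : Fin 2) :
    transition j i.swap c a = transition j i (1 - c) a := by
  have h := transition_unique j i.swap (j.U.1 ⊓ i.U.1) le_rfl
    (fun c a => transition j i (1 - c) a) fun a => by
      rw [Fin.sum_univ_two, i.swap_vec_zero, i.swap_vec_one]
      have := vec_eq j i (j.U.1 ⊓ i.U.1) le_rfl a
      rw [Fin.sum_univ_two, add_comm] at this
      refine this.trans ?_
      simp
      rfl
  have h' := congrFun (congrFun h c) a
  refine Eq.trans ?_ h'
  rw [Matrix.map_apply]
  have e : X.presheaf.map (homOfLE (le_refl (j.U.1 ⊓ i.swap.U.1))).op = 𝟙 _ :=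
    X.presheaf.map_id _
  exact (congrArg (fun f => f.hom (transition j i.swap c a)) e).symm

/-- The criterion for the line `y` of the chart `j` to be the line `e₁ + z' e₂` of the chart `i`:
the transition matrix maps the first vector to a multiple, by a unit `u`, of the second one. -/
theorem sameLine_chartPt (j i : FramedAffine E) {T : Scheme.{0}} (y : T ⟶ chart j)
    (h : ⊤ ≤ (y ≫ chartProj j) ⁻¹ᵁ i.U.1)
    (hV : ⊤ ≤ (y ≫ chartProj j) ⁻¹ᵁ (j.U.1 ⊓ i.U.1)) (u : Γ(T, ⊤)ˣ) (z' : Γ(T, ⊤))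
    (h0 : (y ≫ chartProj j).appLE _ ⊤ hV (transition j i 0 0) +
      (y ≫ chartProj j).appLE _ ⊤ hV (transition j i 0 1) * y.appTop (chartCoord j) = u.1)
    (h1 : (y ≫ chartProj j).appLE _ ⊤ hV (transition j i 1 0) +
      (y ≫ chartProj j).appLE _ ⊤ hV (transition j i 1 1) * y.appTop (chartCoord j) = u.1 * z') :
    SameLine j i y (chartPt i (y ≫ chartProj j) h z') := by
  refine ⟨(chartPt_proj _ _ _ _).symm, hV, u, ?_⟩
  rw [chartPt_coord]
  ext c
  fin_cases c
  · simpa [Matrix.mulVec, dotProduct, Fin.sum_univ_two] using h0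
  · simpa [Matrix.mulVec, dotProduct, Fin.sum_univ_two] using h1

/-- A line given over a field in some chart lies in the chart `{e₁ + t e₂}` of a given frame, or
it is the line spanned by `e₂`. -/
theorem exists_sameLine (j i : FramedAffine E) {T : Scheme.{0}}
    (hT : ∀ a : Γ(T, ⊤), a = 0 ∨ IsUnit a) (y : T ⟶ chart j)
    (h : ⊤ ≤ (y ≫ chartProj j) ⁻¹ᵁ i.U.1) :
    (∃ x : T ⟶ chart i, SameLine j i y x) ∨
      ∃ x : T ⟶ chart i.swap, SameLine j i.swap y x ∧ x.appTop (chartCoord i.swap) = 0 := by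
  have hV : ⊤ ≤ (y ≫ chartProj j) ⁻¹ᵁ (j.U.1 ⊓ i.U.1) := fun t ht =>
    ⟨le_preimage j y ht, h ht⟩
  let f := (y ≫ chartProj j).appLE (j.U.1 ⊓ i.U.1) ⊤ hV
  let g : Matrix (Fin 2) (Fin 2) Γ(T, ⊤) := (transition j i).map f
  let z := y.appTop (chartCoord j)
  rcases hT (g 0 0 + g 0 1 * z) with h0 | h0
  · right
    have hdet : IsUnit g.det := by
      have := (isUnit_det_transition j i).map f.hom
      rwa [RingHom.map_det] at this
    have h1 : IsUnit (g 1 0 + g 1 1 * z) := by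
      rcases hT (g 1 0 + g 1 1 * z) with h1 | h1
      · have : g.det * 1 = 0 := by
          rw [Matrix.det_fin_two]
          linear_combination g 1 1 * h0 - g 0 1 * h1
        rw [mul_one] at this
        rw [this] at hdet
        have h2 : (1 : Γ(T, ⊤)) = 0 := (isUnit_zero_iff.1 hdet).symm
        rw [← mul_one (g 1 0 + g 1 1 * z), h2, mul_zero]
        exact hdet
      · exact h1
    refine ⟨chartPt i.swap (y ≫ chartProj j) h 0,
      sameLine_chartPt j i.swap y h hV h1.unit 0 ?_ ?_, chartPt_coord _ _ _ _⟩
    · exact congrArg₂ (fun a b => f a + f b * z) (transition_swap j i 0 0)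
        (transition_swap j i 0 1)
    · refine (congrArg₂ (fun a b => f a + f b * z) (transition_swap j i 1 0)
        (transition_swap j i 1 1)).trans ?_
      rw [mul_zero]
      exact h0
  · left
    refine ⟨chartPt i (y ≫ chartProj j) h (h0.unit⁻¹.1 * (g 1 0 + g 1 1 * z)),
      sameLine_chartPt j i y h hV h0.unit _ rfl ?_⟩
    exact (Units.mul_inv_cancel_left h0.unit _).symm

theorem eq_zero_or_isUnit_of_field (K : Type) [Field K] (a : Γ(Spec (.of K), ⊤)) :
    a = 0 ∨ IsUnit a := by
  let e := (Scheme.ΓSpecIso (.of K)).commRingCatIsoToRingEquiv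
  rcases eq_or_ne (e a) 0 with h | h
  · exact .inl (by simpa using h)
  · exact .inr ((MulEquiv.isUnit_map e).1 h.isUnit)

/-- A point of `ℙ(E)` as a morphism from the spectrum of its residue field to a chart. -/
theorem exists_residueField_point (p : projBundle E) :
    ∃ (j : FramedAffine E) (y : Spec ((projBundle E).residueField p) ⟶ chart j),
      y ≫ chartι j = (projBundle E).fromSpecResidueField p := by
  obtain ⟨j, q, hq⟩ := exists_chartι_eq p
  exact ⟨j, IsOpenImmersion.lift (chartι j) ((projBundle E).fromSpecResidueField p) (by
    rw [Scheme.range_fromSpecResidueField]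
    rintro _ rfl
    exact ⟨q, hq⟩), IsOpenImmersion.lift_fac _ _ _⟩

/-- The chart `{e₁ + t e₂}` and the chart of the exchanged frame cover `ℙ(E)` over the domain of
the frame. -/
theorem mem_range_chartι (i : FramedAffine E) (p : projBundle E)
    (hp : projBundleProj E p ∈ i.U.1) :
    p ∈ Set.range (chartι i) ∨ p ∈ Set.range (chartι i.swap) := by
  obtain ⟨j, y, hy⟩ := exists_residueField_point p
  have hp' : ∀ t, (projBundle E).fromSpecResidueField p t = p := fun t => by
    have : (projBundle E).fromSpecResidueField p t ∈
        Set.range ((projBundle E).fromSpecResidueField p) := ⟨t, rfl⟩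
    rwa [Scheme.range_fromSpecResidueField] at this
  let t : Spec ((projBundle E).residueField p) := IsLocalRing.closedPoint _
  have h : ⊤ ≤ (y ≫ chartProj j) ⁻¹ᵁ i.U.1 := by
    intro t _
    rw [← chartι_proj, ← Category.assoc, hy]
    change projBundleProj E ((projBundle E).fromSpecResidueField p t) ∈ i.U.1
    rw [hp']
    exact hp
  have hT : ∀ a : Γ(Spec ((projBundle E).residueField p), ⊤), a = 0 ∨ IsUnit a :=
    eq_zero_or_isUnit_of_field _
  rcases exists_sameLine j i hT y h with ⟨x, hx⟩ | ⟨x, hx, -⟩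
  · left
    have := hy ▸ hx.comp_chartι_eq
    exact ⟨x t, (congrArg (fun f => f t) this).symm.trans (hp' t)⟩
  · right
    have := hy ▸ hx.comp_chartι_eq
    exact ⟨x t, (congrArg (fun f => f t) this).symm.trans (hp' t)⟩

theorem preimage_opensRange_chartι (i j : FramedAffine E) :
    chartι i ⁻¹ᵁ (chartι j).opensRange = overlap i j := by
  have h3 := (glueData E).glue_condition i j
  change overlapSwap i j ≫ (overlap j i).ι ≫ chartι j = (overlap i j).ι ≫ chartι i at h3
  apply le_antisymm
  · intro q hq
    let f := (chart i).fromSpecResidueField q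
    have hf : Set.range (f ≫ chartι i) ⊆ Set.range (chartι j) := by
      rintro _ ⟨t, rfl⟩
      rw [Scheme.Hom.comp_apply]
      have : f t = q := by
        have : f t ∈ Set.range f := ⟨t, rfl⟩
        rwa [Scheme.range_fromSpecResidueField] at this
      rw [this]
      exact hq
    have := (sameLine_of_comp_chartι_eq (IsOpenImmersion.lift_fac (chartι j) (f ≫ chartι i)
      hf).symm).top_le
    have h := this (show IsLocalRing.closedPoint ((chart i).residueField q) ∈ _ from trivial)
    have h' : f (IsLocalRing.closedPoint ((chart i).residueField q)) = q := by
      have : f (IsLocalRing.closedPoint ((chart i).residueField q)) ∈ Set.range f := ⟨_, rfl⟩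
      rwa [Scheme.range_fromSpecResidueField] at this
    change f (IsLocalRing.closedPoint ((chart i).residueField q)) ∈ overlap i j at h
    rwa [h'] at h
  · intro q hq
    refine ⟨((overlap j i).ι (overlapSwap i j ⟨q, hq⟩)), ?_⟩
    exact congrArg (fun f => f ⟨q, hq⟩) h3

end Charts

/-! ### Intersections of charts are affine -/

section AffineCharts

variable {X : Scheme.{0}} [X.Over (Spec (.of ℂ))] [IsSeparated (X ↘ Spec (.of ℂ))] {E : X.Modules}

/-- X subscheme of a chart in another chart. -/
theorem isAffineOpen_overlap (i j : FramedAffine E) : IsAffineOpen (overlap i j) := by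
  have : IsAffine (i.U.1 : Scheme.{0}) := i.U.2
  have h : IsAffineOpen (chartProj i ⁻¹ᵁ (i.U.1 ⊓ j.U.1)) := by
    have h1 : IsAffineHom i.U.1.ι :=
      have : IsAffineHom (i.U.1.ι ≫ X ↘ Spec (.of ℂ)) := inferInstance
      .of_comp i.U.1.ι (X ↘ Spec (.of ℂ))
    have h2 : IsAffineHom (chartProj i) :=
      inferInstanceAs
        (IsAffineHom ((𝔸(Unit; (i.U.1 : Scheme.{0})) ↘ (i.U.1 : Scheme.{0})) ≫ i.U.1.ι))
    exact (isAffineOpen_inf i.U j.U).preimage _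
  exact h.basicOpen _

instance isAffineHom_chartι (i : FramedAffine E) : IsAffineHom (chartι i) := by
  refine isAffineHom_of_forall_exists_isAffineOpen _ fun p => ?_
  obtain ⟨j, q, rfl⟩ := exists_chartι_eq p
  refine ⟨(chartι j).opensRange, ⟨q, rfl⟩, isAffineOpen_opensRange _, ?_⟩
  rw [preimage_opensRange_chartι]
  exact isAffineOpen_overlap i j

end AffineCharts

/-! ### Comparison of ideal sheaves -/

section IdealSheaves

open Scheme.IdealSheafData

theorem ofIdealTop_le_ker_iff {Y T : Scheme.{0}} [IsAffine Y] (J : Ideal Γ(Y, ⊤)) (x : T ⟶ Y) :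
    ofIdealTop J ≤ x.ker ↔ J.map x.appTop.hom = ⊥ := by
  rw [Scheme.ker_of_isAffine, ← equivOfIsAffine_symm_apply, ← equivOfIsAffine_symm_apply,
    map_le_map_iff, Ideal.map_eq_bot_iff_le_ker]

theorem ker_le_map_of_le {Y Z T : Scheme.{0}} (I : Y.IdealSheafData) (f : Y ⟶ Z) (x : T ⟶ Y)
    (h : I ≤ x.ker) : I.map f ≤ (x ≫ f).ker := by
  rw [Scheme.Hom.ker_comp]
  exact map_mono f h

/-- Ideal sheaves can be compared on a cover by open immersions of affine schemes. -/
theorem le_of_comap_le {Y : Scheme.{0}} {ι : Type*} (C : ι → Scheme.{0}) [∀ k, IsAffine (C k)]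
    (f : ∀ k, C k ⟶ Y) [∀ k, IsOpenImmersion (f k)] (hf : ∀ y, ∃ k, y ∈ Set.range (f k))
    {I J : Y.IdealSheafData} (h : ∀ k, I.comap (f k) ≤ J.comap (f k)) : I ≤ J := by
  refine le_of_iSup_eq_top (fun k => ⟨f k ''ᵁ ⊤, (isAffineOpen_top (C k)).image_of_isOpenImmersion
    (f k)⟩) ?_ fun k => ?_
  · refine top_le_iff.1 fun y _ => ?_
    obtain ⟨k, q, rfl⟩ := hf y
    exact Opens.mem_iSup.2 ⟨k, q, trivial, rfl⟩
  · have := h k ⟨⊤, isAffineOpen_top (C k)⟩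
    rw [ideal_comap_of_isOpenImmersion, ideal_comap_of_isOpenImmersion] at this
    intro a ha
    have h1 := @this (((f k).appIso ⊤).hom a) (by
      rw [Ideal.mem_comap]
      simpa using ha)
    rw [Ideal.mem_comap] at h1
    simpa using h1

end IdealSheaves

/-! ### The functor of points of the Higgs Grassmannian -/

section GrassIdeal

open Scheme.IdealSheafData

variable {X : Scheme.{0}} [X.Over (Spec (.of ℂ))] [IsSeparated (X ↘ Spec (.of ℂ))]
  [Smooth (X ↘ Spec (.of ℂ))] {E : X.Modules} (φ : HiggsField E)

instance isClosedImmersion_grassι {X : Scheme.{0}} [X.Over (Spec (.of ℂ))] {E : X.Modules}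
    (φ : HiggsField E) : IsClosedImmersion φ.grassι :=
  inferInstanceAs (IsClosedImmersion φ.idealSheaf.subschemeι)

theorem ker_grassι {X : Scheme.{0}} [X.Over (Spec (.of ℂ))] {E : X.Modules}
    (φ : HiggsField E) : φ.grassι.ker = φ.idealSheaf :=
  ker_subschemeι _

/-- The equations of the chart `i` vanish on the closure of the zero locus of the equations of the
chart `k`. -/
theorem ofIdealTop_equations_le_comap_map (i k : FramedAffine E) :
    ofIdealTop (φ.equations i) ≤
      ((ofIdealTop (φ.equations k)).map (chartι k)).comap (chartι i) := by
  set Z := (ofIdealTop (φ.equations k)).subschemeι with hZ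
  have hP := IsPullback.of_hasPullback (chartι i) (Z ≫ chartι k)
  have h1 : ofIdealTop (φ.equations i) ≤ (pullback.fst (chartι i) (Z ≫ chartι k)).ker := by
    rw [ofIdealTop_le_ker_iff]
    have hs : SameLine i k (pullback.fst (chartι i) (Z ≫ chartι k))
        (pullback.snd (chartι i) (Z ≫ chartι k) ≫ Z) :=
      sameLine_of_comp_chartι_eq (by rw [Category.assoc]; exact pullback.condition)
    rw [hs.map_equations_eq φ, ← ofIdealTop_le_ker_iff]
    refine le_trans ?_ (Scheme.Hom.le_ker_comp _ _)
    rw [hZ, ker_subschemeι]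
  intro W
  refine (h1 W).trans ?_
  have hq : QuasiCompact (Z ≫ chartι k) := inferInstance
  rw [ideal_comap_of_isOpenImmersion,
    Scheme.ker_ideal_of_isPullback_of_isOpenImmersion (Z ≫ chartι k)
      (pullback.fst (chartι i) (Z ≫ chartι k)) _ (chartι i) hP]
  exact le_rfl

/-- The closure of the zero locus in one chart is contained in the Higgs Grassmannian. -/
theorem idealSheaf_le (i : FramedAffine E) :
    φ.idealSheaf ≤ (ofIdealTop (φ.equations i)).map (chartι i) :=
  sInf_le fun j => ofIdealTop_equations_le_comap_map φ j i

theorem exists_framedAffine {X : Scheme.{0}} {E : X.Modules} (hE : IsLocallyFreeOfRank E 2) (x : X)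
    (W : X.Opens) (hx : x ∈ W) : ∃ i : FramedAffine E, x ∈ i.U.1 ∧ i.U.1 ≤ W := by
  obtain ⟨U, hxU, ⟨e⟩⟩ := hE x
  obtain ⟨_, ⟨V, hV, rfl⟩, hxV, hVU⟩ :=
    X.isBasis_affineOpens.exists_subset_of_mem_open (show x ∈ U ⊓ W from ⟨hxU, hx⟩)
      (U ⊓ W).isOpen
  have hVU' : V ≤ U ⊓ W := hVU
  exact ⟨⟨⟨V, hV⟩, e.restrict (hVU'.trans inf_le_left)⟩, hxV, hVU'.trans inf_le_right⟩

/-- Finitely many charts cover the projective bundle. -/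
theorem exists_finite_cover {X : Scheme.{0}} [X.Over (Spec (.of ℂ))] (E : X.Modules)
    [QuasiCompact (X ↘ Spec (.of ℂ))] (hE : IsLocallyFreeOfRank E 2) :
    ∃ (ι : Type) (_ : Finite ι) (c : ι → FramedAffine E),
      ∀ p, ∃ k, p ∈ Set.range (chartι (c k)) := by
  have : CompactSpace X := QuasiCompact.compactSpace_of_compactSpace (X ↘ Spec (.of ℂ))
  choose i hi _ using fun x => exists_framedAffine hE x ⊤ trivial
  obtain ⟨s, hs⟩ := isCompact_univ.elim_finite_subcover (fun x => ((i x).U.1 : Set X))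
    (fun x => (i x).U.1.isOpen) (fun x _ => Set.mem_iUnion.2 ⟨x, hi x⟩)
  have hfin : Finite s := s.finite_toSet
  refine ⟨s × Bool, inferInstance, fun k => if k.2 then i k.1 else (i k.1).swap, fun p => ?_⟩
  obtain ⟨x, hx, hp⟩ := Set.mem_iUnion₂.1 (hs (Set.mem_univ (projBundleProj E p)))
  rcases mem_range_chartι (i x) p hp with h | h
  · exact ⟨(⟨x, hx⟩, true), h⟩
  · exact ⟨(⟨x, hx⟩, false), h⟩

/-- The ideal sheaf of the Higgs Grassmannian, defined as an infimum, contains the equations of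
every chart. Restriction of ideals to a chart commutes with finite infima, so the ideal sheaf is
bounded below by the infimum of the ideals of the closures of the zero loci in finitely many charts
that cover. -/
theorem le_comap_idealSheaf [QuasiCompact (X ↘ Spec (.of ℂ))] (hE : IsLocallyFreeOfRank E 2)
    (i : FramedAffine E) : ofIdealTop (φ.equations i) ≤ φ.idealSheaf.comap (chartι i) := by
  obtain ⟨ι, hι, c, hc⟩ := exists_finite_cover E hE
  let I := ⨅ k, (ofIdealTop (φ.equations (c k))).map (chartι (c k))
  have h1 : ofIdealTop (φ.equations i) ≤ I.comap (chartι i) := by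
    intro W
    rw [ideal_comap_of_isOpenImmersion, ideal_iInf, iInf_apply, Ideal.comap_iInf]
    refine le_iInf fun k => ?_
    have := ofIdealTop_equations_le_comap_map φ i (c k) W
    rwa [ideal_comap_of_isOpenImmersion] at this
  refine h1.trans (comap_mono _ (le_sInf fun I' hI' => ?_))
  refine le_of_comap_le (fun k => chart (c k)) (fun k => chartι (c k)) hc fun k => ?_
  refine le_trans ?_ (hI' (c k))
  exact (comap_mono _ (iInf_le _ k)).trans (comap_map_le _ _)

/-- A point of a chart with values in `T` that satisfies the equations lies in the Higgs
Grassmannian. -/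
theorem exists_lift_grass (i : FramedAffine E) {T : Scheme.{0}} (x : T ⟶ chart i)
    (h : (φ.equations i).map x.appTop.hom = ⊥) :
    ∃ l : T ⟶ φ.grass, l ≫ φ.grassι = x ≫ chartι i := by
  have h1 : φ.grassι.ker ≤ (x ≫ chartι i).ker := by
    rw [ker_grassι]
    exact (idealSheaf_le φ i).trans (ker_le_map_of_le _ _ _ ((ofIdealTop_le_ker_iff _ _).2 h))
  exact ⟨IsClosedImmersion.lift φ.grassι (x ≫ chartι i) h1, IsClosedImmersion.lift_fac _ _ _⟩

/-- A point of the Higgs Grassmannian with values in `T` that lies in a chart satisfies the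
equations; the converse is `exists_lift_grass`. -/
theorem map_equations_eq_bot [QuasiCompact (X ↘ Spec (.of ℂ))] (hE : IsLocallyFreeOfRank E 2)
    (i : FramedAffine E) {T : Scheme.{0}} (x : T ⟶ chart i) (l : T ⟶ φ.grass)
    (h : l ≫ φ.grassι = x ≫ chartι i) : (φ.equations i).map x.appTop.hom = ⊥ := by
  rw [← ofIdealTop_le_ker_iff]
  refine (le_comap_idealSheaf φ hE i).trans ?_
  rw [← le_map_iff_comap_le, ← Scheme.Hom.ker_comp, ← h, ← ker_grassι]
  exact Scheme.Hom.le_ker_comp _ _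

end GrassIdeal

/-! ### Adapted frames -/

section Adapted

variable {X : Scheme.{0}} [X.Over (Spec (.of ℂ))] {E : X.Modules} (φ : HiggsField E)

/-- A frame is adapted to `φ` if `φ₁₂` generates the differential forms; then
`φ₂₂ - φ₁₁ = α φ₁₂` and `φ₂₁ = β φ₁₂`, and the eigenlines `e₁ + t e₂` are the solutions of
`t² = α t + β`. -/
structure IsAdapted (i : FramedAffine E) (α β : Γ(X, i.U.1)) : Prop where
  isGenerator : IsGenerator (φ.matrix i 0 1)
  sub_eq : φ.matrix i 1 1 - φ.matrix i 0 0 = α • φ.matrix i 0 1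
  eq : φ.matrix i 1 0 = β • φ.matrix i 0 1

theorem IsGenerator.exists_dual {U : X.Opens} {ω : Forms X U} (h : IsGenerator ω) :
    ∃ v : Module.Dual Γ(X, U) (Forms X U), ∀ r, v (r • ω) = r :=
  ⟨(LinearEquiv.ofBijective (LinearMap.toSpanSingleton _ _ ω) h).symm.toLinearMap,
    fun r => LinearEquiv.symm_apply_apply _ r⟩

theorem IsGenerator.smul {U : X.Opens} {ω : Forms X U} (h : IsGenerator ω) {a : Γ(X, U)}
    (ha : IsUnit a) : IsGenerator (a • ω) := by
  have : (fun r : Γ(X, U) => r • a • ω) = (fun r => r • ω) ∘ fun r => r * a := by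
    ext r
    simp [smul_smul]
  rw [IsGenerator, this]
  exact h.comp (IsUnit.isUnit_iff_mulRight_bijective.1 ha)

variable {φ}

/-- In an adapted frame, the equation contracted with a vector field `v` is `-v(φ₁₂)` times `z² -
(α z + β)`, and `v(φ₁₂) = 1` for some `v`. -/
theorem IsAdapted.evalIdeal_eq {i : FramedAffine E} {α β : Γ(X, i.U.1)} (hi : IsAdapted φ i α β)
    {T : Scheme.{0}} (b : T ⟶ X) (h : ⊤ ≤ b ⁻¹ᵁ i.U.1) (z : Γ(T, ⊤)) :
    evalIdeal φ i le_rfl b h z =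
      Ideal.span {z ^ 2 - (b.appLE i.U.1 ⊤ h α * z + b.appLE i.U.1 ⊤ h β)} := by
  have key (v : Module.Dual Γ(X, i.U.1) (Forms X i.U)) :
      eigenForm ((contractedMatrix φ i le_rfl v).map (b.appLE i.U.1 ⊤ h)) 1 z =
        -b.appLE i.U.1 ⊤ h (v (φ.matrix i 0 1)) *
          (z ^ 2 - (b.appLE i.U.1 ⊤ h α * z + b.appLE i.U.1 ⊤ h β)) := by
    have h1 : v (φ.matrix i 1 1) - v (φ.matrix i 0 0) = α * v (φ.matrix i 0 1) := by
      rw [← map_sub, hi.sub_eq, map_smul, smul_eq_mul]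
    have h2 : v (φ.matrix i 1 0) = β * v (φ.matrix i 0 1) := by
      rw [hi.eq, map_smul, smul_eq_mul]
    have h1' := congrArg (b.appLE i.U.1 ⊤ h) h1
    have h2' := congrArg (b.appLE i.U.1 ⊤ h) h2
    simp only [map_sub, map_mul] at h1' h2'
    simp only [eigenForm, Matrix.map_apply, contractedMatrix, resForm_self]
    linear_combination z * h1' + h2'
  obtain ⟨v, hv⟩ := hi.isGenerator.exists_dual
  refine le_antisymm (Ideal.span_le.2 ?_) ((Ideal.span_singleton_le_iff_mem _).2 ?_)
  · rintro _ ⟨v, rfl⟩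
    simp only [key]
    exact Ideal.mul_mem_left _ _ (Ideal.mem_span_singleton_self _)
  · have h1 : v (φ.matrix i 0 1) = 1 := by simpa using hv 1
    have h2 := key v
    rw [h1, map_one] at h2
    rw [← neg_mem_iff, ← neg_one_mul, ← h2]
    exact Ideal.subset_span ⟨v, rfl⟩

end Adapted

/-! ### The Higgs Grassmannian in an adapted frame -/

section Curve

variable {X : Scheme.{0}} [X.Over (Spec (.of ℂ))] [SmoothOfRelativeDimension 1 (X ↘ Spec (.of ℂ))]
  [IsSeparated (X ↘ Spec (.of ℂ))] [QuasiCompact (X ↘ Spec (.of ℂ))]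
  {E : X.Modules} (φ : HiggsField E)

instance smooth_of_relativeDimension_one {X S : Scheme.{0}} (f : X ⟶ S)
    [SmoothOfRelativeDimension 1 f] : Smooth f :=
  SmoothOfRelativeDimension.smooth 1 f

omit [IsSeparated (X ↘ Spec (.of ℂ))] in
/-- If the greatest common divisor of `φ` is one, every point has a neighbourhood with an adapted
frame. -/
theorem exists_isAdapted [IrreducibleSpace X] (hE : IsLocallyFreeOfRank E 2)
    (hgcd : ∀ i : FramedAffine E, φ.GcdEqOne i) (x : X) :
    ∃ (i : FramedAffine E) (α β : Γ(X, i.U.1)), x ∈ i.U.1 ∧ IsAdapted φ i α β := by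
  obtain ⟨y, hy, hxy⟩ := exists_isClosed_specializes x
  obtain ⟨i₀, hy₀, -⟩ := exists_framedAffine hE y ⊤ trivial
  obtain ⟨V, hV, hyV, -, ⟨ω, hω⟩, π, hπ⟩ := exists_localParameter hy i₀.U.1 hy₀
  -- it suffices to find a frame over `V` for which `φ₁₂` does not vanish at `y`
  suffices h : ∃ (e : Frame E 2 V.1) (a : Γ(X, V.1)),
      φ.matrix ⟨V, e⟩ 0 1 = a • ω ∧ y ∈ X.basicOpen a by
    obtain ⟨e, a, ha, hya⟩ := h
    have hV : IsAffineOpen V.1 := V.2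
    let W : X.affineOpens := ⟨X.basicOpen a, hV.basicOpen a⟩
    have hWV : W.1 ≤ V.1 := X.basicOpen_le a
    have hu : IsUnit (X.presheaf.map (homOfLE hWV).op a) :=
      X.toRingedSpace.isUnit_res_basicOpen a
    have hgen : IsGenerator (φ.matrix (FramedAffine.restrict ⟨V, e⟩ W hWV) 0 1) := by
      rw [matrix_restrict, ha, resForm_smul]
      exact (hω.res hWV).smul hu
    obtain ⟨α, hα⟩ := hgen.2 (φ.matrix (FramedAffine.restrict ⟨V, e⟩ W hWV) 1 1 -
      φ.matrix (FramedAffine.restrict ⟨V, e⟩ W hWV) 0 0)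
    obtain ⟨β, hβ⟩ := hgen.2 (φ.matrix (FramedAffine.restrict ⟨V, e⟩ W hWV) 1 0)
    exact ⟨FramedAffine.restrict ⟨V, e⟩ W hWV, α, β, hxy.mem_open W.1.isOpen hya,
      hgen, hα.symm, hβ.symm⟩
  let i := i₀.restrict V hV
  obtain ⟨a, ha⟩ := hω.2 (φ.matrix i 0 1)
  obtain ⟨c, hc⟩ := hω.2 (φ.matrix i 1 0)
  obtain ⟨d, hd⟩ := hω.2 (φ.matrix i 1 1 - φ.matrix i 0 0)
  simp only at ha hc hd
  by_cases hya : y ∈ X.basicOpen a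
  · exact ⟨i.frame, a, ha.symm, hya⟩
  by_cases hyc : y ∈ X.basicOpen c
  · exact ⟨i.swap.frame, c, (matrix_swap φ i 0 1).trans hc.symm, hyc⟩
  -- if also `φ₂₂ - φ₁₁` vanished at `y`, the local parameter `π` would be a common divisor
  have hyd : y ∈ X.basicOpen d := by
    by_contra hyd
    rw [hπ, Ideal.mem_span_singleton'] at hya hyc hyd
    obtain ⟨a', rfl⟩ := hya
    obtain ⟨c', rfl⟩ := hyc
    obtain ⟨d', rfl⟩ := hyd
    have hs (r : Γ(X, V.1)) : (r * π) • ω = π • r • ω := by rw [smul_smul, mul_comm]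
    have hu : IsUnit π := hgcd i π ⟨a' • ω, ha.symm.trans (hs a')⟩
      ⟨c' • ω, hc.symm.trans (hs c')⟩ ⟨d' • ω, hd.symm.trans (hs d')⟩
    refine (hπ π).2 (Ideal.mem_span_singleton_self π) ?_
    rw [Scheme.basicOpen_of_isUnit _ hu]
    exact hyV
  -- in the frame `(e₁, e₁ + e₂)` the entry `φ₁₂` becomes `φ₁₂ - φ₂₁ - (φ₂₂ - φ₁₁)`
  refine ⟨i.shear.frame, a - c - d, (matrix_shear_zero_one φ i).trans ?_, ?_⟩
  · have key : ∀ p q r s : Forms X V, p + q - r - s = q - r - (s - p) := fun p q r s => by abel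
    refine (key _ _ _ _).trans ?_
    rw [sub_smul, sub_smul, ha, hc, hd]
    rfl
  · by_contra h
    rw [hπ] at hya hyc h
    exact (hπ d).2 (by simpa using sub_mem (sub_mem hya hyc) h) hyd

variable {φ}

theorem exists_chart_factor {X : Scheme.{0}} {E : X.Modules} (K : Type) [Field K]
    (f : Spec (.of K) ⟶ projBundle E) :
    ∃ (j : FramedAffine E) (y : Spec (.of K) ⟶ chart j), y ≫ chartι j = f := by
  obtain ⟨j, q, hq⟩ := exists_chartι_eq (f (IsLocalRing.closedPoint K))
  refine ⟨j, IsOpenImmersion.lift (chartι j) f ?_, IsOpenImmersion.lift_fac _ _ _⟩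
  rintro _ ⟨t, rfl⟩
  have : Subsingleton (PrimeSpectrum K) := inferInstance
  exact ⟨q, hq.trans (congrArg f (this.elim _ _))⟩

/-- The Higgs Grassmannian lies in the chart of an adapted frame: the line spanned by `e₂` is
not an eigenline. -/
theorem IsAdapted.exists_chart_point (hE : IsLocallyFreeOfRank E 2) {i : FramedAffine E}
    {α β : Γ(X, i.U.1)} (hi : IsAdapted φ i α β) {T : Scheme.{0}} (l : T ⟶ φ.grass)
    (h : ⊤ ≤ (l ≫ φ.grassProj) ⁻¹ᵁ i.U.1) : ∃ x : T ⟶ chart i, x ≫ chartι i = l ≫ φ.grassι := by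
  refine ⟨IsOpenImmersion.lift (chartι i) (l ≫ φ.grassι) ?_, IsOpenImmersion.lift_fac _ _ _⟩
  rintro _ ⟨t, rfl⟩
  let K := T.residueField t
  let f := T.fromSpecResidueField t
  let pt : Spec K := IsLocalRing.closedPoint _
  have hf : f pt = t := by
    have : f pt ∈ Set.range f := ⟨_, rfl⟩
    rwa [Scheme.range_fromSpecResidueField] at this
  obtain ⟨j, y, hy⟩ := exists_chart_factor (T.residueField t) (f ≫ l ≫ φ.grassι)
  have h' : ⊤ ≤ (y ≫ chartProj j) ⁻¹ᵁ i.U.1 := by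
    intro s _
    rw [← chartι_proj, ← Category.assoc, hy]
    exact h (show f s ∈ (⊤ : T.Opens) from trivial)
  have hT : ∀ a : Γ(Spec K, ⊤), a = 0 ∨ IsUnit a := eq_zero_or_isUnit_of_field (T.residueField t)
  rcases exists_sameLine j i hT y h' with ⟨x, hx⟩ | ⟨x, hx, hx0⟩
  · refine ⟨x pt, ?_⟩
    have := hy ▸ hx.comp_chartι_eq
    exact (congrArg (fun f => f pt) this).symm.trans (congrArg (l ≫ φ.grassι) hf)
  · exfalso
    have h1 := map_equations_eq_bot φ hE i.swap x (f ≫ l) (by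
      rw [← hx.comp_chartι_eq, hy, Category.assoc])
    obtain ⟨v, hv⟩ := hi.isGenerator.exists_dual
    have hv1 : v (φ.matrix i.swap 1 0) = 1 := by
      rw [matrix_swap]
      simpa using hv 1
    rw [map_equations, hx0, evalIdeal] at h1
    have h2 : (1 : Γ(Spec K, ⊤)) ∈ (⊥ : Ideal Γ(Spec K, ⊤)) := by
      rw [← h1]
      refine Ideal.subset_span ⟨v, ?_⟩
      simp only [eigenForm, Matrix.map_apply, contractedMatrix]
      have h3 : v (resForm X (le_refl i.U.1) (φ.matrix i.swap 1 0)) = 1 :=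
        (congrArg v (resForm_self _ _)).trans hv1
      rw [mul_zero, one_pow, mul_one, zero_pow two_ne_zero, mul_zero, add_zero, sub_zero]
      exact (congrArg _ h3).trans (map_one _)
    have : Nontrivial Γ(Spec K, ⊤) :=
      (Scheme.ΓSpecIso K).commRingCatIsoToRingEquiv.toEquiv.nontrivial
    exact one_ne_zero h2

/-- The points of the Higgs Grassmannian over the domain of an adapted frame are the solutions of
`z² = α z + β`. -/
theorem IsAdapted.exists_coord (hE : IsLocallyFreeOfRank E 2) {i : FramedAffine E}
    {α β : Γ(X, i.U.1)} (hi : IsAdapted φ i α β) {T : Scheme.{0}} (l : T ⟶ φ.grass) (b : T ⟶ X)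
    (hb : l ≫ φ.grassProj = b) (h : ⊤ ≤ b ⁻¹ᵁ i.U.1) :
    ∃ z, z ^ 2 = b.appLE i.U.1 ⊤ h α * z + b.appLE i.U.1 ⊤ h β ∧
      l ≫ φ.grassι = chartPt i b h z ≫ chartι i := by
  subst hb
  obtain ⟨x, hx⟩ := hi.exists_chart_point hE l h
  have hb : x ≫ chartProj i = l ≫ φ.grassProj := by
    rw [← chartι_proj, ← Category.assoc, hx, Category.assoc]
    rfl
  have hx' : x = chartPt i (l ≫ φ.grassProj) h (x.appTop (chartCoord i)) :=
    chart_hom_ext (by rw [hb, chartPt_proj]) (by rw [chartPt_coord])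
  refine ⟨x.appTop (chartCoord i), ?_, by rw [← hx, ← hx']⟩
  have h1 := map_equations_eq_bot φ hE i x l hx.symm
  rw [map_equations] at h1
  simp only [hb] at h1
  rw [hi.evalIdeal_eq, Ideal.span_singleton_eq_bot] at h1
  exact sub_eq_zero.1 h1

omit [QuasiCompact (X ↘ Spec (.of ℂ))] in
/-- Conversely, a solution of `z² = α z + β` is a point of the Higgs Grassmannian. -/
theorem IsAdapted.exists_point {i : FramedAffine E}
    {α β : Γ(X, i.U.1)} (hi : IsAdapted φ i α β) {T : Scheme.{0}} (b : T ⟶ X)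
    (h : ⊤ ≤ b ⁻¹ᵁ i.U.1) (z : Γ(T, ⊤))
    (hz : z ^ 2 = b.appLE i.U.1 ⊤ h α * z + b.appLE i.U.1 ⊤ h β) :
    ∃ l : T ⟶ φ.grass, l ≫ φ.grassι = chartPt i b h z ≫ chartι i ∧ l ≫ φ.grassProj = b := by
  obtain ⟨l, hl⟩ := exists_lift_grass φ i (chartPt i b h z) (by
    rw [map_equations, chartPt_coord]
    simp only [chartPt_proj]
    rw [hi.evalIdeal_eq, Ideal.span_singleton_eq_bot, hz, sub_self])
  refine ⟨l, hl, ?_⟩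
  rw [HiggsField.grassProj, ← Category.assoc, hl, Category.assoc, chartι_proj, chartPt_proj]

end Curve

/-! ### The quadratic polynomial of an adapted frame -/

section SpectralCurve

open Polynomial

/-- The polynomial `t² - (α t + β)` whose roots are the eigenlines `e₁ + t e₂` in an adapted
frame. -/
def curvePoly {A : Type} [CommRing A] (α β : A) : A[X] := X ^ 2 - (C α * X + C β)

theorem curvePoly_monic {A : Type} [CommRing A] (α β : A) : (curvePoly α β).Monic := by
  rcases subsingleton_or_nontrivial A with h | h
  · exact Subsingleton.elim _ _
  · refine (monic_X_pow 2).sub_of_left ?_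
    rw [degree_X_pow]
    exact degree_linear_le.trans_lt (by norm_num)

theorem natDegree_curvePoly {A : Type} [CommRing A] [Nontrivial A] (α β : A) :
    (curvePoly α β).natDegree = 2 := by
  rw [curvePoly]
  compute_degree!

theorem eval₂_curvePoly {A B : Type} [CommRing A] [CommRing B] (α β : A) (f : A →+* B) (z : B) :
    (curvePoly α β).eval₂ f z = z ^ 2 - (f α * z + f β) := by
  simp [curvePoly]

end SpectralCurve

/-! ### Morphisms from and to affine schemes -/

section Local

/-- A property of morphisms that is local on the target can be checked on the spectra of affine
open sets covering the target. -/
theorem of_forall_isPullback_fromSpec {P : MorphismProperty Scheme.{0}} [IsZariskiLocalAtTarget P]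
    [P.IsStableUnderBaseChange] {Y X : Scheme.{0}} (f : Y ⟶ X)
    (h : ∀ x : X, ∃ (U : X.Opens) (hU : IsAffineOpen U) (Z : Scheme.{0}) (q : Z ⟶ Y)
      (p : Z ⟶ Spec Γ(X, U)), x ∈ U ∧ IsPullback q p f hU.fromSpec ∧ P p) : P f := by
  choose U hU Z q p hx hq hp using h
  refine IsZariskiLocalAtTarget.of_iSup_eq_top U (top_le_iff.1 fun x _ =>
    Opens.mem_iSup.2 ⟨x, hx x⟩) fun x => ?_
  have h1 := (isPullback_morphismRestrict f (U x)).flip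
  have e : (hU x).isoSpec.hom ≫ (hU x).fromSpec = (U x).ι := by
    rw [← (hU x).isoSpec_inv_ι]
    simp
  rw [← e] at h1
  let l := (hq x).lift _ _ (h1.w.trans (Category.assoc _ _ _).symm)
  have h2 : IsPullback l (f ∣_ U x) (p x) (hU x).isoSpec.hom :=
    IsPullback.of_right (by rw [(hq x).lift_fst]; exact h1) ((hq x).lift_snd _ _ _) (hq x)
  exact P.of_isPullback h2 (hp x)

theorem appLE_fromSpec {X : Scheme.{0}} {U : X.Opens} (hU : IsAffineOpen U)
    (h : ⊤ ≤ hU.fromSpec ⁻¹ᵁ U) (a : Γ(X, U)) :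
    hU.fromSpec.appLE U ⊤ h a = (Scheme.ΓSpecIso Γ(X, U)).inv a := by
  have e' : hU.fromSpec.appLE U ⊤ h = (Scheme.ΓSpecIso Γ(X, U)).inv := by
    rw [Scheme.Hom.appLE, hU.fromSpec_app_self, Category.assoc]
    refine (congrArg ((Scheme.ΓSpecIso Γ(X, U)).inv ≫ ·)
      ((Functor.map_comp _ _ _).symm.trans ((Spec Γ(X, U)).presheaf.map_id _))).trans
      (Category.comp_id _)
  exact congrArg (fun f => f.hom a) e'

theorem appLE_comp_apply {X T S : Scheme.{0}} {U : X.Opens} (b : S ⟶ X) (c : T ⟶ S)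
    (h : ⊤ ≤ b ⁻¹ᵁ U) (h' : ⊤ ≤ (c ≫ b) ⁻¹ᵁ U) (a : Γ(X, U)) :
    (c ≫ b).appLE U ⊤ h' a = c.appTop (b.appLE U ⊤ h a) := by
  have hc : ⊤ ≤ c ⁻¹ᵁ ⊤ := fun _ _ => trivial
  have e := Scheme.Hom.appLE_comp_appLE c b U ⊤ ⊤ h hc
  have e₁ : c.appTop = c.appLE ⊤ ⊤ hc := Scheme.Hom.app_eq_appLE c
  rw [e₁, ← e]
  rfl

theorem top_le_comp {X T S : Scheme.{0}} {U : X.Opens} (b : S ⟶ X) (c : T ⟶ S)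
    (h : ⊤ ≤ b ⁻¹ᵁ U) : ⊤ ≤ (c ≫ b) ⁻¹ᵁ U :=
  fun t _ => h (show c t ∈ (⊤ : S.Opens) from trivial)

theorem hom_Spec_ext {T : Scheme.{0}} {R : CommRingCat.{0}} {m m' : T ⟶ Spec R}
    (h : ∀ r : R, m.appTop ((Scheme.ΓSpecIso R).inv r) = m'.appTop ((Scheme.ΓSpecIso R).inv r)) :
    m = m' := by
  apply ext_of_isAffine
  ext r
  simpa using h ((Scheme.ΓSpecIso R).hom r)

theorem exists_hom_Spec {T : Scheme.{0}} {R : CommRingCat.{0}} (f : R ⟶ Γ(T, ⊤)) :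
    ∃ m : T ⟶ Spec R, ∀ r : R, m.appTop ((Scheme.ΓSpecIso R).inv r) = f r := by
  refine ⟨T.toSpecΓ ≫ Spec.map f, fun r => ?_⟩
  have h := congrArg (fun g => g.hom r) (Scheme.ΓSpecIso_inv_naturality f)
  rw [Scheme.Hom.comp_appTop, CommRingCat.comp_apply]
  refine (congrArg T.toSpecΓ.appTop h.symm).trans ?_
  rw [Scheme.toSpecΓ_appTop]
  exact congrArg (fun g => g.hom (f r)) (Scheme.ΓSpecIso Γ(T, ⊤)).inv_hom_id

theorem top_le_fromSpec {X : Scheme.{0}} {U : X.Opens} (hU : IsAffineOpen U) :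
    ⊤ ≤ hU.fromSpec ⁻¹ᵁ U :=
  hU.fromSpec_preimage_self.ge

theorem chartPt_congr {X : Scheme.{0}} {E : X.Modules} {i : FramedAffine E} {T : Scheme.{0}}
    {b b' : T ⟶ X} {h : ⊤ ≤ b ⁻¹ᵁ i.U.1} {h' : ⊤ ≤ b' ⁻¹ᵁ i.U.1} {z z' : Γ(T, ⊤)}
    (hb : b = b') (hz : z = z') : chartPt i b h z = chartPt i b' h' z' := by
  subst hb hz
  rfl

end Local

/-! ### Finiteness, flatness and degree -/

section Pullback

variable {X : Scheme.{0}} [X.Over (Spec (.of ℂ))] [SmoothOfRelativeDimension 1 (X ↘ Spec (.of ℂ))]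
  [IsSeparated (X ↘ Spec (.of ℂ))] [QuasiCompact (X ↘ Spec (.of ℂ))]
  {E : X.Modules} {φ : HiggsField E}

/-- Over an affine scheme that maps to the domain of an adapted frame, the Higgs Grassmannian is the
curve `t² = α t + β`. -/
theorem IsAdapted.exists_isPullback (hE : IsLocallyFreeOfRank E 2) {i : FramedAffine E}
    {α β : Γ(X, i.U.1)} (hi : IsAdapted φ i α β) {R₀ : CommRingCat.{0}} (b : Spec R₀ ⟶ X)
    (h : ⊤ ≤ b ⁻¹ᵁ i.U.1) {α' β' : R₀}
    (hα : b.appLE i.U.1 ⊤ h α = (Scheme.ΓSpecIso R₀).inv α')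
    (hβ : b.appLE i.U.1 ⊤ h β = (Scheme.ΓSpecIso R₀).inv β') :
    ∃ q : Spec (.of (AdjoinRoot (curvePoly α' β'))) ⟶ φ.grass,
      IsPullback q (Spec.map (CommRingCat.ofHom (AdjoinRoot.of (curvePoly α' β')))) φ.grassProj
        b := by
  set R := CommRingCat.of (AdjoinRoot (curvePoly α' β')) with hR
  set p : Spec R ⟶ Spec R₀ :=
    Spec.map (CommRingCat.ofHom (AdjoinRoot.of (curvePoly α' β'))) with hp
  let r : R := AdjoinRoot.root (curvePoly α' β')
  have hpa (a : R₀) : p.appTop ((Scheme.ΓSpecIso R₀).inv a) =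
      (Scheme.ΓSpecIso R).inv (AdjoinRoot.of (curvePoly α' β') a) :=
    congrArg (fun g => g.hom a) (Scheme.ΓSpecIso_inv_naturality
      (CommRingCat.ofHom (AdjoinRoot.of (curvePoly α' β')))).symm
  have hr : r ^ 2 =
      AdjoinRoot.of (curvePoly α' β') α' * r + AdjoinRoot.of (curvePoly α' β') β' := by
    have := AdjoinRoot.eval₂_root (curvePoly α' β')
    rw [eval₂_curvePoly] at this
    exact sub_eq_zero.1 this
  obtain ⟨q, hq, hqp⟩ := hi.exists_point (p ≫ b) (top_le_comp b p h)
    ((Scheme.ΓSpecIso R).inv r) (by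
      rw [appLE_comp_apply b p h, appLE_comp_apply b p h, hα, hβ, hpa, hpa,
        ← map_pow, hr, map_add, map_mul])
  have key {T : Scheme.{0}} (l : T ⟶ φ.grass) (c : T ⟶ Spec R₀)
      (hlc : l ≫ φ.grassProj = c ≫ b) : ∃ m : T ⟶ Spec R, m ≫ q = l ∧ m ≫ p = c := by
    obtain ⟨z, hz, hlz⟩ := hi.exists_coord hE l (c ≫ b) hlc (top_le_comp b c h)
    rw [appLE_comp_apply b c h, appLE_comp_apply b c h, hα, hβ] at hz
    have hev := (eval₂_curvePoly α' β'
      ((Scheme.ΓSpecIso R₀).inv ≫ c.appTop).hom z).trans (sub_eq_zero.2 hz)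
    let f : AdjoinRoot (curvePoly α' β') →+* Γ(T, ⊤) := AdjoinRoot.lift _ z hev
    obtain ⟨m, hm⟩ := exists_hom_Spec (R := R) (CommRingCat.ofHom f)
    have hmp : m ≫ p = c := hom_Spec_ext fun a => by
      rw [Scheme.Hom.comp_appTop, CommRingCat.comp_apply, hpa, hm]
      change f (AdjoinRoot.of (curvePoly α' β') a) =
        ((Scheme.ΓSpecIso R₀).inv ≫ c.appTop).hom a
      rw [AdjoinRoot.lift_of]
    refine ⟨m, ?_, hmp⟩
    rw [← cancel_mono φ.grassι, Category.assoc, hq, hlz, ← Category.assoc,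
      comp_chartPt i m _ _ (by rw [← Category.assoc]; exact top_le_comp b _ h)]
    congr 1
    refine chartPt_congr (by rw [← Category.assoc, hmp]) ?_
    rw [hm]
    exact AdjoinRoot.lift_root hev
  have uniq {T : Scheme.{0}} (m m' : T ⟶ Spec R) (h1 : m ≫ q = m' ≫ q) (h2 : m ≫ p = m' ≫ p) :
      m = m' := by
    have h3 : (m ≫ chartPt i (p ≫ b) (top_le_comp b p h)
        ((Scheme.ΓSpecIso R).inv r)) ≫ chartι i = (m' ≫ chartPt i (p ≫ b)
        (top_le_comp b p h) ((Scheme.ΓSpecIso R).inv r)) ≫ chartι i := by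
      rw [Category.assoc, Category.assoc, ← hq, ← Category.assoc, h1, Category.assoc]
    rw [cancel_mono] at h3
    have h4 := congrArg (fun f => f.appTop (chartCoord i)) h3
    simp only [Scheme.Hom.comp_appTop, CommRingCat.comp_apply, chartPt_coord] at h4
    have h5 : ((Scheme.ΓSpecIso R).inv ≫ m.appTop).hom =
        ((Scheme.ΓSpecIso R).inv ≫ m'.appTop).hom := by
      refine Ideal.Quotient.ringHom_ext (Polynomial.ringHom_ext (fun a => ?_) h4)
      have := congrArg (fun f => f.appTop ((Scheme.ΓSpecIso R₀).inv a)) h2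
      simp only [Scheme.Hom.comp_appTop, CommRingCat.comp_apply, hpa] at this
      exact this
    exact hom_Spec_ext fun r => congrArg (fun f => f r) h5
  choose m hm hm' using fun s : PullbackCone φ.grassProj b =>
    key s.fst s.snd s.condition
  exact ⟨q, ⟨⟨hqp⟩, ⟨PullbackCone.IsLimit.mk _ m hm hm' fun s m' h h' =>
    uniq _ _ (h.trans (hm s).symm) (h'.trans (hm' s).symm)⟩⟩⟩

theorem IsAdapted.exists_isPullback_fromSpec (hE : IsLocallyFreeOfRank E 2) {i : FramedAffine E}
    {α β : Γ(X, i.U.1)} (hi : IsAdapted φ i α β) (hU : IsAffineOpen i.U.1) :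
    ∃ q : Spec (.of (AdjoinRoot (curvePoly α β))) ⟶ φ.grass,
      IsPullback q (Spec.map (CommRingCat.ofHom (AdjoinRoot.of (curvePoly α β)))) φ.grassProj
        hU.fromSpec :=
  hi.exists_isPullback hE hU.fromSpec (top_le_fromSpec hU) (appLE_fromSpec hU _ _)
    (appLE_fromSpec hU _ _)

section Finite

variable [IrreducibleSpace X] (hE : IsLocallyFreeOfRank E 2)
  (hgcd : ∀ i : FramedAffine E, φ.GcdEqOne i)

include hE hgcd

/-- A local property holds for `ρ₁` if it holds for all the curves `t² = α t + β`. -/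
theorem grassProj_of_forall_curve {P : MorphismProperty Scheme.{0}} [IsZariskiLocalAtTarget P]
    [P.IsStableUnderBaseChange] (h : ∀ (A : CommRingCat.{0}) (α β : A),
      P (Spec.map (CommRingCat.ofHom (AdjoinRoot.of (curvePoly α β))))) : P φ.grassProj := by
  refine of_forall_isPullback_fromSpec _ fun x => ?_
  obtain ⟨i, α, β, hx, hi⟩ := exists_isAdapted φ hE hgcd x
  have hU : IsAffineOpen i.U.1 := i.U.2
  obtain ⟨q, hq⟩ := hi.exists_isPullback_fromSpec hE hU
  exact ⟨i.U.1, hU, _, q, _, hx, hq, h _ α β⟩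

theorem isFinite_grassProj : IsFinite φ.grassProj :=
  have : IsZariskiLocalAtTarget @IsFinite.{0} :=
    have : HasAffineProperty @IsFinite.{0} (affineAnd RingHom.Finite) :=
      (HasAffineProperty.affineAnd_iff _ RingHom.finite_respectsIso
        RingHom.finite_localizationPreserves.away RingHom.finite_ofLocalizationSpan).2
        fun f => by simp [isFinite_iff]
    HasAffineProperty.instIsZariskiLocalAtTarget (Q := affineAnd RingHom.Finite)
  grassProj_of_forall_curve hE hgcd (P := @IsFinite) fun _ α β =>
    (IsFinite.SpecMap_iff _).2 (RingHom.finite_algebraMap.2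
      (curvePoly_monic α β).finite_adjoinRoot)

theorem flat_grassProj : Flat φ.grassProj :=
  have : IsZariskiLocalAtTarget @Flat.{0} := HasRingHomProperty.instIsZariskiLocalAtTarget @Flat
  grassProj_of_forall_curve hE hgcd (P := @Flat) fun A α β =>
    Flat.SpecMap_iff.2 (by
      have := (curvePoly_monic α β).free_adjoinRoot
      exact (RingHom.flat_algebraMap_iff (R := A) (S := AdjoinRoot (curvePoly α β))).2
        inferInstance)

theorem finrank_grassProj (x : X) : φ.grassProj.finrank x = 2 := by
  have := isFinite_grassProj hE hgcd
  have := flat_grassProj hE hgcd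
  obtain ⟨i, α, β, hx, hi⟩ := exists_isAdapted φ hE hgcd x
  have hU : IsAffineOpen i.U.1 := i.U.2
  obtain ⟨q, hq⟩ := hi.exists_isPullback_fromSpec hE hU
  obtain ⟨y, rfl⟩ : x ∈ Set.range hU.fromSpec := by
    rw [hU.range_fromSpec]
    exact hx
  rw [← Scheme.Hom.finrank_of_isPullback _ _ _ _ hq]
  have := (curvePoly_monic α β).free_adjoinRoot
  have := (curvePoly_monic α β).finite_adjoinRoot
  refine (Scheme.Hom.finrank_SpecMap_algebraMap Γ(X, i.U.1)
    (AdjoinRoot (curvePoly α β)) y).trans ?_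
  have : Nontrivial Γ(X, i.U.1) := (show PrimeSpectrum Γ(X, i.U.1) from y).nontrivial
  rw [Module.rankAtStalk_eq_finrank_of_free]
  exact (PowerBasis.finrank (AdjoinRoot.powerBasis' (curvePoly_monic α β))).trans
    ((AdjoinRoot.powerBasis'_dim _).trans (natDegree_curvePoly α β))

end Finite

end Pullback

/-! ### Extension of functions on a normal scheme -/

section Density

variable {X : Scheme.{0}}

theorem map_map {U V W : X.Opens} (h : V ≤ U) (h' : W ≤ V) (f : Γ(X, U)) :
    X.presheaf.map (homOfLE h').op (X.presheaf.map (homOfLE h).op f) =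
      X.presheaf.map (homOfLE (h'.trans h)).op f := by
  rw [← CommRingCat.comp_apply, ← Functor.map_comp]
  rfl

theorem inf_nonempty [IrreducibleSpace X] {U V : X.Opens} (hU : (U : Set X).Nonempty)
    (hV : (V : Set X).Nonempty) : ((U ⊓ V : X.Opens) : Set X).Nonempty :=
  nonempty_preirreducible_inter U.isOpen V.isOpen hU hV

/-- Functions on an integral scheme are determined by their restriction to a nonempty open set. -/
theorem eq_of_map_eq [IsIntegral X] {U V : X.Opens} (h : V ≤ U)
    (hV : (U : Set X).Nonempty → (V : Set X).Nonempty) {f g : Γ(X, U)}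
    (hfg : X.presheaf.map (homOfLE h).op f = X.presheaf.map (homOfLE h).op g) : f = g := by
  rcases (U : Set X).eq_empty_or_nonempty with hU | hU
  · obtain rfl : U = ⊥ := SetLike.coe_injective hU
    exact Subsingleton.elim _ _
  · have : Nonempty V := (hV hU).to_subtype
    exact map_injective_of_isIntegral X (homOfLE h) hfg

/-- By normality, a root of a monic quadratic polynomial on a smaller open set extends. -/
theorem exists_root_extension [IsIntegral X] {U V : X.Opens} (hU : IsAffineOpen U) (h : V ≤ U)
    (hV : (V : Set X).Nonempty) [IsIntegrallyClosed Γ(X, U)] (α β : Γ(X, U)) (σ : Γ(X, V))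
    (hσ : σ ^ 2 = X.presheaf.map (homOfLE h).op α * σ + X.presheaf.map (homOfLE h).op β) :
    ∃ τ : Γ(X, U), X.presheaf.map (homOfLE h).op τ = σ ∧ τ ^ 2 = α * τ + β := by
  have : Nonempty V := hV.to_subtype
  have : Nonempty U := ⟨⟨_, h hV.some_mem⟩⟩
  have hfrac : IsFractionRing Γ(X, U) X.functionField :=
    functionField_isFractionRing_of_isAffineOpen X U hU
  have hg (a : Γ(X, U)) : X.germToFunctionField V (X.presheaf.map (homOfLE h).op a) =
      algebraMap Γ(X, U) X.functionField a :=
    TopCat.Presheaf.germ_res_apply _ _ _ _ _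
  have hint : IsIntegral Γ(X, U) (X.germToFunctionField V σ) := by
    refine ⟨curvePoly α β, curvePoly_monic α β, ?_⟩
    rw [eval₂_curvePoly, ← hg, ← hg, ← map_pow, hσ, map_add, map_mul, sub_self]
  obtain ⟨τ, hτ⟩ := IsIntegrallyClosed.isIntegral_iff.1 hint
  rw [← hg] at hτ
  have h1 := Scheme.germToFunctionField_injective X V hτ
  refine ⟨τ, h1, ?_⟩
  apply map_injective_of_isIntegral X (homOfLE h)
  rw [map_pow, map_add, map_mul, h1, hσ]

/-- If `(a, b)` is unimodular and `b` is a solution of a quadratic equation monic in `b`,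
homogenized by `a`, then `a` is a unit: where `a` vanishes, so does `b`. -/
theorem isUnit_of_quadratic {A : Type*} [CommRing A] {a b α β p q : A} (h1 : p * a + q * b = 1)
    (h2 : b ^ 2 = α * (a * b) + β * a ^ 2) : IsUnit a := by
  refine IsUnit.of_mul_eq_one (p ^ 2 * a + 2 * p * q * b + q ^ 2 * (α * b + β * a)) ?_
  linear_combination (p * a + q * b + 1) * h1 - q ^ 2 * h2

end Density

/-! ### Frames with prescribed first vector -/

section Lower

variable {X : Scheme.{0}} {E : X.Modules}

/-- The framed affine open set with the frame `(e₁, e₂)` replaced by `(e₁ + t e₂, e₂)`. -/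
def FramedAffine.lower (i : FramedAffine E) (t : Γ(X, i.U.1)) : FramedAffine E :=
  ⟨i.U, i.frame.change !![1, 0; t, 1] (by simp [Matrix.det_fin_two])⟩

theorem FramedAffine.lower_vec_zero (i : FramedAffine E) (t : Γ(X, i.U.1)) :
    (i.lower t).frame.vec 0 = i.frame.vec 0 + t • i.frame.vec 1 := by
  simp [FramedAffine.lower, Frame.change, Fin.sum_univ_two]

theorem FramedAffine.lower_vec_one (i : FramedAffine E) (t : Γ(X, i.U.1)) :
    (i.lower t).frame.vec 1 = i.frame.vec 1 := by
  simp [FramedAffine.lower, Frame.change, Fin.sum_univ_two]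

variable [X.Over (Spec (.of ℂ))] {φ : HiggsField E}

/-- The vector `e₁ + t e₂` spans an invariant line exactly where `t` is a root of `t² - α t - β`.
-/
theorem IsAdapted.matrix_lower {i : FramedAffine E} {α β : Γ(X, i.U.1)} (hi : IsAdapted φ i α β)
    (t : Γ(X, i.U.1)) :
    φ.matrix (i.lower t) 1 0 = (α * t + β - t ^ 2) • φ.matrix i 0 1 := by
  have h : φ.app i.U (i.frame.vec 0 + t • i.frame.vec 1) =
      (i.frame.vec 0 + t • i.frame.vec 1) ⊗ₜ[Γ(X, i.U.1)]
        (φ.matrix i 0 0 + t • φ.matrix i 0 1) +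
      i.frame.vec 1 ⊗ₜ ((α * t + β - t ^ 2) • φ.matrix i 0 1) := by
    have h1 : φ.matrix i 1 1 = φ.matrix i 0 0 + α • φ.matrix i 0 1 := by
      rw [← hi.sub_eq]
      abel
    rw [map_add, map_smul, app_vec, app_vec, Fin.sum_univ_two, Fin.sum_univ_two, h1, hi.eq]
    simp only [TensorProduct.tmul_add, TensorProduct.add_tmul, TensorProduct.tmul_smul,
      ← TensorProduct.smul_tmul']
    module
  refine matrix_unique φ (i.lower t) (fun a _ => ![φ.matrix i 0 0 + t • φ.matrix i 0 1,
    (α * t + β - t ^ 2) • φ.matrix i 0 1] a) 0 ?_ 1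
  rw [Fin.sum_univ_two, i.lower_vec_zero, i.lower_vec_one]
  exact h

end Lower

/-! ### Invariant lines in an adapted frame -/

section Eigenline

variable {X : Scheme.{0}} [X.Over (Spec (.of ℂ))] {E : X.Modules} {φ : HiggsField E}

/-- An eigenline spanned by the first vector of a frame is spanned by a vector `e₁ + σ e₂` in terms
of an adapted frame. -/
theorem IsAdapted.exists_root {i : FramedAffine E} {α β : Γ(X, i.U.1)} (hi : IsAdapted φ i α β)
    (k : FramedAffine E) {V : X.affineOpens} (hV : V.1 ≤ k.U.1 ⊓ i.U.1)
    (hk : resForm X (hV.trans inf_le_left) (φ.matrix k 1 0) = 0) :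
    ∃ (u : Γ(X, V.1)ˣ) (σ : Γ(X, V.1)),
      σ ^ 2 = X.presheaf.map (homOfLE (hV.trans inf_le_right)).op α * σ +
        X.presheaf.map (homOfLE (hV.trans inf_le_right)).op β ∧
      res E (hV.trans inf_le_left) (k.frame.vec 0) =
        u.1 • (res E (hV.trans inf_le_right) (i.frame.vec 0) +
          σ • res E (hV.trans inf_le_right) (i.frame.vec 1)) := by
  obtain ⟨v, hv⟩ := (IsGenerator.res (hV.trans inf_le_right) hi.isGenerator).exists_dual
  have hconj := contractedMatrix_mul_transition φ k i hV v
  set Q := contractedMatrix φ i (hV.trans inf_le_right) v with hQ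
  set P := contractedMatrix φ k (hV.trans inf_le_left) v with hP
  set g := (transition k i).map (X.presheaf.map (homOfLE hV).op) with hg
  have hP10 : P 1 0 = 0 := by rw [hP, contractedMatrix, hk, map_zero]
  have hQ01 : Q 0 1 = 1 := by
    have := hv 1
    rwa [one_smul] at this
  have hQ10 : Q 1 0 = X.presheaf.map (homOfLE (hV.trans inf_le_right)).op β := by
    rw [hQ, contractedMatrix, hi.eq, resForm_smul, hv]
  have hQ11 : Q 1 1 - Q 0 0 = X.presheaf.map (homOfLE (hV.trans inf_le_right)).op α := by
    rw [hQ, contractedMatrix, contractedMatrix, ← map_sub, ← map_sub, hi.sub_eq, resForm_smul, hv]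
  have hdet : IsUnit g.det := by
    have := (isUnit_det_transition k i).map (X.presheaf.map (homOfLE hV).op).hom
    rwa [RingHom.map_det] at this
  obtain ⟨d, hd⟩ := hdet.exists_right_inv
  -- the line spanned by the first vector of the frame `k` has homogeneous coordinates `g₀₀, g₁₀` in
  -- the adapted frame, and these satisfy the homogenized equation
  have hq := eigenForm_conj hconj 1 0
  simp only [eigenForm, hP10, hQ01, hQ10, hQ11, mul_one, mul_zero, add_zero] at hq
  have hunit : IsUnit (g 0 0) := by
    rw [Matrix.det_fin_two] at hd
    refine isUnit_of_quadratic (b := g 1 0) (p := d * g 1 1) (q := -(d * g 0 1))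
      (α := X.presheaf.map (homOfLE (hV.trans inf_le_right)).op α)
      (β := X.presheaf.map (homOfLE (hV.trans inf_le_right)).op β) ?_ ?_
    · linear_combination hd
    · linear_combination -hq
  refine ⟨hunit.unit, hunit.unit⁻¹.1 * g 1 0, ?_, ?_⟩
  · have h1 : hunit.unit⁻¹.1 * g 0 0 = 1 := hunit.val_inv_mul
    linear_combination (-hunit.unit⁻¹.1 ^ 2) * hq + (-X.presheaf.map
      (homOfLE (hV.trans inf_le_right)).op α * hunit.unit⁻¹.1 * g 1 0 -
      X.presheaf.map (homOfLE (hV.trans inf_le_right)).op β *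
        (hunit.unit⁻¹.1 * g 0 0 + 1)) * (-h1)
  · have h1 : g 0 0 * hunit.unit⁻¹.1 = 1 := hunit.mul_val_inv
    rw [vec_eq k i V.1 hV 0, Fin.sum_univ_two, smul_add, smul_smul, ← mul_assoc]
    have h2 : (hunit.unit : Γ(X, V.1)) * hunit.unit⁻¹.1 = 1 := hunit.mul_val_inv
    rw [h2, one_mul]
    rfl

end Eigenline

/-! ### Line subbundles determined by a frame on an open set -/

section Span

variable {X : Scheme.{0}} {E : X.Modules}

theorem Frame.repr_res {r : ℕ} {U V W : X.Opens} (e : Frame E r U) (h : V ≤ U) (h' : W ≤ V)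
    (s : Γ(E, V)) (a : Fin r) :
    (e.basis (h'.trans h)).repr (res E h' s) a =
      X.presheaf.map (homOfLE h').op ((e.basis h).repr s a) := by
  conv_lhs => rw [← (e.basis h).sum_repr s]
  have : res E h' (∑ c, (e.basis h).repr s c • e.basis h c) =
      ∑ c, X.presheaf.map (homOfLE h').op ((e.basis h).repr s c) • e.basis (h'.trans h) c := by
    rw [map_sum]
    exact Finset.sum_congr rfl fun c _ => by
      rw [res_smul, Frame.basis_apply, Frame.basis_apply, res_res]
  rw [this, Module.Basis.repr_sum_self]

theorem Frame.mem_span_iff {U V : X.Opens} (e : Frame E 2 U) (h : V ≤ U) (s : Γ(E, V)) :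
    s ∈ Submodule.span Γ(X, V) {res E h (e.vec 0)} ↔ (e.basis h).repr s 1 = 0 := by
  rw [Submodule.mem_span_singleton]
  constructor
  · rintro ⟨c, rfl⟩
    rw [← Frame.basis_apply, map_smul, Module.Basis.repr_self]
    simp
  · intro hs
    refine ⟨(e.basis h).repr s 0, ?_⟩
    conv_rhs => rw [← (e.basis h).sum_repr s, Fin.sum_univ_two, hs, zero_smul, add_zero,
      Frame.basis_apply]

theorem Frame.res_mem_span {U V W : X.Opens} (e : Frame E 2 U) (h : V ≤ U) (h' : W ≤ V)
    {s : Γ(E, V)} (hs : s ∈ Submodule.span Γ(X, V) {res E h (e.vec 0)}) :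
    res E h' s ∈ Submodule.span Γ(X, W) {res E (h'.trans h) (e.vec 0)} := by
  rw [e.mem_span_iff] at hs ⊢
  rw [e.repr_res h h', hs, map_zero]

/-- On an integral scheme, whether a section is a multiple of the first vector of a frame can be
tested on a nonempty open set. -/
theorem Frame.mem_span_of_res [IsIntegral X] {U V W : X.Opens} (e : Frame E 2 U) (h : V ≤ U)
    (h' : W ≤ V) (hW : (V : Set X).Nonempty → (W : Set X).Nonempty) {s : Γ(E, V)}
    (hs : res E h' s ∈ Submodule.span Γ(X, W) {res E (h'.trans h) (e.vec 0)}) :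
    s ∈ Submodule.span Γ(X, V) {res E h (e.vec 0)} := by
  rw [e.mem_span_iff] at hs ⊢
  rw [e.repr_res h h'] at hs
  exact eq_of_map_eq h' hW (hs.trans (map_zero _).symm)

/-- A line has at most one spanning vector of the form `e₁ + a e₂`. -/
theorem Frame.coord_eq {U V : X.Opens} (e : Frame E 2 U) (h : V ≤ U) {a b c : Γ(X, V)}
    (hab : c • (res E h (e.vec 0) + a • res E h (e.vec 1)) =
      res E h (e.vec 0) + b • res E h (e.vec 1)) : a = b := by
  simp only [← Frame.basis_apply] at hab
  have h0 := congrArg (fun s => (e.basis h).repr s 0) hab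
  have h1 := congrArg (fun s => (e.basis h).repr s 1) hab
  simp only [map_smul, map_add, Module.Basis.repr_self, Finsupp.smul_apply, Finsupp.add_apply,
    smul_eq_mul] at h0 h1
  simp at h0 h1
  rw [h0, one_mul] at h1
  exact h1

/-- Membership in a line subbundle can be tested on a dense open set. -/
theorem LineSubbundle.mem_of_res_mem [IsIntegral X] (L : LineSubbundle E) {U V : X.Opens}
    (h : V ≤ U) (hV : (U : Set X).Nonempty → (V : Set X).Nonempty) {s : Γ(E, U)}
    (hs : res E h s ∈ L.carrier V) : s ∈ L.carrier U := by
  refine L.mem_of_local U s fun x hx => ?_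
  obtain ⟨U', e, hx', he⟩ := L.locally_span x
  refine ⟨U ⊓ U', inf_le_left, ⟨hx, hx'⟩, ?_⟩
  rw [he _ inf_le_right]
  refine e.mem_span_of_res inf_le_right (W := V ⊓ U') (inf_le_inf_right _ h)
    (fun _ => inf_nonempty (hV ⟨x, hx⟩) ⟨x, hx'⟩) ?_
  rw [← he _ inf_le_right, res_res, ← res_res E h inf_le_left]
  exact L.res_mem _ _ _ _ hs

/-- Line subbundles that agree over a nonempty open set are equal. -/
theorem LineSubbundle.ext_of_dense [IsIntegral X] {L L' : LineSubbundle E} {U₀ : X.Opens}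
    (h₀ : (U₀ : Set X).Nonempty) (h : ∀ V ≤ U₀, L.carrier V = L'.carrier V) : L = L' := by
  have key {L L' : LineSubbundle E} (h : ∀ V ≤ U₀, L.carrier V = L'.carrier V) (U : X.Opens) :
      L.carrier U ≤ L'.carrier U := fun s hs => by
    refine L'.mem_of_res_mem (V := U ⊓ U₀) inf_le_left (fun hU => inf_nonempty hU h₀) ?_
    rw [← h _ inf_le_right]
    exact L.res_mem _ _ _ _ hs
  ext U : 2
  exact le_antisymm (key h U) (key (fun V hV => (h V hV).symm) U)

/-- The sections over `U` whose restrictions to `U ∩ U₀` are multiples of the first vector of a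
frame on `U₀`. -/
def lineCarrier {U₀ : X.Opens} (k : Frame E 2 U₀) (U : X.Opens) : Submodule Γ(X, U) Γ(E, U) where
  carrier := {s | res E (inf_le_left : U ⊓ U₀ ≤ U) s ∈
    Submodule.span Γ(X, U ⊓ U₀) {res E inf_le_right (k.vec 0)}}
  add_mem' ha hb := by
    rw [Set.mem_ofPred_eq, map_add]
    exact Submodule.add_mem _ ha hb
  zero_mem' := by
    rw [Set.mem_ofPred_eq, map_zero]
    exact Submodule.zero_mem _
  smul_mem' c s hs := by
    rw [Set.mem_ofPred_eq, res_smul]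
    exact Submodule.smul_mem _ _ hs

theorem mem_lineCarrier {U₀ : X.Opens} (k : Frame E 2 U₀) {U : X.Opens} {s : Γ(E, U)} :
    s ∈ lineCarrier k U ↔ res E (inf_le_left : U ⊓ U₀ ≤ U) s ∈
      Submodule.span Γ(X, U ⊓ U₀) {res E inf_le_right (k.vec 0)} :=
  Iff.rfl

/-- The line subbundle of the sections that are multiples of the first vector of the frame `k` on
its domain `U₀`, provided that this line extends locally to the whole scheme. -/
def lineOf [IsIntegral X] {U₀ : X.Opens} (h₀ : (U₀ : Set X).Nonempty) (k : Frame E 2 U₀)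
    (H : ∀ x : X, ∃ (U : X.Opens) (e : Frame E 2 U) (u : Γ(X, U ⊓ U₀)ˣ), x ∈ U ∧
      res E inf_le_right (k.vec 0) = u.1 • res E inf_le_left (e.vec 0)) : LineSubbundle E where
  carrier := lineCarrier k
  res_mem U V h s hs := by
    rw [mem_lineCarrier] at hs ⊢
    have := k.res_mem_span inf_le_right (W := V ⊓ U₀) (inf_le_inf_right _ h) hs
    rw [res_res] at this
    rwa [res_res]
  mem_of_local U s hs := by
    rw [mem_lineCarrier]
    rcases ((U ⊓ U₀ : X.Opens) : Set X).eq_empty_or_nonempty with he | ⟨x, hx⟩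
    · have : Subsingleton Γ(X, U ⊓ U₀) := by
        rw [show U ⊓ U₀ = ⊥ from SetLike.coe_injective he]
        infer_instance
      have : Subsingleton Γ(E, U ⊓ U₀) := Module.subsingleton Γ(X, U ⊓ U₀) _
      rw [Subsingleton.elim (res E inf_le_left s) 0]
      exact Submodule.zero_mem _
    · obtain ⟨V, h, hV, hs⟩ := hs x hx.1
      refine k.mem_span_of_res inf_le_right (W := V ⊓ U₀) (inf_le_inf_right _ h)
        (fun _ => ⟨x, hV, hx.2⟩) ?_
      rw [mem_lineCarrier, res_res] at hs
      rwa [res_res]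
  locally_span x := by
    obtain ⟨U, e, u, hx, hu⟩ := H x
    refine ⟨U, e, hx, fun V h => ?_⟩
    have key : Submodule.span Γ(X, V ⊓ U₀) {res E (inf_le_right : V ⊓ U₀ ≤ U₀) (k.vec 0)} =
        Submodule.span Γ(X, V ⊓ U₀) {res E ((inf_le_left : V ⊓ U₀ ≤ V).trans h) (e.vec 0)} := by
      have h1 := congrArg (res E (inf_le_inf_right U₀ h)) hu
      rw [res_smul, res_res, res_res] at h1
      rw [h1]
      exact Submodule.span_singleton_smul_eq
        (u.isUnit.map (X.presheaf.map (homOfLE (inf_le_inf_right U₀ h)).op).hom) _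
    ext s
    rw [mem_lineCarrier, key]
    exact ⟨fun hs => e.mem_span_of_res h inf_le_left (fun hV => inf_nonempty hV h₀) hs,
      fun hs => e.res_mem_span h inf_le_left hs⟩

theorem mem_lineOf [IsIntegral X] {U₀ : X.Opens} (h₀ : (U₀ : Set X).Nonempty) (k : Frame E 2 U₀)
    (H) {U : X.Opens} {s : Γ(E, U)} : s ∈ (lineOf h₀ k H).carrier U ↔
      res E (inf_le_left : U ⊓ U₀ ≤ U) s ∈
        Submodule.span Γ(X, U ⊓ U₀) {res E inf_le_right (k.vec 0)} :=
  Iff.rfl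

theorem lineOf_carrier_of_le [IsIntegral X] {U₀ : X.Opens} (h₀ : (U₀ : Set X).Nonempty)
    (k : Frame E 2 U₀) (H) {U : X.Opens} (hU : U ≤ U₀) :
    (lineOf h₀ k H).carrier U = Submodule.span Γ(X, U) {res E hU (k.vec 0)} := by
  ext s
  rw [mem_lineOf]
  exact ⟨fun hs => k.mem_span_of_res hU inf_le_left (fun hU => inf_nonempty hU h₀) hs,
    fun hs => k.res_mem_span hU inf_le_left hs⟩

end Span

/-! ### Invariance under the Higgs field -/

section Invariance

variable {X : Scheme.{0}} [X.Over (Spec (.of ℂ))] [Smooth (X ↘ Spec (.of ℂ))] {E : X.Modules}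
  {φ : HiggsField E}

/-- A section of `E ⊗ Ω¹` lies in the image of `L ⊗ Ω¹` if and only if all its contractions with
vector fields lie in `L`. -/
theorem mem_range_rTensor_iff {U : X.affineOpens} (L : Submodule Γ(X, U.1) Γ(E, U.1))
    (x : Γ(E, U.1) ⊗[Γ(X, U.1)] Forms X U) :
    x ∈ LinearMap.range (L.subtype.rTensor (Forms X U)) ↔ ∀ v, contract E v x ∈ L := by
  constructor
  · rintro ⟨y, rfl⟩ v
    induction y with
    | zero => simp
    | tmul s η =>
      rw [LinearMap.rTensor_tmul, contract_tmul]
      exact L.smul_mem _ s.2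
    | add x y hx hy =>
      rw [map_add, map_add]
      exact L.add_mem hx hy
  · intro h
    obtain ⟨n, v, m, hv⟩ := exists_eq_sum_contract_tmul (E := E) U
    rw [hv x]
    exact Submodule.sum_mem _ fun k _ => ⟨⟨_, h (v k)⟩ ⊗ₜ m k, rfl⟩

omit [Smooth (X ↘ Spec (.of ℂ))] in
theorem contract_app_vec (k : FramedAffine E) (v : Module.Dual Γ(X, k.U.1) (Forms X k.U.1)) :
    contract E v (φ.app k.U (k.frame.vec 0)) =
      v (φ.matrix k 0 0) • k.frame.vec 0 + v (φ.matrix k 1 0) • k.frame.vec 1 := by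
  rw [app_vec, Fin.sum_univ_two, map_add, contract_tmul, contract_tmul]

/-- A line subbundle that is spanned by the first vector of a frame is invariant only if the
lower left entry of `φ` vanishes in this frame. -/
theorem matrix_eq_zero_of_invariant (L : φ.LineSubbundles) (k : FramedAffine E)
    (hk : L.1.carrier k.U.1 = Submodule.span Γ(X, k.U.1) {k.frame.vec 0}) :
    φ.matrix k 1 0 = 0 := by
  refine eq_zero_of_forall_dual (R := Γ(X, k.U.1)) fun v => ?_
  have h1 : k.frame.vec 0 ∈ L.1.carrier k.U.1 := hk ▸ Submodule.mem_span_singleton_self _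
  have h2 := (mem_range_rTensor_iff _ _).1 (L.2 k.U _ h1) v
  have hres (a : Fin 2) : res E (le_refl k.U.1) (k.frame.vec a) = k.frame.vec a := by simp [res]
  rw [hk, contract_app_vec, ← hres, k.frame.mem_span_iff, ← hres 1, ← Frame.basis_apply,
    ← Frame.basis_apply, map_add, map_smul, map_smul, Module.Basis.repr_self,
    Module.Basis.repr_self] at h2
  simpa using h2

/-- Invariance of a line subbundle holds everywhere if it holds on the domain of a frame. -/
theorem invariant_lineOf [IsIntegral X] [IsSeparated (X ↘ Spec (.of ℂ))] (k : FramedAffine E)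
    (h₀ : (k.U.1 : Set X).Nonempty) (H) (hk : φ.matrix k 1 0 = 0) (U : X.affineOpens)
    (s : Γ(E, U.1)) (hs : s ∈ (lineOf h₀ k.frame H).carrier U.1) :
    φ.app U s ∈ LinearMap.range
      (((lineOf h₀ k.frame H).carrier U.1).subtype.rTensor (Forms X U)) := by
  rw [mem_range_rTensor_iff]
  intro v
  rw [mem_lineOf] at hs ⊢
  let W : X.affineOpens := ⟨U.1 ⊓ k.U.1, isAffineOpen_inf U k.U⟩
  have hWU : W.1 ≤ U.1 := inf_le_left
  have hWk : W.1 ≤ k.U.1 := inf_le_right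
  obtain ⟨v', hv⟩ := (span_and_extend_forms hWU).2 v
  obtain ⟨c, hc⟩ := Submodule.mem_span_singleton.1 hs
  have h1 := contract_resTensor hWU v v' hv (φ.app U s)
  rw [φ.res_app U W hWU] at h1
  refine Eq.subst (motive := fun y => y ∈ _) h1 ?_
  have h2 : φ.app W (res E hWU s) = c • φ.app W (res E hWk (k.frame.vec 0)) := by
    rw [← map_smul]
    exact congrArg _ hc.symm
  rw [h2, map_smul, contract_app_res_vec φ k hWk, Fin.sum_univ_two]
  have h3 : contractedMatrix φ k hWk v' 1 0 = 0 := by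
    rw [contractedMatrix, hk, map_zero, map_zero]
  rw [h3, zero_smul, add_zero]
  exact Submodule.smul_mem _ _ (Submodule.smul_mem _ _ (Submodule.mem_span_singleton_self _))

end Invariance

/-! ### Higgs line subbundles and roots -/

section Lines

variable {X : Scheme.{0}} [X.Over (Spec (.of ℂ))] [QuasiCompact (X ↘ Spec (.of ℂ))]
  [SmoothOfRelativeDimension 1 (X ↘ Spec (.of ℂ))] {E : X.Modules} {φ : HiggsField E}

/-- The roots of the monic quadratic polynomial `t² - α t - β`. -/
abbrev Roots {R : Type*} [CommRing R] (α β : R) : Type _ := {τ : R // τ ^ 2 = α * τ + β}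

omit [QuasiCompact (X ↘ Spec (.of ℂ))] [SmoothOfRelativeDimension 1 (X ↘ Spec (.of ℂ))] in
theorem IsAdapted.matrix_lower_eq_zero {i : FramedAffine E} {α β : Γ(X, i.U.1)}
    (hi : IsAdapted φ i α β) (τ : Roots α β) : φ.matrix (i.lower τ.1) 1 0 = 0 := by
  refine (hi.matrix_lower τ.1).trans ?_
  rw [τ.2, sub_self, zero_smul]
  rfl

/-- An invariant line over a nonempty open set extends locally to a line subbundle: in an adapted
frame it is given by a root, which extends by normality. -/
theorem exists_line_extension [IsIntegral X] [IsSeparated (X ↘ Spec (.of ℂ))]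
    (hE : IsLocallyFreeOfRank E 2) (hgcd : ∀ i, φ.GcdEqOne i)
    (k : FramedAffine E) (h₀ : (k.U.1 : Set X).Nonempty)
    (hk : φ.matrix k 1 0 = 0) (x : X) :
    ∃ (U : X.Opens) (e : Frame E 2 U) (u : Γ(X, U ⊓ k.U.1)ˣ), x ∈ U ∧
      res E inf_le_right (k.frame.vec 0) = u.1 • res E inf_le_left (e.vec 0) := by
  obtain ⟨j, α', β', hx, hj⟩ := exists_isAdapted φ hE hgcd x
  let W : X.affineOpens := ⟨j.U.1 ⊓ k.U.1, isAffineOpen_inf j.U k.U⟩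
  have hW : W.1 ≤ k.U.1 ⊓ j.U.1 := inf_comm _ _ |>.le
  obtain ⟨u, σ, hσ, hu⟩ := hj.exists_root k (V := W) hW (by rw [hk, map_zero])
  have := isIntegrallyClosed_of_smooth j.U ⟨x, hx⟩
  obtain ⟨τ, rfl, hτ⟩ := exists_root_extension j.U.2 (hW.trans inf_le_right)
    (inf_nonempty ⟨x, hx⟩ h₀) α' β' σ hσ
  refine ⟨j.U.1, (j.lower τ).frame, u, hx, ?_⟩
  rw [j.lower_vec_zero, map_add, res_smul]
  exact hu

/-- The Higgs line subbundle spanned by `e₁ + τ e₂` in an adapted frame. -/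
def IsAdapted.line [IsIntegral X] [IsSeparated (X ↘ Spec (.of ℂ))]
    (hE : IsLocallyFreeOfRank E 2) (hgcd : ∀ i, φ.GcdEqOne i)
    {i : FramedAffine E} {α β : Γ(X, i.U.1)} (hi : IsAdapted φ i α β)
    (h₀ : (i.U.1 : Set X).Nonempty) (τ : Roots α β) : φ.LineSubbundles :=
  ⟨lineOf h₀ (i.lower τ.1).frame fun x => exists_line_extension hE hgcd (i.lower τ.1) h₀
      (hi.matrix_lower_eq_zero τ) x,
    invariant_lineOf (i.lower τ.1) h₀ _ (hi.matrix_lower_eq_zero τ)⟩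

/-- The Higgs line subbundles correspond to the roots in one adapted frame. -/
theorem IsAdapted.bijective_line [IsIntegral X] [IsSeparated (X ↘ Spec (.of ℂ))]
    (hE : IsLocallyFreeOfRank E 2) (hgcd : ∀ i, φ.GcdEqOne i)
    {i : FramedAffine E} {α β : Γ(X, i.U.1)} (hi : IsAdapted φ i α β)
    (h₀ : (i.U.1 : Set X).Nonempty) : Function.Bijective (hi.line hE hgcd h₀) := by
  have hline (τ : Roots α β) (V : X.Opens) (h : V ≤ i.U.1) :
      (hi.line hE hgcd h₀ τ).1.carrier V = Submodule.span Γ(X, V)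
        {res E h (i.frame.vec 0) +
          X.presheaf.map (homOfLE h).op τ.1 • res E h (i.frame.vec 1)} := by
    refine (lineOf_carrier_of_le h₀ (i.lower τ.1).frame
      (exists_line_extension hE hgcd (i.lower τ.1) h₀ (hi.matrix_lower_eq_zero τ)) h).trans ?_
    rw [i.lower_vec_zero, map_add, res_smul]
  constructor
  · intro τ τ' h
    have h1 := congrArg (fun L : φ.LineSubbundles => L.1.carrier i.U.1) h
    simp only [hline _ _ le_rfl] at h1
    obtain ⟨c, hc⟩ := Submodule.mem_span_singleton.1
      (h1.le (Submodule.mem_span_singleton_self _))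
    exact Subtype.ext (eq_of_map_eq le_rfl id (i.frame.coord_eq le_rfl hc)).symm
  · intro L
    obtain ⟨x, hx⟩ := h₀
    obtain ⟨U, e, hxU, he⟩ := L.1.locally_span x
    obtain ⟨V, hV, hxV, hVU⟩ := exists_isAffineOpen_mem_and_subset (U := U ⊓ i.U.1) ⟨hxU, hx⟩
    have hVU' : V ≤ U := hVU.trans inf_le_left
    have hVi : V ≤ i.U.1 := hVU.trans inf_le_right
    let k : FramedAffine E := ⟨⟨V, hV⟩, e.restrict hVU'⟩
    have hk := matrix_eq_zero_of_invariant L k (he V hVU')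
    obtain ⟨u, σ, hσ, hu⟩ := hi.exists_root k (V := ⟨V, hV⟩) (le_inf le_rfl hVi)
      (by rw [hk, map_zero])
    have := isIntegrallyClosed_of_smooth i.U ⟨x, hx⟩
    obtain ⟨τ, rfl, hτ⟩ := exists_root_extension i.U.2 hVi ⟨x, hxV⟩ α β σ hσ
    have key (W : X.Opens) (hW : W ≤ V) (y : Γ(E, W)) :
        Submodule.span Γ(X, W) {X.presheaf.map (homOfLE hW).op u.1 • y} =
          Submodule.span Γ(X, W) {y} :=
      Submodule.span_singleton_smul_eq
        (u.isUnit.map (X.presheaf.map (homOfLE hW).op).hom) y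
    refine ⟨⟨τ, hτ⟩, Subtype.ext (LineSubbundle.ext_of_dense (U₀ := V) ⟨x, hxV⟩ fun W hW => ?_)⟩
    rw [he W (hW.trans hVU')]
    rw [hline _ _ (hW.trans hVi)]
    have h1 : res E hVU' (e.vec 0) = u.1 • (res E hVi (i.frame.vec 0) +
        X.presheaf.map (homOfLE hVi).op τ • res E hVi (i.frame.vec 1)) :=
      (res_res E hVU' le_rfl _).symm.trans hu
    rw [← res_res E hVU' hW, h1, res_smul, map_add, res_smul, res_res, res_res, map_map hVi hW]
    exact (key W hW _).symm

end Lines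

/-! ### Gluing sections -/

section Glue

/-- A section of a separated morphism over a dominant open immersion into a reduced scheme extends
to a section over the whole scheme if it extends locally. -/
theorem exists_section_of_local {G X Y₀ : Scheme.{0}} (ρ : G ⟶ X) [IsSeparated ρ] [IsReduced X]
    (f₀ : Y₀ ⟶ X) [IsOpenImmersion f₀] [IsDominant f₀] (s₀ : Y₀ ⟶ G)
    (H : ∀ x : X, ∃ (Y : Scheme.{0}) (f : Y ⟶ X) (s : Y ⟶ G), IsOpenImmersion f ∧
      x ∈ Set.range f ∧ s ≫ ρ = f ∧ ∀ (T : Scheme.{0}) (c : T ⟶ Y) (c₀ : T ⟶ Y₀),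
        c ≫ f = c₀ ≫ f₀ → c ≫ s = c₀ ≫ s₀) :
    ∃ σ : X ⟶ G, σ ≫ ρ = 𝟙 X ∧ f₀ ≫ σ = s₀ := by
  choose Y f s hf hx hs hc using H
  let 𝒰 : X.OpenCover :=
    { I₀ := X
      X := Y
      f := f
      mem₀ := by
        rw [Scheme.presieve₀_mem_precoverage_iff]
        exact ⟨fun x => ⟨x, hx x⟩, hf⟩ }
  -- the local extensions agree on the dense open set where both are given by `s₀`
  have compat (x y : X) : pullback.fst (f x) (f y) ≫ s x = pullback.snd (f x) (f y) ≫ s y := by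
    let p := pullback.fst (f x) (f y) ≫ f x
    have hpo : IsOpenImmersion p := inferInstance
    have hred : IsReduced (pullback (f x) (f y)) := isReduced_of_isOpenImmersion p
    let O := p ⁻¹ᵁ f₀.opensRange
    have hdom : IsDominant O.ι := ⟨by
      rw [DenseRange, Scheme.Opens.range_ι]
      exact (IsDominant.denseRange (f := f₀)).preimage p.isOpenEmbedding.isOpenMap⟩
    refine ext_of_isDominant_of_isSeparated ρ ?_ O.ι ?_
    · rw [Category.assoc, Category.assoc, hs, hs, pullback.condition]
    · let c₀ : (O : Scheme.{0}) ⟶ Y₀ := IsOpenImmersion.lift f₀ (O.ι ≫ p) (by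
        rintro _ ⟨t, rfl⟩
        exact t.2)
      have h₀ : c₀ ≫ f₀ = O.ι ≫ p := IsOpenImmersion.lift_fac _ _ _
      rw [← Category.assoc, ← Category.assoc, hc x _ (O.ι ≫ pullback.fst _ _) c₀
        (by rw [h₀, Category.assoc]), hc y _ (O.ι ≫ pullback.snd _ _) c₀
        (by rw [h₀, Category.assoc, ← pullback.condition])]
  refine ⟨𝒰.glueMorphisms s compat, ?_, ?_⟩
  · refine 𝒰.hom_ext _ _ fun x => ?_
    rw [← Category.assoc, 𝒰.ι_glueMorphisms, Category.comp_id]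
    exact hs x
  · refine Scheme.Cover.hom_ext (𝒰.pullback₁ f₀) _ _ fun x => ?_
    change pullback.fst f₀ (f x) ≫ f₀ ≫ _ = pullback.fst f₀ (f x) ≫ s₀
    rw [pullback.condition_assoc]
    refine (congrArg (pullback.snd f₀ (f x) ≫ ·) (𝒰.ι_glueMorphisms s compat x)).trans ?_
    exact hc x _ _ _ pullback.condition.symm

end Glue

/-! ### Sections of the projection and roots -/

section Sections

variable {X : Scheme.{0}} [X.Over (Spec (.of ℂ))] [QuasiCompact (X ↘ Spec (.of ℂ))]
  [SmoothOfRelativeDimension 1 (X ↘ Spec (.of ℂ))] [IsSeparated (X ↘ Spec (.of ℂ))]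
  [IsIntegral X] {E : X.Modules} {φ : HiggsField E}

omit [X.Over (Spec (.of ℂ))] [QuasiCompact (X ↘ Spec (.of ℂ))] [IsSeparated (X ↘ Spec (.of ℂ))]
  [SmoothOfRelativeDimension 1 (X ↘ Spec (.of ℂ))] in
theorem isDominant_fromSpec {U : X.Opens} (hU : IsAffineOpen U) (h₀ : (U : Set X).Nonempty) :
    IsDominant hU.fromSpec := ⟨by
  rw [DenseRange, hU.range_fromSpec]
  exact U.isOpen.dense h₀⟩

/-- A root of the characteristic polynomial in an adapted frame defines a section of `ρ₁`. -/
theorem IsAdapted.exists_section (hE : IsLocallyFreeOfRank E 2) (hgcd : ∀ i, φ.GcdEqOne i)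
    {i : FramedAffine E} {α β : Γ(X, i.U.1)} (hi : IsAdapted φ i α β) (hU : IsAffineOpen i.U.1)
    (h₀ : (i.U.1 : Set X).Nonempty) (τ : Roots α β) :
    ∃ σ : X ⟶ φ.grass, σ ≫ φ.grassProj = 𝟙 X ∧
      (hU.fromSpec ≫ σ) ≫ φ.grassι =
        chartPt i hU.fromSpec (top_le_fromSpec hU) ((Scheme.ΓSpecIso _).inv τ.1) ≫ chartι i := by
  have := isFinite_grassProj hE hgcd
  have := isDominant_fromSpec hU h₀
  obtain ⟨s₀, hs₀, hs₀'⟩ := hi.exists_point hU.fromSpec (top_le_fromSpec hU)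
    ((Scheme.ΓSpecIso Γ(X, i.U.1)).inv τ.1) (by
      rw [appLE_fromSpec, appLE_fromSpec, ← map_pow, τ.2, map_add, map_mul])
  obtain ⟨σ, hσ, hσ'⟩ := exists_section_of_local φ.grassProj hU.fromSpec s₀ fun x => by
    obtain ⟨j, α', β', hx, hj⟩ := exists_isAdapted φ hE hgcd x
    have hV : IsAffineOpen j.U.1 := j.U.2
    have hW : IsAffineOpen (j.U.1 ⊓ i.U.1) := isAffineOpen_inf j.U i.U
    have hWU : j.U.1 ⊓ i.U.1 ≤ i.U.1 := inf_le_right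
    have hWV : j.U.1 ⊓ i.U.1 ≤ j.U.1 := inf_le_left
    have e₀ := hU.map_fromSpec hW (homOfLE hWU).op
    have e₁ := hV.map_fromSpec hW (homOfLE hWV).op
    have hz₁ (a : Γ(X, j.U.1)) : (Spec.map (X.presheaf.map (homOfLE hWV).op)).appTop
        ((Scheme.ΓSpecIso _).inv a) =
        (Scheme.ΓSpecIso _).inv (X.presheaf.map (homOfLE hWV).op a) :=
      (congrArg (fun g => g.hom a)
        (Scheme.ΓSpecIso_inv_naturality (X.presheaf.map (homOfLE hWV).op))).symm
    have htop : ⊤ ≤ hW.fromSpec ⁻¹ᵁ j.U.1 := fun t ht => hWV (top_le_fromSpec hW ht)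
    have hle (a : Γ(X, j.U.1)) : hW.fromSpec.appLE j.U.1 ⊤ htop a =
        (Scheme.ΓSpecIso _).inv (X.presheaf.map (homOfLE hWV).op a) := by
      rw [← hz₁, ← appLE_fromSpec hV (top_le_fromSpec hV)]
      simp only [← e₁]
      rw [appLE_comp_apply]
    -- on the intersection with an adapted frame near `x`, the section is given by a root `ζ`, which
    -- extends to a root `ξ` on the domain of that frame
    obtain ⟨z, hz, hlz⟩ := hj.exists_coord hE
      (Spec.map (X.presheaf.map (homOfLE hWU).op) ≫ s₀) hW.fromSpec
      (by rw [Category.assoc, hs₀', e₀]) htop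
    obtain ⟨ζ, rfl⟩ : ∃ ζ, (Scheme.ΓSpecIso Γ(X, j.U.1 ⊓ i.U.1)).inv ζ = z :=
      ⟨(Scheme.ΓSpecIso _).hom z, by simp⟩
    rw [hle, hle, ← map_pow, ← map_mul, ← map_add] at hz
    have hζ := (Scheme.ΓSpecIso Γ(X, j.U.1 ⊓ i.U.1)).symm.commRingCatIsoToRingEquiv.injective hz
    have := isIntegrallyClosed_of_smooth j.U ⟨x, hx⟩
    obtain ⟨ξ, rfl, hξ⟩ := exists_root_extension hV hWV (inf_nonempty ⟨x, hx⟩ h₀) α' β' ζ hζ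
    obtain ⟨s, hs, hs'⟩ := hj.exists_point hV.fromSpec (top_le_fromSpec hV)
      ((Scheme.ΓSpecIso Γ(X, j.U.1)).inv ξ) (by
        rw [appLE_fromSpec, appLE_fromSpec, ← map_pow, hξ, map_add, map_mul])
    refine ⟨_, hV.fromSpec, s, inferInstance, by rwa [hV.range_fromSpec], hs', fun T c c₀ h => ?_⟩
    let d : T ⟶ Spec Γ(X, j.U.1 ⊓ i.U.1) := IsOpenImmersion.lift hW.fromSpec (c ≫ hV.fromSpec) (by
      rw [hW.range_fromSpec]
      rintro _ ⟨t, rfl⟩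
      refine ⟨top_le_fromSpec hV (x := c t) trivial, ?_⟩
      rw [h]
      exact top_le_fromSpec hU (x := c₀ t) trivial)
    have hd : d ≫ hW.fromSpec = c ≫ hV.fromSpec := IsOpenImmersion.lift_fac _ _ _
    have hd₁ : d ≫ Spec.map (X.presheaf.map (homOfLE hWV).op) = c := by
      rw [← cancel_mono hV.fromSpec, Category.assoc, e₁, hd]
    have hd₀ : d ≫ Spec.map (X.presheaf.map (homOfLE hWU).op) = c₀ := by
      rw [← cancel_mono hU.fromSpec, Category.assoc, e₀, hd, h]
    rw [← cancel_mono φ.grassι, ← hd₀, Category.assoc, Category.assoc, hs,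
      Category.assoc, ← Category.assoc (Spec.map _) s₀, hlz, ← Category.assoc, ← Category.assoc,
      comp_chartPt j c _ _ (top_le_comp _ c (top_le_fromSpec hV)),
      comp_chartPt j d _ _ (top_le_comp _ d htop)]
    congr 1
    refine chartPt_congr hd.symm ?_
    rw [← hz₁, ← hd₁, Scheme.Hom.comp_appTop, CommRingCat.comp_apply]
  exact ⟨σ, hσ, by rw [hσ', hs₀]⟩

/-- The sections of `ρ₁` correspond to the roots in one adapted frame. -/
theorem IsAdapted.nonempty_roots_equiv_sections (hE : IsLocallyFreeOfRank E 2)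
    (hgcd : ∀ i, φ.GcdEqOne i)
    {i : FramedAffine E} {α β : Γ(X, i.U.1)} (hi : IsAdapted φ i α β)
    (h₀ : (i.U.1 : Set X).Nonempty) : Nonempty (Roots α β ≃ φ.Sections) := by
  have hU : IsAffineOpen i.U.1 := i.U.2
  have := isFinite_grassProj hE hgcd
  have := isDominant_fromSpec hU h₀
  choose σ hσ hσ' using hi.exists_section hE hgcd hU h₀
  refine ⟨Equiv.ofBijective (fun τ => (⟨σ τ, hσ τ⟩ : φ.Sections)) ⟨fun τ τ' h => ?_, fun s => ?_⟩⟩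
  · have h1 : σ τ = σ τ' := congrArg Subtype.val h
    have h2 := hσ' τ
    rw [h1, hσ' τ', cancel_mono] at h2
    have h3 := congrArg (fun f => f.appTop (chartCoord i)) h2
    simp only [chartPt_coord] at h3
    exact Subtype.ext
      ((Scheme.ΓSpecIso Γ(X, i.U.1)).symm.commRingCatIsoToRingEquiv.injective h3).symm
  · obtain ⟨z, hz, hl⟩ := hi.exists_coord hE (hU.fromSpec ≫ s.1) hU.fromSpec
      (by rw [Category.assoc, s.2, Category.comp_id]) (top_le_fromSpec hU)
    obtain ⟨τ, rfl⟩ : ∃ τ, (Scheme.ΓSpecIso Γ(X, i.U.1)).inv τ = z :=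
      ⟨(Scheme.ΓSpecIso _).hom z, by simp⟩
    rw [appLE_fromSpec, appLE_fromSpec, ← map_pow, ← map_mul, ← map_add] at hz
    have hτ := (Scheme.ΓSpecIso Γ(X, i.U.1)).symm.commRingCatIsoToRingEquiv.injective hz
    refine ⟨⟨τ, hτ⟩, Subtype.ext ?_⟩
    refine ext_of_isDominant_of_isSeparated φ.grassProj ((hσ _).trans s.2.symm) hU.fromSpec ?_
    rw [← cancel_mono φ.grassι, hσ', hl]

end Sections

/-! ### Tensors of degree two and square roots -/

section Pairing

variable {R M : Type*} [CommRing R] [AddCommGroup M] [Module R M]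

/-- The contraction of `M ⊗ M` with two linear forms. -/
def dualPair (v w : Module.Dual R M) : M ⊗[R] M →ₗ[R] R :=
  LinearMap.mul' R R ∘ₗ TensorProduct.map v w

theorem dualPair_tmul (v w : Module.Dual R M) (x y : M) : dualPair v w (x ⊗ₜ y) = v x * w y := by
  simp [dualPair]

/-- An element of `M ⊗ M` is determined by its contractions with pairs of linear forms. -/
theorem eq_of_forall_dualPair [Module.Finite R M] [Module.Projective R M] {x y : M ⊗[R] M}
    (h : ∀ v w, dualPair v w x = dualPair v w y) : x = y := by
  obtain ⟨n, v, m, hv⟩ := exists_dual_basis (R := R) (M := M)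
  have key (z : M ⊗[R] M) : z = ∑ k, ∑ l, dualPair (v k) (v l) z • (m k ⊗ₜ[R] m l) := by
    induction z with
    | zero => simp
    | tmul a b =>
      conv_lhs => rw [hv a, hv b, TensorProduct.sum_tmul]
      refine Finset.sum_congr rfl fun k _ => ?_
      rw [TensorProduct.tmul_sum]
      refine Finset.sum_congr rfl fun l _ => ?_
      rw [TensorProduct.smul_tmul_smul, dualPair_tmul]
    | add a b ha hb =>
      conv_lhs => rw [ha, hb, ← Finset.sum_add_distrib]
      refine Finset.sum_congr rfl fun k _ => ?_
      rw [← Finset.sum_add_distrib]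
      exact Finset.sum_congr rfl fun l _ => by rw [map_add, add_smul]
  rw [key x, key y]
  simp only [h]

/-- The discriminant of the characteristic polynomial is invariant under conjugation. -/
theorem disc_conj {A : Type*} [CommRing A] {N N' g : Matrix (Fin 2) (Fin 2) A}
    (h : N' * g = g * N) (hg : IsUnit g.det) :
    (N 1 1 - N 0 0) ^ 2 + 4 * (N 0 1 * N 1 0) = (N' 1 1 - N' 0 0) ^ 2 + 4 * (N' 0 1 * N' 1 0) := by
  have hdet : N.det = N'.det := by
    have := congrArg Matrix.det h
    rw [Matrix.det_mul, Matrix.det_mul, mul_comm] at this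
    exact (hg.mul_left_cancel this).symm
  have htr : N.trace = N'.trace := by
    have h1 : g⁻¹ * g = 1 := Matrix.nonsing_inv_mul g hg
    calc N.trace = (g⁻¹ * (g * N)).trace := by rw [← Matrix.mul_assoc, h1, Matrix.one_mul]
      _ = N'.trace := by
        rw [← h, Matrix.trace_mul_comm, Matrix.mul_assoc, Matrix.mul_nonsing_inv g hg,
          Matrix.mul_one]
  rw [Matrix.det_fin_two, Matrix.det_fin_two] at hdet
  rw [Matrix.trace_fin_two, Matrix.trace_fin_two] at htr
  linear_combination (N 0 0 + N 1 1 + N' 0 0 + N' 1 1) * htr - 4 * hdet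

/-- Completing the square: `τ` is a root of `t² - α t - β` if and only if `2 τ - α` is a square root
of the discriminant. -/
def rootsEquiv {R : Type*} [CommRing R] (h2 : IsUnit (2 : R)) (α β : R) :
    Roots α β ≃ {d : R // d ^ 2 = α ^ 2 + 4 * β} where
  toFun τ := ⟨2 * τ.1 - α, by linear_combination 4 * τ.2⟩
  invFun d := ⟨h2.unit⁻¹.1 * (d.1 + α), h2.mul_left_cancel (h2.mul_left_cancel (by
    have h : 2 * h2.unit⁻¹.1 = 1 := h2.mul_val_inv
    have := d.2
    linear_combination (d.1 ^ 2 + 2 * d.1 * α + α ^ 2) * (2 * h2.unit⁻¹.1 + 1) * h -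
      2 * α * (d.1 + α) * h + this))⟩
  left_inv τ := by
    have h : h2.unit⁻¹.1 * 2 = 1 := h2.val_inv_mul
    refine Subtype.ext ?_
    linear_combination τ.1 * h
  right_inv d := by
    have h : 2 * h2.unit⁻¹.1 = 1 := h2.mul_val_inv
    refine Subtype.ext ?_
    linear_combination (d.1 + α) * h

theorem natCard_sqrt {R : Type*} [CommRing R] [IsDomain R] (h2 : IsUnit (2 : R)) {δ d : R}
    (hd : d ^ 2 = δ) (h0 : δ ≠ 0) : Nat.card {d : R // d ^ 2 = δ} = 2 := by
  have hd0 : d ≠ 0 := by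
    rintro rfl
    exact h0 (by rw [← hd]; ring)
  have hset : {e : R | e ^ 2 = δ} = {d, -d} := by
    ext e
    rw [Set.mem_ofPred_eq, ← hd, sq_eq_sq_iff_eq_or_eq_neg]
    rfl
  refine (congrArg (fun s : Set R => Nat.card s) hset).trans ?_
  rw [Nat.card_coe_set_eq, Set.ncard_pair]
  intro h
  have : 2 * d = 0 := by linear_combination h
  exact hd0 ((h2.mul_right_eq_zero).1 this)

theorem natCard_sqrt_zero {R : Type*} [CommRing R] [IsDomain R] :
    Nat.card {d : R // d ^ 2 = 0} = 1 := by
  have hset : {e : R | e ^ 2 = 0} = {0} := by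
    ext e
    simp
  refine (congrArg (fun s : Set R => Nat.card s) hset).trans ?_
  simp

end Pairing

/-! ### Gluing functions on dense open sets -/

section GlueFunctions

variable {X : Scheme.{0}}

/-- A function on a dense open subset of an open set extends if it extends locally. -/
theorem exists_extension_of_local [IsIntegral X] {U U₀ : X.Opens} (h₀ : (U₀ : Set X).Nonempty)
    (f : Γ(X, U ⊓ U₀)) (H : ∀ x ∈ U, ∃ (V : X.Opens) (h : V ≤ U) (g : Γ(X, V)), x ∈ V ∧
      X.presheaf.map (homOfLE (inf_le_left : V ⊓ U₀ ≤ V)).op g =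
        X.presheaf.map (homOfLE (inf_le_inf_right U₀ h)).op f) :
    ∃ g : Γ(X, U), X.presheaf.map (homOfLE inf_le_left).op g = f := by
  choose V hVU s hxV hs using fun x : U => H x.1 x.2
  have compat (x y : U) (W : X.Opens) (hWx : W ≤ V x) (hWy : W ≤ V y) :
      X.presheaf.map (homOfLE hWx).op (s x) = X.presheaf.map (homOfLE hWy).op (s y) := by
    refine eq_of_map_eq (V := W ⊓ U₀) inf_le_left (fun hW => inf_nonempty hW h₀) ?_
    have hx := congrArg (X.presheaf.map (homOfLE (inf_le_inf_right U₀ hWx)).op) (hs x)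
    have hy := congrArg (X.presheaf.map (homOfLE (inf_le_inf_right U₀ hWy)).op) (hs y)
    rw [map_map, map_map] at hx hy ⊢
    exact hx.trans hy.symm
  obtain ⟨g, hg⟩ : ∃ g : Γ(X, U), ∀ x, X.presheaf.map (homOfLE (hVU x)).op g = s x :=
    (X.sheaf.existsUnique_gluing' V U (fun x => homOfLE (hVU x))
      (fun x hx => Opens.mem_iSup.2 ⟨⟨x, hx⟩, hxV ⟨x, hx⟩⟩) s (fun x y => compat x y _ _ _)).exists
  refine ⟨g, ?_⟩
  rcases (U : Set X).eq_empty_or_nonempty with hU | ⟨x, hx⟩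
  · obtain rfl : U = ⊥ := SetLike.coe_injective hU
    have : Subsingleton Γ(X, ⊥ ⊓ U₀) := by
      rw [bot_inf_eq]
      infer_instance
    exact Subsingleton.elim _ _
  · refine eq_of_map_eq (V := V ⟨x, hx⟩ ⊓ U₀) (inf_le_inf_right U₀ (hVU _))
      (fun _ => inf_nonempty ⟨x, hxV ⟨x, hx⟩⟩ h₀) ?_
    rw [← hs, ← hg, map_map, map_map]

end GlueFunctions

/-! ### The discriminant in an adapted frame -/

section Discriminant

variable {X : Scheme.{0}} [X.Over (Spec (.of ℂ))]

theorem isUnit_two (U : X.Opens) : IsUnit (2 : Γ(X, U)) := by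
  have h : IsUnit (2 : ℂ) := isUnit_iff_ne_zero.2 two_ne_zero
  have := h.map (scalars X U).hom
  rwa [map_ofNat] at this

/-- Forms over an affine open set of an integral smooth scheme are determined by their restriction
to a nonempty affine open set. -/
theorem eq_of_resForm_eq [Smooth (X ↘ Spec (.of ℂ))] [IsIntegral X] {U V : X.affineOpens}
    (h : V.1 ≤ U.1) (hV : (U.1 : Set X).Nonempty → (V.1 : Set X).Nonempty) {η η' : Forms X U}
    (hη : resForm X h η = resForm X h η') : η = η' := by
  rw [← sub_eq_zero]
  refine eq_zero_of_forall_dual (R := Γ(X, U.1)) fun v => ?_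
  obtain ⟨v', hv⟩ := (span_and_extend_forms h).2 v
  refine eq_of_map_eq h hV ?_
  rw [← hv, map_sub, hη, sub_self, map_zero, map_zero]

/-- Restriction of vector fields to smaller open sets is transitive. The restriction of a vector
field is determined by its values on restricted forms, since these generate. -/
theorem extension_comp [Smooth (X ↘ Spec (.of ℂ))] {U V W : X.affineOpens}
    (h : V.1 ≤ U.1) (h' : W.1 ≤ V.1) (v : Module.Dual Γ(X, U.1) (Forms X U))
    (v' : Module.Dual Γ(X, V.1) (Forms X V)) (v'' : Module.Dual Γ(X, W.1) (Forms X W))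
    (hv' : ∀ η, v' (resForm X h η) = X.presheaf.map (homOfLE h).op (v η))
    (hv'' : ∀ η, v'' (resForm X (h'.trans h) η) = X.presheaf.map (homOfLE (h'.trans h)).op (v η))
    (η : Forms X V) : v'' (resForm X h' η) = X.presheaf.map (homOfLE h').op (v' η) := by
  have hη : η ∈ Submodule.span Γ(X, V.1) (Set.range (resForm X h)) := by
    rw [(span_and_extend_forms h).1]
    trivial
  induction hη using Submodule.span_induction with
  | mem x hx =>
    obtain ⟨η, rfl⟩ := hx
    rw [resForm_resForm, hv'', hv', map_map]
  | zero => simp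
  | add x y _ _ hx hy => simp only [map_add, hx, hy]
  | smul r x _ hx => rw [resForm_smul, map_smul, map_smul, hx, smul_eq_mul, smul_eq_mul, map_mul]

variable {E : X.Modules} {φ : HiggsField E}

theorem dualPair_disc (j : FramedAffine E) (v w : Module.Dual Γ(X, j.U.1) (Forms X j.U.1)) :
    dualPair v w (φ.disc j) = v (φ.matrix j 1 1 - φ.matrix j 0 0) *
      w (φ.matrix j 1 1 - φ.matrix j 0 0) + 4 * (v (φ.matrix j 0 1) * w (φ.matrix j 1 0)) := by
  rw [HiggsField.disc, map_add, map_smul, dualPair_tmul, dualPair_tmul, smul_eq_mul]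

/-- The discriminant is `δ ω ⊗ ω` for the discriminant `δ = α² + 4 β` in an adapted frame, compared
on the common domain with an arbitrary frame. -/
theorem IsAdapted.disc_eq [Smooth (X ↘ Spec (.of ℂ))] {i : FramedAffine E} {α β : Γ(X, i.U.1)}
    (hi : IsAdapted φ i α β) (j : FramedAffine E) {V : X.affineOpens} (hV : V.1 ≤ j.U.1 ⊓ i.U.1)
    (v w : Module.Dual Γ(X, j.U.1) (Forms X j.U.1)) (v' w' : Module.Dual Γ(X, V.1) (Forms X V.1))
    (hv : ∀ η, v' (resForm X (hV.trans inf_le_left) η) =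
      X.presheaf.map (homOfLE (hV.trans inf_le_left)).op (v η))
    (hw : ∀ η, w' (resForm X (hV.trans inf_le_left) η) =
      X.presheaf.map (homOfLE (hV.trans inf_le_left)).op (w η)) :
    X.presheaf.map (homOfLE (hV.trans inf_le_left)).op (dualPair v w (φ.disc j)) =
      X.presheaf.map (homOfLE (hV.trans inf_le_right)).op (α ^ 2 + 4 * β) *
        (v' (resForm X (hV.trans inf_le_right) (φ.matrix i 0 1)) *
          w' (resForm X (hV.trans inf_le_right) (φ.matrix i 0 1))) := by
  have hgen := IsGenerator.res (hV.trans inf_le_right) hi.isGenerator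
  obtain ⟨u, hu⟩ := hgen.exists_dual
  have hgen' (η : Forms X V.1) :
      η = u η • resForm X (hV.trans inf_le_right) (φ.matrix i 0 1) := by
    obtain ⟨r, rfl⟩ := hgen.2 η
    simp only [hu]
  set ω := resForm X (hV.trans inf_le_right) (φ.matrix i 0 1) with hω
  have hconj := contractedMatrix_mul_transition φ j i hV u
  set Q := contractedMatrix φ i (hV.trans inf_le_right) u with hQ
  set P := contractedMatrix φ j (hV.trans inf_le_left) u with hP
  have hdet : IsUnit ((transition j i).map (X.presheaf.map (homOfLE hV).op)).det := by
    have := (isUnit_det_transition j i).map (X.presheaf.map (homOfLE hV).op).hom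
    rwa [RingHom.map_det] at this
  have hdisc := disc_conj hconj hdet
  have hQ01 : Q 0 1 = 1 := by
    have := hu 1
    rwa [one_smul] at this
  have hQ10 : Q 1 0 = X.presheaf.map (homOfLE (hV.trans inf_le_right)).op β := by
    rw [hQ, contractedMatrix, hi.eq, resForm_smul, hu]
  have hQ11 : Q 1 1 - Q 0 0 = X.presheaf.map (homOfLE (hV.trans inf_le_right)).op α := by
    rw [hQ, contractedMatrix, contractedMatrix, ← map_sub, ← map_sub, hi.sub_eq, resForm_smul, hu]
  have hPv (a b : Fin 2) (y : Module.Dual Γ(X, V.1) (Forms X V.1)) :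
      y (resForm X (hV.trans inf_le_left) (φ.matrix j a b)) = P a b * y ω := by
    conv_lhs => rw [hgen' (resForm X (hV.trans inf_le_left) (φ.matrix j a b)), map_smul]
    rfl
  rw [dualPair_disc, map_add, map_mul, map_mul, map_mul, ← hv, ← hw, ← hv, ← hw]
  simp only [map_sub, hPv]
  rw [hQ01, hQ10, hQ11, one_mul] at hdisc
  rw [map_add, map_mul, map_pow]
  simp only [map_ofNat]
  rw [← hdisc]
  ring

variable [Smooth (X ↘ Spec (.of ℂ))] [IsSeparated (X ↘ Spec (.of ℂ))] [IsIntegral X]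

/-- The discriminant of `φ` vanishes if and only if it vanishes in one adapted frame. -/
theorem IsAdapted.discEqZero_iff {i : FramedAffine E} {α β : Γ(X, i.U.1)}
    (hi : IsAdapted φ i α β) (h₀ : (i.U.1 : Set X).Nonempty) :
    φ.DiscEqZero ↔ α ^ 2 + 4 * β = 0 := by
  constructor
  · intro h
    obtain ⟨v, hv⟩ := hi.isGenerator.exists_dual
    have h1 := dualPair_disc (φ := φ) i v v
    have hv1 : v (φ.matrix i 0 1) = 1 := by simpa using hv 1
    rw [h i, map_zero, hi.sub_eq, hi.eq, hv, hv, hv1] at h1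
    linear_combination -h1
  · intro h j
    refine eq_of_forall_dualPair fun v w => ?_
    have hW : IsAffineOpen (j.U.1 ⊓ i.U.1) := isAffineOpen_inf j.U i.U
    have hWj : j.U.1 ⊓ i.U.1 ≤ j.U.1 := inf_le_left
    obtain ⟨v', hv⟩ := (span_and_extend_forms (V := ⟨_, hW⟩) hWj).2 v
    obtain ⟨w', hw⟩ := (span_and_extend_forms (V := ⟨_, hW⟩) hWj).2 w
    refine eq_of_map_eq hWj (fun hj => inf_nonempty hj h₀) ?_
    refine (hi.disc_eq j (V := ⟨_, hW⟩) le_rfl v w v' w' hv hw).trans ?_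
    rw [h, map_zero, zero_mul, map_zero, map_zero]

/-- A form on a nonempty affine open set extends to a global form if its contractions with vector
fields extend locally. -/
theorem exists_globalForm_of_local {U₀ : X.affineOpens} (h₀ : (U₀.1 : Set X).Nonempty)
    (ξ : Forms X U₀)
    (H : ∀ (x : X) (W : X.Opens), x ∈ W → ∃ V : X.affineOpens, x ∈ V.1 ∧ V.1 ≤ W ∧
      ∀ (w : Module.Dual Γ(X, V.1) (Forms X V))
        (w' : Module.Dual Γ(X, V.1 ⊓ U₀.1) (Forms X (V.1 ⊓ U₀.1))),
        (∀ η, w' (resForm X inf_le_left η) = X.presheaf.map (homOfLE inf_le_left).op (w η)) →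
        ∃ g : Γ(X, V.1), X.presheaf.map (homOfLE inf_le_left).op g =
          w' (resForm X inf_le_right ξ)) :
    ∃ η : GlobalForm X, ∀ (V : X.affineOpens) (hV : V.1 ≤ U₀.1), η.app V = resForm X hV ξ := by
  have hW (U : X.affineOpens) : IsAffineOpen (U.1 ⊓ U₀.1) := isAffineOpen_inf U U₀
  have hWU (U : X.affineOpens) : U.1 ⊓ U₀.1 ≤ U.1 := inf_le_left
  have hWi (U : X.affineOpens) : U.1 ⊓ U₀.1 ≤ U₀.1 := inf_le_right
  have key (U : X.affineOpens) :
      ∃ η : Forms X U, resForm X (hWU U) η = resForm X (hWi U) ξ := by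
    obtain ⟨n, v, m, hm⟩ := exists_dual_basis (R := Γ(X, U.1)) (M := Forms X U)
    choose v' hv' using fun k => (span_and_extend_forms (V := ⟨_, hW U⟩) (hWU U)).2 (v k)
    have hext (k : Fin n) : ∃ g : Γ(X, U.1), X.presheaf.map (homOfLE (hWU U)).op g =
        v' k (resForm X (hWi U) ξ) := by
      refine exists_extension_of_local h₀ _ fun x hx => ?_
      obtain ⟨V, hxV, hVU, hV⟩ := H x U.1 hx
      obtain ⟨w, hw⟩ := (span_and_extend_forms hVU).2 (v k)
      obtain ⟨w', hw'⟩ := (span_and_extend_forms (V := ⟨_, hW V⟩) (hWU V)).2 w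
      obtain ⟨g, hg⟩ := hV w w' hw'
      have hle : V.1 ⊓ U₀.1 ≤ U.1 ⊓ U₀.1 := inf_le_inf_right _ hVU
      refine ⟨V.1, hVU, g, hxV, hg.trans ?_⟩
      rw [← resForm_resForm (hWi U) hle]
      refine extension_comp (V := ⟨_, hW U⟩) (W := ⟨_, hW V⟩) (hWU U) hle (v k) (v' k) w'
        (hv' k) (fun η => ?_) _
      rw [← map_map hVU (hWU V), ← hw, ← hw', resForm_resForm]
    choose g hg using hext
    have hsum (η : Forms X (U.1 ⊓ U₀.1)) : η = ∑ k, v' k η • resForm X (hWU U) (m k) := by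
      have hη : η ∈ Submodule.span Γ(X, U.1 ⊓ U₀.1) (Set.range (resForm X (hWU U))) := by
        rw [(span_and_extend_forms (V := ⟨_, hW U⟩) (hWU U)).1]
        trivial
      induction hη using Submodule.span_induction with
      | mem x hx =>
        obtain ⟨η, rfl⟩ := hx
        conv_lhs => rw [hm η, map_sum]
        exact Finset.sum_congr rfl fun k _ => by rw [resForm_smul, hv']
      | zero => simp
      | add x y _ _ hx hy =>
        conv_lhs => rw [hx, hy, ← Finset.sum_add_distrib]
        exact Finset.sum_congr rfl fun k _ => by rw [map_add, add_smul]
      | smul r x _ hx =>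
        conv_lhs => rw [hx, Finset.smul_sum]
        exact Finset.sum_congr rfl fun k _ => by rw [map_smul, smul_smul, smul_eq_mul]
    refine ⟨∑ k, g k • m k, ?_⟩
    conv_rhs => rw [hsum (resForm X (hWi U) ξ)]
    rw [map_sum]
    exact Finset.sum_congr rfl fun k _ => by rw [resForm_smul, hg]
  choose η hη using key
  refine ⟨⟨η, fun U V h => ?_⟩, fun V hV => ?_⟩
  · refine eq_of_resForm_eq (V := ⟨_, hW V⟩) (hWU V) (fun hV => inf_nonempty hV h₀) ?_
    rw [hη, resForm_resForm h (hWU V),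
      ← resForm_resForm (hWU U) (inf_le_inf_right _ h : V.1 ⊓ U₀.1 ≤ U.1 ⊓ U₀.1), hη,
      resForm_resForm]
  · refine eq_of_resForm_eq (V := ⟨_, hW V⟩) (hWU V) (fun hV => inf_nonempty hV h₀) ?_
    rw [hη, resForm_resForm]

end Discriminant

/-! ### Square roots of the discriminant -/

section Square

variable {X : Scheme.{0}} [X.Over (Spec (.of ℂ))] [IsSeparated (X ↘ Spec (.of ℂ))] [IsIntegral X]
  {E : X.Modules} {φ : HiggsField E}

/-- A square root `d` of the discriminant in an adapted frame gives a form `d ω`, which extends to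
the whole curve: the squares of its contractions with vector fields extend, and the curve is
normal. -/
theorem IsAdapted.discIsSquare_iff [SmoothOfRelativeDimension 1 (X ↘ Spec (.of ℂ))]
    [QuasiCompact (X ↘ Spec (.of ℂ))] (hE : IsLocallyFreeOfRank E 2) {i : FramedAffine E}
    {α β : Γ(X, i.U.1)} (hi : IsAdapted φ i α β) (h₀ : (i.U.1 : Set X).Nonempty) :
    φ.DiscIsSquare ↔ ∃ d, d ^ 2 = α ^ 2 + 4 * β := by
  have hW (U : X.affineOpens) : IsAffineOpen (U.1 ⊓ i.U.1) := isAffineOpen_inf U i.U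
  have hWU (U : X.affineOpens) : U.1 ⊓ i.U.1 ≤ U.1 := inf_le_left
  have hWi (U : X.affineOpens) : U.1 ⊓ i.U.1 ≤ i.U.1 := inf_le_right
  constructor
  · rintro ⟨η, hη⟩
    obtain ⟨v, hv⟩ := hi.isGenerator.exists_dual
    have h1 := dualPair_disc (φ := φ) i v v
    have hv1 : v (φ.matrix i 0 1) = 1 := by simpa using hv 1
    rw [hη i, dualPair_tmul, hi.sub_eq, hi.eq, hv, hv, hv1] at h1
    exact ⟨v (η.app i.U), by linear_combination h1⟩
  · rintro ⟨d, hd⟩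
    have hdisc (j : FramedAffine E) (v w : Module.Dual Γ(X, j.U.1) (Forms X j.U.1))
        (v' w' : Module.Dual Γ(X, j.U.1 ⊓ i.U.1) (Forms X (j.U.1 ⊓ i.U.1)))
        (hv : ∀ η, v' (resForm X (hWU j.U) η) = X.presheaf.map (homOfLE (hWU j.U)).op (v η))
        (hw : ∀ η, w' (resForm X (hWU j.U) η) = X.presheaf.map (homOfLE (hWU j.U)).op (w η)) :
        X.presheaf.map (homOfLE (hWU j.U)).op
        (dualPair v w (φ.disc j)) = v' (resForm X (hWi j.U) (d • φ.matrix i 0 1)) *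
          w' (resForm X (hWi j.U) (d • φ.matrix i 0 1)) := by
      refine (hi.disc_eq j (V := ⟨_, hW j.U⟩) le_rfl v w v' w' hv hw).trans ?_
      rw [resForm_smul, map_smul, map_smul, ← hd, map_pow, smul_eq_mul, smul_eq_mul]
      ring
    obtain ⟨η, hη⟩ := exists_globalForm_of_local h₀ (d • φ.matrix i 0 1) fun x W hx => by
      obtain ⟨j, hxj, hjW⟩ := exists_framedAffine hE x W hx
      refine ⟨j.U, hxj, hjW, fun w w' hw' => ?_⟩
      have hsq : w' (resForm X (hWi j.U) (d • φ.matrix i 0 1)) ^ 2 =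
          X.presheaf.map (homOfLE (hWU j.U)).op 0 *
            w' (resForm X (hWi j.U) (d • φ.matrix i 0 1)) +
          X.presheaf.map (homOfLE (hWU j.U)).op (dualPair w w (φ.disc j)) := by
        rw [hdisc j w w w' w' hw' hw', map_zero, zero_mul, zero_add, sq]
      have := isIntegrallyClosed_of_smooth j.U ⟨x, hxj⟩
      have hj : IsAffineOpen j.U.1 := j.U.2
      obtain ⟨g, hg, -⟩ := exists_root_extension hj (hWU j.U) (inf_nonempty ⟨x, hxj⟩ h₀) _ _ _ hsq
      exact ⟨g, hg⟩
    refine ⟨η, fun j => eq_of_forall_dualPair fun v w => ?_⟩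
    obtain ⟨v', hv⟩ := (span_and_extend_forms (V := ⟨_, hW j.U⟩) (hWU j.U)).2 v
    obtain ⟨w', hw⟩ := (span_and_extend_forms (V := ⟨_, hW j.U⟩) (hWU j.U)).2 w
    refine eq_of_map_eq (hWU j.U) (fun hj => inf_nonempty hj h₀) ?_
    rw [hdisc j v w v' w' hv hw, dualPair_tmul, map_mul, ← hv, ← hw,
      η.res_app j.U ⟨_, hW j.U⟩ (hWU j.U), hη ⟨_, hW j.U⟩ (hWi j.U)]

end Square

/-! ### Algebra of a quadratic double cover -/

section CurveAlgebra

open Polynomial in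
/-- A monic quadratic polynomial without roots over an integrally closed domain is prime. -/
theorem prime_curvePoly {R : Type} [CommRing R] [IsDomain R] [IsIntegrallyClosed R] {α β : R}
    (h : IsEmpty (Roots α β)) : Prime (curvePoly α β) := by
  let K := FractionRing R
  have hinj : Function.Injective (algebraMap R K) := IsFractionRing.injective R K
  have hmonic := curvePoly_monic α β
  have hirr : Irreducible ((curvePoly α β).map (algebraMap R K)) := by
    have hdeg : ((curvePoly α β).map (algebraMap R K)).natDegree = 2 := by
      rw [hmonic.natDegree_map, natDegree_curvePoly]
    rw [(hmonic.map _).irreducible_iff_roots_eq_zero_of_degree_le_three hdeg.ge (by omega)]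
    refine Multiset.eq_zero_of_forall_notMem fun z hz => ?_
    have hz' : eval₂ (algebraMap R K) z (curvePoly α β) = 0 := by
      rw [← Polynomial.eval_map]
      exact isRoot_of_mem_roots hz
    obtain ⟨τ, rfl⟩ := IsIntegrallyClosed.isIntegral_iff.1 ⟨_, hmonic, hz'⟩
    rw [eval₂_curvePoly, ← map_pow, ← map_mul, ← map_add, sub_eq_zero] at hz'
    exact h.false ⟨τ, hinj hz'⟩
  refine ⟨hmonic.ne_zero, fun hu => hirr.not_isUnit (hu.map (mapRingHom (algebraMap R K))),
    fun a b hab => ?_⟩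
  rw [← map_dvd_map _ hinj hmonic, ← map_dvd_map _ hinj hmonic]
  refine hirr.prime.dvd_or_dvd ?_
  rw [← Polynomial.map_mul]
  exact Polynomial.map_dvd _ hab

variable {R : Type} [CommRing R] {α β : R}

theorem root_sq : AdjoinRoot.root (curvePoly α β) ^ 2 =
    AdjoinRoot.of _ α * AdjoinRoot.root (curvePoly α β) + AdjoinRoot.of _ β := by
  have := AdjoinRoot.eval₂_root (curvePoly α β)
  rw [eval₂_curvePoly] at this
  exact sub_eq_zero.1 this

/-- Two different roots `τ`, `τ'` split the double cover: the product of the functions `t - τ` and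
`t - τ'` is zero. -/
theorem exists_disjoint_basicOpen [IsDomain R] {τ τ' : Roots α β} (h : τ ≠ τ') :
    ∃ f g : AdjoinRoot (curvePoly α β), f * g = 0 ∧ ¬ IsNilpotent f ∧ ¬ IsNilpotent g := by
  have hsum : (τ.1 - τ'.1) * (τ.1 + τ'.1 - α) = 0 := by linear_combination τ.2 - τ'.2
  have h1 : τ.1 + τ'.1 = α := by
    rcases mul_eq_zero.1 hsum with h2 | h2
    · exact absurd (Subtype.ext (sub_eq_zero.1 h2)) h
    · exact sub_eq_zero.1 h2
  have hβ : β = -(τ.1 * τ'.1) := by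
    linear_combination -τ.2 + τ.1 * h1
  have hne {τ τ' : Roots α β} (h : τ ≠ τ') :
      ¬ IsNilpotent (AdjoinRoot.root (curvePoly α β) - AdjoinRoot.of _ τ.1) := by
    intro hn
    let e := AdjoinRoot.lift (RingHom.id R) τ'.1 (by
      rw [eval₂_curvePoly, RingHom.id_apply, RingHom.id_apply, τ'.2, sub_self] :
        (curvePoly α β).eval₂ (RingHom.id R) τ'.1 = 0)
    have h2 := (hn.map e).eq_zero
    rw [map_sub, AdjoinRoot.lift_root, AdjoinRoot.lift_of, RingHom.id_apply, sub_eq_zero] at h2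
    exact h (Subtype.ext h2.symm)
  refine ⟨_, _, ?_, hne h, hne h.symm⟩
  have hr := root_sq (α := α) (β := β)
  have h1' := congrArg (AdjoinRoot.of (curvePoly α β)) h1
  have hβ' := congrArg (AdjoinRoot.of (curvePoly α β)) hβ
  rw [map_add] at h1'
  rw [map_neg, map_mul] at hβ'
  linear_combination hr - AdjoinRoot.root (curvePoly α β) * h1' + hβ'

/-- A double root makes the double cover nonreduced. -/
theorem not_isReduced_adjoinRoot [Nontrivial R] {τ : R} (h : 2 * τ = α) (h' : τ ^ 2 = -β) :
    ¬ IsReduced (AdjoinRoot (curvePoly α β)) := by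
  intro hred
  have hr := root_sq (α := α) (β := β)
  have h1 := congrArg (AdjoinRoot.of (curvePoly α β)) h
  have h2 := congrArg (AdjoinRoot.of (curvePoly α β)) h'
  rw [map_mul, map_ofNat] at h1
  rw [map_neg, map_pow] at h2
  have hnil : (AdjoinRoot.root (curvePoly α β) - AdjoinRoot.of _ τ) ^ 2 = 0 := by
    linear_combination hr - AdjoinRoot.root (curvePoly α β) * h1 + h2
  have h0 := pow_eq_zero_iff two_ne_zero |>.1 hnil
  refine AdjoinRoot.mk_ne_zero_of_natDegree_lt (curvePoly_monic α β)
    (g := Polynomial.X - Polynomial.C τ) (Polynomial.X_sub_C_ne_zero τ) ?_ ?_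
  · rw [Polynomial.natDegree_X_sub_C, natDegree_curvePoly]
    norm_num
  · rw [map_sub, AdjoinRoot.mk_X, AdjoinRoot.mk_C]
    exact h0

open Polynomial in
/-- Translation of a double root to zero. -/
theorem exists_ringEquiv_of_double_root {τ : R} (h : 2 * τ = α) (h' : τ ^ 2 = -β) :
    ∃ e : AdjoinRoot (curvePoly α β) ≃+* R[X] ⧸ Ideal.span {(X : R[X]) ^ 2},
      ∀ r, e (AdjoinRoot.of _ r) = algebraMap R _ r := by
  have hp : algEquivAevalXAddC τ (curvePoly α β) = X ^ 2 := by
    rw [curvePoly, ← h]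
    have h2 : (C (2 : R) : R[X]) = 2 := rfl
    have hβ : C τ ^ 2 = -C β := by rw [← C_pow, h', C_neg]
    simp only [algEquivAevalXAddC, algEquivOfCompEqX, map_sub, map_add, map_mul, map_pow]
    simp
    linear_combination (-(X * C τ) - C τ ^ 2) * h2 - hβ
  let e := Ideal.quotientEquivAlg (Ideal.span {curvePoly α β}) (Ideal.span {(X : R[X]) ^ 2})
    (algEquivAevalXAddC τ) (by
      rw [Ideal.map_span, Set.image_singleton]
      exact (congrArg (fun p => Ideal.span {p}) hp).symm)
  exact ⟨e.toRingEquiv, fun r => e.commutes r⟩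

end CurveAlgebra

/-! ### Irreducibility and reducedness -/

section Components

variable {X : Scheme.{0}} [X.Over (Spec (.of ℂ))] [QuasiCompact (X ↘ Spec (.of ℂ))]
  [SmoothOfRelativeDimension 1 (X ↘ Spec (.of ℂ))] [IsSeparated (X ↘ Spec (.of ℂ))]
  [IsIntegral X] {E : X.Modules} {φ : HiggsField E} (hE : IsLocallyFreeOfRank E 2)

theorem range_of_isPullback {P Y Z W : Scheme.{0}} {q : P ⟶ Y} {p : P ⟶ Z} {f : Y ⟶ W}
    {g : Z ⟶ W} (h : IsPullback q p f g) [IsOpenImmersion g] :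
    IsOpenImmersion q ∧ Set.range q = f ⁻¹' Set.range g := by
  have e := h.isoPullback_hom_fst
  constructor
  · rw [← e]
    infer_instance
  · have h1 : Set.range (pullback.fst f g) = f ⁻¹' Set.range g :=
      IsOpenImmersion.range_pullbackFst _ _
    rw [← h1, ← e]
    exact Function.Surjective.range_comp h.isoPullback.hom.surjective _

include hE

omit [IsIntegral X] in
/-- The part of the Higgs Grassmannian over the domain of an adapted frame is the curve `t² = α t +
β`. -/
theorem IsAdapted.exists_piece {i : FramedAffine E} {α β : Γ(X, i.U.1)} (hi : IsAdapted φ i α β) :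
    ∃ q : Spec (.of (AdjoinRoot (curvePoly α β))) ⟶ φ.grass, IsOpenImmersion q ∧
      Set.range q = φ.grassProj ⁻¹' i.U.1 := by
  have hU : IsAffineOpen i.U.1 := i.U.2
  obtain ⟨q, hq⟩ := hi.exists_isPullback_fromSpec hE hU
  obtain ⟨h1, h2⟩ := range_of_isPullback hq
  exact ⟨q, h1, by rw [h2, hU.range_fromSpec]⟩

/-- Two different roots make the Higgs Grassmannian reducible: over the domain of the frame there
are two nonempty open sets that do not meet. -/
theorem IsAdapted.not_preirreducibleSpace {i : FramedAffine E} {α β : Γ(X, i.U.1)}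
    (hi : IsAdapted φ i α β) (h₀ : (i.U.1 : Set X).Nonempty) {τ τ' : Roots α β} (h : τ ≠ τ') :
    ¬ PreirreducibleSpace φ.grass := by
  intro hirr
  have : Nonempty i.U.1 := h₀.to_subtype
  obtain ⟨q, hq, -⟩ := hi.exists_piece hE
  obtain ⟨f, g, hfg, hf, hg⟩ := exists_disjoint_basicOpen h
  have hne {f : AdjoinRoot (curvePoly α β)} (hf : ¬ IsNilpotent f) :
      (PrimeSpectrum.basicOpen f : Set (PrimeSpectrum (AdjoinRoot (curvePoly α β)))).Nonempty := by
    by_contra h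
    rw [Set.not_nonempty_iff_eq_empty] at h
    exact hf (PrimeSpectrum.basicOpen_eq_bot_iff f |>.1 (SetLike.coe_injective h))
  have hopen (f : AdjoinRoot (curvePoly α β)) : IsOpen (q '' (PrimeSpectrum.basicOpen f).1) :=
    q.isOpenEmbedding.isOpenMap _ (PrimeSpectrum.basicOpen f).2
  obtain ⟨_, ⟨a, ha, rfl⟩, ⟨b, hb, hab⟩⟩ := nonempty_preirreducible_inter (hopen f) (hopen g)
    ((hne hf).image q) ((hne hg).image q)
  obtain rfl := q.isOpenEmbedding.injective hab
  have h1 : b ∈ PrimeSpectrum.basicOpen (f * g) := by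
    rw [PrimeSpectrum.basicOpen_mul]
    exact ⟨ha, hb⟩
  rw [hfg, PrimeSpectrum.basicOpen_zero] at h1
  exact h1

omit [IsIntegral X] in
theorem IsAdapted.not_isReduced {i : FramedAffine E} {α β : Γ(X, i.U.1)}
    (hi : IsAdapted φ i α β) (h₀ : (i.U.1 : Set X).Nonempty) {τ : Γ(X, i.U.1)} (h : 2 * τ = α)
    (h' : τ ^ 2 = -β) : ¬ IsReduced φ.grass := by
  intro hred
  have : Nonempty i.U.1 := h₀.to_subtype
  obtain ⟨q, hq, -⟩ := hi.exists_piece hE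
  have h1 : IsReduced (Spec (.of (AdjoinRoot (curvePoly α β)))) := isReduced_of_isOpenImmersion q
  exact not_isReduced_adjoinRoot h h' ((affine_isReduced_iff _).1 h1)

variable (hgcd : ∀ i, φ.GcdEqOne i)

include hgcd

/-- If `ρ₁` has no section, there is no root in any adapted frame. -/
theorem isEmpty_roots {i : FramedAffine E} {α β : Γ(X, i.U.1)} (hi : IsAdapted φ i α β)
    (h₀ : (i.U.1 : Set X).Nonempty) (h : IsEmpty φ.Sections) : IsEmpty (Roots α β) := by
  obtain ⟨e⟩ := hi.nonempty_roots_equiv_sections hE hgcd h₀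
  exact e.isEmpty

/-- If `ρ₁` has no section, the Higgs Grassmannian is covered by spectra of domains. -/
theorem isReduced_grass (h : IsEmpty φ.Sections) : IsReduced φ.grass := by
  have (p : φ.grass) : _root_.IsReduced (φ.grass.presheaf.stalk p) := by
    obtain ⟨i, α, β, hp, hi⟩ := exists_isAdapted φ hE hgcd (φ.grassProj p)
    obtain ⟨q, hq, hr⟩ := hi.exists_piece hE
    obtain ⟨y, rfl⟩ : p ∈ Set.range q := hr ▸ hp
    have := isIntegrallyClosed_of_smooth i.U ⟨_, hp⟩
    have : Nonempty i.U.1 := ⟨⟨_, hp⟩⟩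
    have := AdjoinRoot.isDomain_of_prime (prime_curvePoly (isEmpty_roots hE hgcd hi ⟨_, hp⟩ h))
    exact isReduced_of_injective (q.stalkMap y).hom
      (asIso (q.stalkMap y)).commRingCatIsoToRingEquiv.injective
  exact isReduced_of_isReduced_stalk _

/-- If `ρ₁` has no section, the Higgs Grassmannian is covered by spectra of domains. Since `ρ₁` is
surjective and the base is irreducible, these open sets meet each other. -/
theorem irreducibleSpace_grass (h : IsEmpty φ.Sections) : IrreducibleSpace φ.grass := by
  have := isFinite_grassProj hE hgcd
  have := flat_grassProj hE hgcd
  have hsurj : Surjective φ.grassProj := by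
    rw [← Scheme.Hom.one_le_finrank_iff_surjective]
    intro x
    rw [finrank_grassProj hE hgcd]
    norm_num
  obtain ⟨x₀⟩ : Nonempty X := inferInstance
  obtain ⟨i₀, α₀, β₀, hx₀, hi₀⟩ := exists_isAdapted φ hE hgcd x₀
  have hirr {i : FramedAffine E} {α β : Γ(X, i.U.1)} (hi : IsAdapted φ i α β)
      (h₀ : (i.U.1 : Set X).Nonempty) : IsIrreducible (φ.grassProj ⁻¹' i.U.1) := by
    obtain ⟨q, hq, hr⟩ := hi.exists_piece hE
    have := isIntegrallyClosed_of_smooth i.U h₀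
    have : Nonempty i.U.1 := h₀.to_subtype
    have := AdjoinRoot.isDomain_of_prime (prime_curvePoly (isEmpty_roots hE hgcd hi h₀ h))
    have : IrreducibleSpace (Spec (.of (AdjoinRoot (curvePoly α β)))) :=
      PrimeSpectrum.irreducibleSpace
    rw [← hr, ← Set.image_univ]
    exact (IrreducibleSpace.isIrreducible_univ _).image q q.continuous.continuousOn
  have hmeet (A : Set φ.grass) (hA : IsOpen A) (hne : A.Nonempty) :
      (φ.grassProj ⁻¹' i₀.U.1 ∩ A).Nonempty := by
    obtain ⟨a, ha⟩ := hne
    -- a point of the base over which both pieces lie lifts to the Higgs Grassmannian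
    obtain ⟨j, α, β, hj, hadj⟩ := exists_isAdapted φ hE hgcd (φ.grassProj a)
    obtain ⟨y, hy, hy'⟩ := inf_nonempty (U := i₀.U.1) (V := j.U.1) ⟨_, hx₀⟩ ⟨_, hj⟩
    obtain ⟨g, rfl⟩ := hsurj.surj y
    obtain ⟨z, -, hz, hzA⟩ := (hirr hadj ⟨_, hj⟩).2 (φ.grassProj ⁻¹' i₀.U.1) A
      (i₀.U.1.2.preimage φ.grassProj.continuous) hA ⟨g, hy', hy⟩ ⟨a, hj, ha⟩
    exact ⟨z, hz, hzA⟩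
  have : PreirreducibleSpace φ.grass := ⟨fun A C hA hC ⟨a, _, ha⟩ ⟨c, _, hc⟩ => by
    obtain ⟨z, -, hz⟩ := (hirr hi₀ ⟨_, hx₀⟩).2 A C hA hC (hmeet A hA ⟨a, ha⟩) (hmeet C hC ⟨c, hc⟩)
    exact ⟨z, trivial, hz⟩⟩
  obtain ⟨g, -⟩ := hsurj.surj x₀
  exact { toNonempty := ⟨g⟩ }

omit hgcd in
/-- Where the discriminant vanishes, the fibres of `ρ₁` over closed points are double points. -/
theorem exists_fibre_iso (hgcd : ∀ i, φ.GcdEqOne i) (h : φ.DiscEqZero) (b : Spec (.of ℂ) ⟶ X) :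
    ∃ e : pullback φ.grassProj b ≅
        Spec (.of (Polynomial ℂ ⧸ Ideal.span {(Polynomial.X : Polynomial ℂ) ^ 2})),
      e.hom ≫ Spec.map (CommRingCat.ofHom (algebraMap ℂ
        (Polynomial ℂ ⧸ Ideal.span {(Polynomial.X : Polynomial ℂ) ^ 2}))) =
        pullback.snd φ.grassProj b := by
  obtain ⟨i, α, β, hx, hi⟩ := exists_isAdapted φ hE hgcd (b (IsLocalRing.closedPoint ℂ))
  have hb : ⊤ ≤ b ⁻¹ᵁ i.U.1 := fun t _ => by
    have : t = IsLocalRing.closedPoint ℂ := Subsingleton.elim (α := PrimeSpectrum ℂ) _ _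
    rw [this]
    exact hx
  let f : Γ(X, i.U.1) →+* ℂ := (b.appLE i.U.1 ⊤ hb ≫ (Scheme.ΓSpecIso (.of ℂ)).hom).hom
  have hf (a : Γ(X, i.U.1)) : b.appLE i.U.1 ⊤ hb a = (Scheme.ΓSpecIso (.of ℂ)).inv (f a) := by
    change _ = ((Scheme.ΓSpecIso (.of ℂ)).hom ≫ (Scheme.ΓSpecIso (.of ℂ)).inv) _
    rw [Iso.hom_inv_id]
    rfl
  obtain ⟨q, hq⟩ := hi.exists_isPullback hE (R₀ := .of ℂ) b hb (hf α) (hf β)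
  have hδ := congrArg f ((hi.discEqZero_iff ⟨_, hx⟩).1 h)
  rw [map_add, map_mul, map_pow, map_ofNat, map_zero] at hδ
  obtain ⟨e, he⟩ := exists_ringEquiv_of_double_root (R := ℂ) (α := f α) (β := f β)
    (τ := f α / 2) (by ring) (by linear_combination hδ / 4)
  refine ⟨hq.isoPullback.symm ≪≫ (Scheme.Spec.mapIso e.toCommRingCatIso.op).symm, ?_⟩
  have h1 : CommRingCat.ofHom (algebraMap ℂ (Polynomial ℂ ⧸
      Ideal.span {(Polynomial.X : Polynomial ℂ) ^ 2})) ≫ e.toCommRingCatIso.inv =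
      CommRingCat.ofHom (AdjoinRoot.of (curvePoly (f α) (f β))) := by
    ext r
    exact e.symm_apply_eq.2 (he r).symm
  refine Eq.trans (Category.assoc _ _ _) (Eq.trans ?_ hq.isoPullback_inv_snd)
  exact congrArg (hq.isoPullback.inv ≫ ·) ((Spec.map_comp _ _).symm.trans (congrArg Spec.map h1))

end Components

/-! ### Central Higgs fields -/

section Central

variable {X : Scheme.{0}} {E : X.Modules}

theorem eq_of_res_eq_of_cover {U : X.Opens} {s t : Γ(E, U)}
    (h : ∀ x ∈ U, ∃ (V : X.Opens) (h : V ≤ U), x ∈ V ∧ res E h s = res E h t) : s = t := by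
  choose V hVU hxV hV using fun x : U => h x.1 x.2
  exact TopCat.Sheaf.eq_of_locally_eq' ⟨_, E.isSheaf⟩ V U (fun x => homOfLE (hVU x))
    (fun x hx => Opens.mem_iSup.2 ⟨⟨x, hx⟩, hxV ⟨x, hx⟩⟩) s t hV

/-- Sections of a locally free sheaf on an integral scheme are determined by their restriction to a
nonempty open set. -/
theorem eq_of_res_eq [IsIntegral X] (hE : IsLocallyFreeOfRank E 2) {U U₀ : X.Opens}
    (h₀ : (U₀ : Set X).Nonempty) {s t : Γ(E, U)}
    (h : res E (inf_le_left : U ⊓ U₀ ≤ U) s = res E inf_le_left t) : s = t := by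
  refine eq_of_res_eq_of_cover fun x hx => ?_
  obtain ⟨U', hxU', ⟨e⟩⟩ := hE x
  have hVU : U ⊓ U' ≤ U := inf_le_left
  have hVU' : U ⊓ U' ≤ U' := inf_le_right
  have hW : (U ⊓ U') ⊓ U₀ ≤ U ⊓ U' := inf_le_left
  have hW' : (U ⊓ U') ⊓ U₀ ≤ U ⊓ U₀ := inf_le_inf_right _ inf_le_left
  refine ⟨U ⊓ U', hVU, ⟨hx, hxU'⟩, (e.basis hVU').ext_elem fun a => ?_⟩
  refine eq_of_map_eq hW (fun hne => inf_nonempty hne h₀) ?_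
  rw [← e.repr_res hVU' hW, ← e.repr_res hVU' hW, res_res, res_res,
    ← res_res E inf_le_left hW', ← res_res E inf_le_left hW', h]

variable [X.Over (Spec (.of ℂ))] {φ : HiggsField E}
  [Smooth (X ↘ Spec (.of ℂ))] [IsSeparated (X ↘ Spec (.of ℂ))] [IsIntegral X]

/-- A Higgs field that is scalar in some frame is central: its upper left entries in all frames
glue to a global form. -/
theorem isCentral_of_matrix (hE : IsLocallyFreeOfRank E 2) (k : FramedAffine E)
    (h₀ : (k.U.1 : Set X).Nonempty) (h01 : φ.matrix k 0 1 = 0) (h10 : φ.matrix k 1 0 = 0)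
    (h11 : φ.matrix k 1 1 - φ.matrix k 0 0 = 0) : φ.IsCentral := by
  have hW (U : X.affineOpens) : IsAffineOpen (U.1 ⊓ k.U.1) := isAffineOpen_inf U k.U
  have hWU (U : X.affineOpens) : U.1 ⊓ k.U.1 ≤ U.1 := inf_le_left
  have hWk (U : X.affineOpens) : U.1 ⊓ k.U.1 ≤ k.U.1 := inf_le_right
  -- contraction with a vector field acts on `E` over the domain of the frame as a scalar
  have hscal (V : X.affineOpens) (hV : V.1 ≤ k.U.1) (v : Module.Dual Γ(X, V.1) (Forms X V.1))
      (s : Γ(E, V.1)) : contract E v (φ.app V s) = v (resForm X hV (φ.matrix k 0 0)) • s := by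
    have hb (b : Fin 2) : contract E v (φ.app V (res E hV (k.frame.vec b))) =
        v (resForm X hV (φ.matrix k 0 0)) • res E hV (k.frame.vec b) := by
      rw [contract_app_res_vec, Fin.sum_univ_two]
      simp only [contractedMatrix]
      fin_cases b
      · simp [h10]
      · simp [h01, sub_eq_zero.1 h11]
    rw [← (k.frame.basis hV).sum_repr s]
    simp only [Fin.sum_univ_two, map_add, map_smul, Frame.basis_apply, hb]
    module
  obtain ⟨η, hη⟩ := exists_globalForm_of_local h₀ (φ.matrix k 0 0) fun x W hx => by
    obtain ⟨j, hxj, hjW⟩ := exists_framedAffine hE x W hx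
    refine ⟨j.U, hxj, hjW, fun w w' hw' => ⟨w (φ.matrix j 0 0), ?_⟩⟩
    have h1 := hscal ⟨_, hW j.U⟩ (hWk j.U) w' (res E (hWU j.U) (j.frame.vec 0))
    rw [contract_app_res_vec φ j (V := ⟨_, hW j.U⟩) (hWU j.U), Fin.sum_univ_two,
      ← Frame.basis_apply, ← Frame.basis_apply] at h1
    have h2 := congrArg (fun s => (j.frame.basis (hWU j.U)).repr s 0) h1
    simp only [map_add, map_smul, Module.Basis.repr_self, Finsupp.add_apply,
      Finsupp.smul_apply] at h2
    rw [← hw']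
    simpa [contractedMatrix] using h2
  refine ⟨η, fun U s => eq_of_forall_contract fun v => ?_⟩
  obtain ⟨v', hv⟩ := (span_and_extend_forms (V := ⟨_, hW U⟩) (hWU U)).2 v
  refine eq_of_res_eq hE h₀ ?_
  rw [← contract_resTensor (hWU U) v v' hv, ← contract_resTensor (hWU U) v v' hv,
    φ.res_app U ⟨_, hW U⟩ (hWU U), resTensor_tmul, contract_tmul,
    hscal ⟨_, hW U⟩ (hWk U), η.res_app U ⟨_, hW U⟩ (hWU U), hη ⟨_, hW U⟩ (hWk U)]

end Central

/-! ### Points of the fibres of the projective bundle -/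

section ChartPoints

variable {X : Scheme.{0}} {E : X.Modules}

theorem appLE_congr_hom {S T : Scheme.{0}} {f g : S ⟶ T} (e : f = g) {U : T.Opens}
    (hf : ⊤ ≤ f ⁻¹ᵁ U) (hg : ⊤ ≤ g ⁻¹ᵁ U) : f.appLE U ⊤ hf = g.appLE U ⊤ hg := by
  subst e
  rfl

theorem top_le_chartProj (k : FramedAffine E) : ⊤ ≤ chartProj k ⁻¹ᵁ k.U.1 :=
  le_preimage k (𝟙 _)

/-- A chart of the projective bundle is the affine line over the ring of functions of its base. -/
theorem exists_isIso_chart (k : FramedAffine E) (hU : IsAffineOpen k.U.1) :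
    ∃ c : Spec (.of (Polynomial Γ(X, k.U.1))) ⟶ chart k, IsIso c ∧
      c ≫ chartProj k = Spec.map (CommRingCat.ofHom Polynomial.C) ≫ hU.fromSpec ∧
      (∀ a, c.appTop ((chartProj k).appLE k.U.1 ⊤ (top_le_chartProj k) a) =
        (Scheme.ΓSpecIso (.of (Polynomial Γ(X, k.U.1)))).inv
          (Polynomial.C a : Polynomial Γ(X, k.U.1))) ∧
      c.appTop (chartCoord k) = (Scheme.ΓSpecIso (.of (Polynomial Γ(X, k.U.1)))).inv
        (Polynomial.X : Polynomial Γ(X, k.U.1)) := by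
  set R : CommRingCat := Γ(X, k.U.1)
  set S : CommRingCat := .of (Polynomial R)
  let p : Spec S ⟶ Spec R := Spec.map (CommRingCat.ofHom Polynomial.C)
  have hpa (a : R) : p.appTop ((Scheme.ΓSpecIso R).inv a) =
      (Scheme.ΓSpecIso S).inv (Polynomial.C a : Polynomial R) :=
    congrArg (fun g => g.hom a) (Scheme.ΓSpecIso_inv_naturality
      (CommRingCat.ofHom (Polynomial.C : R →+* Polynomial R))).symm
  have hp : ⊤ ≤ (p ≫ hU.fromSpec) ⁻¹ᵁ k.U.1 := top_le_comp _ _ (top_le_fromSpec hU)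
  let c : Spec S ⟶ chart k := chartPt k (p ≫ hU.fromSpec) hp
    ((Scheme.ΓSpecIso S).inv (Polynomial.X : Polynomial R))
  have hc : c ≫ chartProj k = p ≫ hU.fromSpec := chartPt_proj _ _ _ _
  have hc' : c.appTop (chartCoord k) = _ := chartPt_coord _ _ _ _
  have hk : ⊤ ≤ chartProj k ⁻¹ᵁ k.U.1 := top_le_chartProj k
  let f : Polynomial R →+* Γ(chart k, ⊤) :=
    Polynomial.eval₂RingHom ((chartProj k).appLE k.U.1 ⊤ hk).hom (chartCoord k)
  have hfC (a : R) : f (Polynomial.C a) = (chartProj k).appLE k.U.1 ⊤ hk a :=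
    Polynomial.eval₂_C _ _
  have hfX : f Polynomial.X = chartCoord k := Polynomial.eval₂_X _ _
  obtain ⟨d, hd⟩ := exists_hom_Spec (R := S) (CommRingCat.ofHom f)
  have hd (r : Polynomial R) : d.appTop ((Scheme.ΓSpecIso S).inv r) = f r := hd r
  have hcC (a : R) : c.appTop ((chartProj k).appLE k.U.1 ⊤ hk a) =
      (Scheme.ΓSpecIso S).inv (Polynomial.C a : Polynomial R) := by
    have hck : ⊤ ≤ (c ≫ chartProj k) ⁻¹ᵁ k.U.1 := le_preimage k c
    rw [← appLE_comp_apply _ _ hk hck, ← hpa, ← appLE_fromSpec hU (top_le_fromSpec hU),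
      ← appLE_comp_apply _ _ _ hp, appLE_congr_hom hc hck hp]
  have hcd : c ≫ d = 𝟙 _ := by
    have h1 : (CommRingCat.ofHom f ≫ c.appTop).hom = (Scheme.ΓSpecIso S).inv.hom := by
      refine Polynomial.ringHom_ext (fun a => ?_) ?_
      · change c.appTop (f (Polynomial.C a)) = (Scheme.ΓSpecIso S).inv (Polynomial.C a)
        rw [hfC, hcC]
      · change c.appTop (f Polynomial.X) = _
        rw [hfX, hc']
    refine hom_Spec_ext fun r => ?_
    rw [Scheme.Hom.comp_appTop, CommRingCat.comp_apply, hd]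
    refine (congrArg (fun g => g r) h1).trans ?_
    rw [Scheme.Hom.id_appTop]
    rfl
  have hdc : d ≫ c = 𝟙 _ := by
    refine chart_hom_ext ?_ ?_
    · have hr : Set.range (chartProj k) ⊆ Set.range hU.fromSpec := by
        rw [hU.range_fromSpec]
        rintro _ ⟨t, rfl⟩
        exact hk (show t ∈ (⊤ : (chart k).Opens) from trivial)
      let m := IsOpenImmersion.lift hU.fromSpec (chartProj k) hr
      have hm : m ≫ hU.fromSpec = chartProj k := IsOpenImmersion.lift_fac _ _ _
      have hmp : d ≫ p = m := hom_Spec_ext fun a => by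
        rw [Scheme.Hom.comp_appTop, CommRingCat.comp_apply, hpa, hd, hfC,
          ← appLE_fromSpec hU (top_le_fromSpec hU), ← appLE_comp_apply _ _ _
            (top_le_comp _ _ (top_le_fromSpec hU)), appLE_congr_hom hm _ hk]
      rw [Category.assoc, hc, ← Category.assoc, hmp, hm, Category.id_comp]
    · rw [Scheme.Hom.comp_appTop, CommRingCat.comp_apply, hc']
      refine (hd _).trans (hfX.trans ?_)
      simp
  exact ⟨c, ⟨d, hcd, hdc⟩, hc, hcC, hc'⟩

/-- The points of a chart of the projective bundle over a closed point `b` with principal ideal are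
the specializations of one point `ξ`, and this point `ξ` has no proper generization at which a
nonzero polynomial of degree at most two in the coordinate vanishes. -/
theorem exists_genericPoint_chart (k : FramedAffine E) [IsDomain Γ(X, k.U.1)]
    [IsNoetherianRing Γ(X, k.U.1)] {b : X} (hb : b ∈ k.U.1)
    {π : Γ(X, k.U.1)} (hπ : ∀ f, b ∉ X.basicOpen f ↔ f ∈ Ideal.span {π})
    (hmax : (Ideal.span {π}).IsMaximal) :
    ∃ ξ ∈ Set.range (chartι k), projBundleProj E ξ = b ∧
      (∀ p ∈ Set.range (chartι k), projBundleProj E p = b → ξ ⤳ p) ∧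
      ∀ q : chart k, chartι k q ⤳ ξ → ∀ u v w : Γ(X, k.U.1), ¬ (u = 0 ∧ v = 0 ∧ w = 0) →
        q ∉ (chart k).basicOpen
          ((chartProj k).appLE k.U.1 ⊤ (top_le_chartProj k) u +
            chartCoord k * (chartProj k).appLE k.U.1 ⊤ (top_le_chartProj k) v -
            chartCoord k ^ 2 * (chartProj k).appLE k.U.1 ⊤ (top_le_chartProj k) w) →
        chartι k q = ξ := by
  have hU : IsAffineOpen k.U.1 := k.U.2
  obtain ⟨c, hc, hcp, hcC, hcX⟩ := exists_isIso_chart k hU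
  have hid : (hU.primeIdealOf ⟨b, hb⟩).asIdeal = Ideal.span {π} :=
    Ideal.ext fun f => (mem_primeIdealOf hU hb f).trans (hπ f)
  have hprime : (Ideal.span {π}).IsPrime := hmax.isPrime
  -- the generic point of the fibre is the prime ideal `π R[t]`
  let P : PrimeSpectrum (Polynomial Γ(X, k.U.1)) :=
    ⟨(Ideal.span {π}).map Polynomial.C, Ideal.isPrime_map_C_of_isPrime⟩
  have hproj (Q : PrimeSpectrum (Polynomial Γ(X, k.U.1))) :
      projBundleProj E (chartι k (c Q)) =
        hU.fromSpec (PrimeSpectrum.comap Polynomial.C Q) := by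
    have h (q : Spec (.of (Polynomial Γ(X, k.U.1)))) : projBundleProj E (chartι k (c q)) =
        hU.fromSpec (Spec.map (CommRingCat.ofHom Polynomial.C) q) := by
      rw [← Scheme.Hom.comp_apply, chartι_proj, ← Scheme.Hom.comp_apply, hcp,
        Scheme.Hom.comp_apply]
    exact h Q
  have hPb : projBundleProj E (chartι k (c P)) = b := by
    rw [hproj]
    have : PrimeSpectrum.comap Polynomial.C P = hU.primeIdealOf ⟨b, hb⟩ := by
      refine PrimeSpectrum.ext ?_
      rw [hid]
      ext a
      exact Ideal.mem_map_C_iff.trans ⟨fun h => by simpa using h 0, fun h n => by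
        rw [Polynomial.coeff_C]; split_ifs <;> simp [h]⟩
    rw [this]
    exact hU.fromSpec_primeIdealOf ⟨b, hb⟩
  refine ⟨chartι k (c P), ⟨_, rfl⟩, hPb, ?_, fun q hq u v w hne hqF => ?_⟩
  swap
  · obtain ⟨Q, rfl⟩ : ∃ Q, c Q = q := (Scheme.Hom.surjective c) q
    have hQP : Q ⤳ P := by
      refine c.isOpenEmbedding.isInducing.specializes_iff.1 ?_
      exact (chartι k).isOpenEmbedding.isInducing.specializes_iff.1 hq
    let F : Polynomial Γ(X, k.U.1) :=
      Polynomial.C u + Polynomial.X * Polynomial.C v - Polynomial.X ^ 2 * Polynomial.C w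
    have hF : F ≠ 0 := fun h => hne (by
      have h0 := congrArg (Polynomial.coeff · 0) h
      have h1 := congrArg (Polynomial.coeff · 1) h
      have h2 := congrArg (Polynomial.coeff · 2) h
      simp [F, Polynomial.coeff_X_pow, Polynomial.coeff_X, Polynomial.coeff_C] at h0 h1 h2
      exact ⟨h0, h1, h2⟩)
    have hFQ : F ∈ Q.asIdeal := by
      by_contra hFQ
      refine hqF ?_
      change Q ∈ (c ⁻¹ᵁ (chart k).basicOpen _ : (Spec _).Opens)
      rw [Scheme.preimage_basicOpen_top, map_sub, map_add, map_mul, map_mul, map_pow, hcC, hcC,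
        hcC, hcX, ← map_pow, ← map_mul, ← map_mul, ← map_add, ← map_sub,
        basicOpen_eq_of_affine (R := .of (Polynomial Γ(X, k.U.1)))]
      exact hFQ
    have := Q.isPrime
    have hQ := eq_map_C_of_le π hmax Q.asIdeal ((PrimeSpectrum.le_iff_specializes Q P).2 hQP)
      (fun h => hF (by rwa [h, Ideal.mem_bot] at hFQ))
    rw [show Q = P from PrimeSpectrum.ext hQ]
  rintro _ ⟨q, rfl⟩ hq
  obtain ⟨Q, rfl⟩ : ∃ Q, c Q = q := (Scheme.Hom.surjective c) q
  have h1 : PrimeSpectrum.comap Polynomial.C Q = hU.primeIdealOf ⟨b, hb⟩ := by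
    refine hU.fromSpec.isOpenEmbedding.injective ?_
    refine (hproj Q).symm.trans (hq.trans (hU.fromSpec_primeIdealOf ⟨b, hb⟩).symm)
  have h2 : P ⤳ Q := by
    refine (PrimeSpectrum.le_iff_specializes P Q).1 ?_
    change (Ideal.span {π}).map Polynomial.C ≤ Q.asIdeal
    rw [Ideal.map_le_iff_le_comap, ← hid, ← h1]
    exact le_rfl
  exact (h2.map c.continuous).map (chartι k).continuous

/-- The fibre of the projective bundle over a point `b` meets the intersection of a chart with the
chart of the exchanged frame. -/
theorem exists_mem_range_inter (k : FramedAffine E) {b : X} (hb : b ∈ k.U.1) :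
    ∃ p : projBundle E, p ∈ Set.range (chartι k) ∧ p ∈ Set.range (chartι k.swap) ∧
      projBundleProj E p = b := by
  let T := Spec (X.residueField b)
  let f : T ⟶ X := X.fromSpecResidueField b
  have hf (t : T) : f t = b := by
    have : f t ∈ Set.range (X.fromSpecResidueField b) := ⟨t, rfl⟩
    rwa [Scheme.range_fromSpecResidueField] at this
  have hfk : ⊤ ≤ f ⁻¹ᵁ k.U.1 := fun t _ => by
    change f t ∈ k.U.1
    rwa [hf t]
  -- the line spanned by `e₁ + e₂` over `b`
  let y := chartPt k f hfk 1
  have hy : y ≫ chartProj k = f := chartPt_proj _ _ _ _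
  have hyk : ⊤ ≤ (y ≫ chartProj k) ⁻¹ᵁ k.U.1 := le_preimage k y
  have hykk : ⊤ ≤ (y ≫ chartProj k) ⁻¹ᵁ (k.U.1 ⊓ k.swap.U.1) := fun t ht => ⟨hyk ht, hyk ht⟩
  have hs (c a : Fin 2) :
      (y ≫ chartProj k).appLE (k.U.1 ⊓ k.swap.U.1) ⊤ hykk (transition k k.swap c a) =
        (1 : Matrix (Fin 2) (Fin 2) Γ(T, ⊤)) (1 - c) a := by
    have h1 := congrArg (fun M => M.map ((y ≫ chartProj k).appLE (k.U.1 ⊓ k.U.1) ⊤ hykk))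
      (transition_self k (k.U.1 ⊓ k.U.1) le_rfl)
    rw [← map_transition k k _ _ le_rfl hykk hykk, Matrix.map_one _ (map_zero _) (map_one _)] at h1
    have h2 := congrFun (congrFun h1 (1 - c)) a
    rw [← h2, transition_swap]
    rfl
  have hsl : SameLine k k.swap y (chartPt k.swap (y ≫ chartProj k) hyk 1) := by
    refine sameLine_chartPt k k.swap y hyk hykk 1 1 ?_ ?_
    · rw [hs, hs, chartPt_coord]
      simp [Matrix.one_apply]
    · rw [hs, hs, chartPt_coord]
      simp [Matrix.one_apply]
  have he := hsl.comp_chartι_eq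
  let t : T := IsLocalRing.closedPoint _
  refine ⟨chartι k (y t), ⟨_, rfl⟩, ⟨chartPt k.swap (y ≫ chartProj k) hyk 1 t, ?_⟩, ?_⟩
  · rw [← Scheme.Hom.comp_apply, ← Scheme.Hom.comp_apply, he]
  · rw [← Scheme.Hom.comp_apply, ← Scheme.Hom.comp_apply, chartι_proj, hy]
    exact hf t

/-- The fibre of the projective bundle over a closed point is the closure of a point `ξ` that has no
proper generization, in a chart, at which a nonzero polynomial of degree at most two in the
coordinate vanishes. -/
theorem exists_genericPoint_fibre (k : FramedAffine E) [IsDomain Γ(X, k.U.1)]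
    [IsNoetherianRing Γ(X, k.U.1)] {b : X} (hb : b ∈ k.U.1)
    {π : Γ(X, k.U.1)} (hπ : ∀ f, b ∉ X.basicOpen f ↔ f ∈ Ideal.span {π})
    (hmax : (Ideal.span {π}).IsMaximal) :
    ∃ ξ ∈ Set.range (chartι k), projBundleProj E ξ = b ∧
      (∀ p, projBundleProj E p = b → ξ ⤳ p) ∧
      ∀ q : chart k, chartι k q ⤳ ξ → ∀ u v w : Γ(X, k.U.1), ¬ (u = 0 ∧ v = 0 ∧ w = 0) →
        q ∉ (chart k).basicOpen
          ((chartProj k).appLE k.U.1 ⊤ (top_le_chartProj k) u +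
            chartCoord k * (chartProj k).appLE k.U.1 ⊤ (top_le_chartProj k) v -
            chartCoord k ^ 2 * (chartProj k).appLE k.U.1 ⊤ (top_le_chartProj k) w) →
        chartι k q = ξ := by
  obtain ⟨ξ, hξ, hξb, h1, h2⟩ := exists_genericPoint_chart k hb hπ hmax
  have : IsDomain Γ(X, k.swap.U.1) := ‹IsDomain Γ(X, k.U.1)›
  have : IsNoetherianRing Γ(X, k.swap.U.1) := ‹IsNoetherianRing Γ(X, k.U.1)›
  obtain ⟨ξ', -, hξb', h1', -⟩ := exists_genericPoint_chart k.swap hb hπ hmax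
  obtain ⟨p, hp, hp', hpb⟩ := exists_mem_range_inter k hb
  -- the two charts of the fibre intersect, so their generic points are the same
  have hξ' : ξ' ∈ Set.range (chartι k) :=
    (h1' p hp' hpb).mem_open (chartι k).isOpenEmbedding.isOpen_range hp
  refine ⟨ξ, hξ, hξb, fun q hq => ?_, h2⟩
  rcases mem_range_chartι k q (by rwa [hq]) with h | h
  · exact h1 q h hq
  · exact (h1 ξ' hξ' hξb').trans (h1' q h hq)

theorem appLE_eq_zero_of_field {K : CommRingCat.{0}} (hK : IsField K) (f : Spec K ⟶ X)
    {U : X.Opens} (h : ⊤ ≤ f ⁻¹ᵁ U) (a : Γ(X, U)) (t : Spec K) (ht : f t ∉ X.basicOpen a) :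
    f.appLE U ⊤ h a = 0 := by
  let := hK.toField
  refine (eq_zero_or_isUnit_of_field K _).resolve_right fun hu => ht ?_
  have h1 := Scheme.basicOpen_of_isUnit _ hu
  rw [Scheme.basicOpen_appLE] at h1
  exact (h1.ge (show t ∈ (⊤ : (Spec K).Opens) from trivial)).2

/-- The fibre over a point has more than one point: the coordinate takes the values `0` and `1`. -/
theorem exists_ne_of_fibre (k : FramedAffine E) {b : X} (hb : b ∈ k.U.1) :
    ∃ p p' : projBundle E, projBundleProj E p = b ∧ projBundleProj E p' = b ∧ p ≠ p' := by
  let T := Spec (X.residueField b)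
  let f : T ⟶ X := X.fromSpecResidueField b
  have hf (t : T) : f t = b := (Scheme.range_fromSpecResidueField b).le ⟨t, rfl⟩
  have hfk : ⊤ ≤ f ⁻¹ᵁ k.U.1 := fun t _ => by
    change f t ∈ k.U.1
    rwa [hf t]
  let t : T := IsLocalRing.closedPoint _
  have hpt (a : Γ(T, ⊤)) : projBundleProj E (chartι k (chartPt k f hfk a t)) = b := by
    rw [← Scheme.Hom.comp_apply, ← Scheme.Hom.comp_apply, chartι_proj, chartPt_proj]
    exact hf t
  have hmem (a : Γ(T, ⊤)) :
      chartPt k f hfk a t ∈ (chart k).basicOpen (chartCoord k) ↔ t ∈ T.basicOpen a := by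
    have h := Scheme.preimage_basicOpen_top (chartPt k f hfk a) (chartCoord k)
    rw [chartPt_coord] at h
    rw [← h]
    rfl
  refine ⟨_, _, hpt 0, hpt 1, fun h => ?_⟩
  have h1 := (chartι k).isOpenEmbedding.injective h
  have h2 : chartPt k f hfk 1 t ∈ (chart k).basicOpen (chartCoord k) :=
    (hmem 1).2 (by rw [Scheme.basicOpen_of_isUnit _ isUnit_one]; trivial)
  rw [← h1, hmem, Scheme.basicOpen_zero] at h2
  exact h2

end ChartPoints

/-! ### Vertical components -/

section Vertical

theorem notMem_basicOpen_of_appTop_eq_zero {S T : Scheme.{0}} {f : S ⟶ T} {a : Γ(T, ⊤)}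
    (h : f.appTop.hom a = 0) (s : S) : f s ∉ T.basicOpen a := fun hs => by
  have h1 : s ∈ f ⁻¹ᵁ T.basicOpen a := hs
  rw [Scheme.preimage_basicOpen_top] at h1
  refine (?_ : s ∉ S.basicOpen (f.appTop.hom a)) h1
  rw [h, Scheme.basicOpen_zero]
  exact id

variable {X : Scheme.{0}} [X.Over (Spec (.of ℂ))] [SmoothOfRelativeDimension 1 (X ↘ Spec (.of ℂ))]
  [IsSeparated (X ↘ Spec (.of ℂ))] [QuasiCompact (X ↘ Spec (.of ℂ))]
  {E : X.Modules} {φ : HiggsField E}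

omit [QuasiCompact (X ↘ Spec (.of ℂ))] in
/-- If `π` divides `φ₂₁`, `φ₂₂ - φ₁₁` and `φ₁₂`, every line over a zero of `π` belongs to the Higgs
Grassmannian, since `φ` is scalar there. -/
theorem mem_range_grassι (k : FramedAffine E) {π : Γ(X, k.U.1)} {η₁ η₂ η₃ : Forms X k.U}
    (h₁ : φ.matrix k 1 0 = π • η₁) (h₂ : φ.matrix k 1 1 - φ.matrix k 0 0 = π • η₂)
    (h₃ : φ.matrix k 0 1 = π • η₃) {p : projBundle E} (hp : p ∈ Set.range (chartι k))
    (hpπ : projBundleProj E p ∉ X.basicOpen π) : p ∈ Set.range φ.grassι := by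
  have : Smooth (X ↘ Spec (.of ℂ)) := SmoothOfRelativeDimension.smooth 1 _
  let f := (projBundle E).fromSpecResidueField p
  have hr : Set.range f = {p} := Scheme.range_fromSpecResidueField p
  let x := IsOpenImmersion.lift (chartι k) f (by rw [hr]; simpa using hp)
  have hx : x ≫ chartι k = f := IsOpenImmersion.lift_fac _ _ _
  let t : Spec ((projBundle E).residueField p) := IsLocalRing.closedPoint _
  have ht : f t = p := hr.le ⟨t, rfl⟩
  have hxp : x ≫ chartProj k = f ≫ projBundleProj E := by
    rw [← hx, Category.assoc, chartι_proj]
  have hxU : ⊤ ≤ (x ≫ chartProj k) ⁻¹ᵁ k.U.1 := le_preimage k x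
  have h0 : (x ≫ chartProj k).appLE k.U.1 ⊤ hxU π = 0 := by
    refine appLE_eq_zero_of_field (Field.toIsField _) _ _ _ t ?_
    rw [hxp, Scheme.Hom.comp_apply, ht]
    exact hpπ
  obtain ⟨l, hl⟩ := exists_lift_grass φ k x (by
    rw [HiggsField.equations, Ideal.map_span, Ideal.span_eq_bot]
    rintro _ ⟨_, ⟨v, rfl⟩, rfl⟩
    have hc (η : Forms X k.U) : x.appTop ((chartProj k).appLE k.U.1 ⊤ (top_le_chartProj k)
        (v (π • η))) = 0 := by
      rw [← appLE_comp_apply _ _ _ hxU, map_smul, smul_eq_mul, map_mul, h0, zero_mul]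
    simp only [h₁, h₂, h₃]
    change x.appTop _ = 0
    rw [map_sub, map_add, map_mul, map_mul, hc, hc, hc]
    simp)
  refine ⟨l t, ?_⟩
  rw [← Scheme.Hom.comp_apply, hl, hx, ht]

variable [IrreducibleSpace X]

omit [IsSeparated (X ↘ Spec (.of ℂ))] [QuasiCompact (X ↘ Spec (.of ℂ))] in
/-- If `φ₂₁`, `φ₂₂ - φ₁₁` and `φ₁₂` have a common divisor `d` that is not invertible, then near a
closed zero of `d` they are divisible by a local parameter. -/
theorem exists_parameter_dvd {i : FramedAffine E} (hi : ¬ φ.GcdEqOne i) :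
    ∃ (b : X) (k : FramedAffine E) (π : Γ(X, k.U.1)) (ω : Forms X k.U) (u v w : Γ(X, k.U.1)),
      IsClosed {b} ∧ b ∈ k.U.1 ∧ (∀ f, b ∉ X.basicOpen f ↔ f ∈ Ideal.span {π}) ∧
      IsGenerator ω ∧ φ.matrix k 1 0 = π • u • ω ∧
      φ.matrix k 1 1 - φ.matrix k 0 0 = π • v • ω ∧ φ.matrix k 0 1 = π • w • ω := by
  have : JacobsonSpace X := LocallyOfFiniteType.jacobsonSpace (X ↘ Spec (.of ℂ))
  simp only [HiggsField.GcdEqOne, not_forall] at hi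
  obtain ⟨d, ⟨η₃, h₃⟩, ⟨η₁, h₁⟩, ⟨η₂, h₂⟩, hd⟩ := hi
  obtain ⟨b, ⟨hbU, hbd⟩, hb⟩ := nonempty_inter_closedPoints
    (Z := (i.U.1 : Set X) ∩ (X.basicOpen d : Set X)ᶜ) (by
      by_contra hne
      refine hd (X.toRingedSpace.isUnit_of_isUnit_germ i.U.1 d fun x hx => ?_)
      refine (X.mem_basicOpen d x hx).1 ?_
      by_contra hxd
      exact hne ⟨x, hx, hxd⟩)
    (i.U.1.2.isLocallyClosed.inter (X.basicOpen d).2.isClosed_compl.isLocallyClosed)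
  have hb : IsClosed {b} := hb
  obtain ⟨V, hVi, hbV, -, ⟨ω, hω⟩, π, hπ⟩ := exists_localParameter hb i.U.1 hbU
  obtain ⟨d', hd'⟩ : ∃ d', X.presheaf.map (homOfLE hVi).op d = d' * π := by
    refine Ideal.mem_span_singleton'.1 ((hπ _).1 fun h => hbd ?_) |>.imp fun _ h => h.symm
    rw [Scheme.basicOpen_res] at h
    exact h.2
  have key {η θ : Forms X i.U} (h : θ = d • η) : ∃ a : Γ(X, V.1), resForm X hVi θ = π • a • ω := by
    obtain ⟨a, ha⟩ := hω.2 (resForm X hVi η)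
    refine ⟨d' * a, ?_⟩
    rw [h, resForm_smul, hd', ← ha]
    simp only [smul_smul]
    congr 1
    ring
  obtain ⟨u, hu⟩ := key h₁
  obtain ⟨v, hv⟩ := key h₂
  obtain ⟨w, hw⟩ := key h₃
  refine ⟨b, i.restrict V hVi, π, ω, u, v, w, hb, hbV, hπ, hω, ?_, ?_, ?_⟩
  · exact (matrix_restrict φ i V hVi 1 0).trans hu
  · rw [matrix_restrict, matrix_restrict]
    exact (map_sub _ _ _).symm.trans hv
  · exact (matrix_restrict φ i V hVi 0 1).trans hw

/-- If the gcd of `φ` is not `1`, then `ρ₁` has a fibre that is a whole line and an irreducible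
component of the Higgs Grassmannian. -/
theorem exists_vertical_component (hE : IsLocallyFreeOfRank E 2) (hφ : ¬ φ.IsCentral)
    {i : FramedAffine E} (hi : ¬ φ.GcdEqOne i) :
    (∃ b : X, IsClosed {b} ∧ φ.grassProj ⁻¹' {b} ∈ irreducibleComponents φ.grass ∧
        φ.grassι '' (φ.grassProj ⁻¹' {b}) = projBundleProj E ⁻¹' {b}) ∧
      ¬ IsFinite φ.grassProj := by
  have hsm : Smooth (X ↘ Spec (.of ℂ)) := SmoothOfRelativeDimension.smooth 1 _
  have hint : IsIntegral X := isIntegral_of_smooth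
  obtain ⟨b, k, π, ω, u, v, w, hb, hbk, hπ, hω, h₁, h₂, h₃⟩ := exists_parameter_dvd hi
  have hU : IsAffineOpen k.U.1 := k.U.2
  have : Nonempty k.U.1 := ⟨⟨b, hbk⟩⟩
  have : IsNoetherianRing Γ(X, k.U.1) := isNoetherianRing_of_smooth k.U
  have hid : (hU.primeIdealOf ⟨b, hbk⟩).asIdeal = Ideal.span {π} :=
    Ideal.ext fun f => (mem_primeIdealOf hU hbk f).trans (hπ f)
  have hmax : (Ideal.span {π}).IsMaximal := by
    rw [← hid, ← PrimeSpectrum.isClosed_singleton_iff_isMaximal]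
    have h1 := hb.preimage hU.fromSpec.continuous
    have h2 : hU.fromSpec ⁻¹' {b} = {hU.primeIdealOf ⟨b, hbk⟩} := Set.ext fun Q =>
      ⟨fun h => hU.fromSpec.isOpenEmbedding.injective
        (h.trans (hU.fromSpec_primeIdealOf ⟨b, hbk⟩).symm), fun h =>
          (congrArg hU.fromSpec h).trans (hU.fromSpec_primeIdealOf ⟨b, hbk⟩)⟩
    rwa [h2] at h1
  have hbπ : b ∉ X.basicOpen π := (hπ π).2 (Ideal.mem_span_singleton_self π)
  have hne : ¬ (π * u = 0 ∧ π * v = 0 ∧ π * w = 0) := fun ⟨h, h', h''⟩ =>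
    hφ (isCentral_of_matrix hE k ⟨b, hbk⟩ (by rw [h₃, smul_smul, h'', zero_smul])
      (by rw [h₁, smul_smul, h, zero_smul]) (by rw [h₂, smul_smul, h', zero_smul]))
  obtain ⟨ξ, hξk, hξb, hξ, hgen⟩ := exists_genericPoint_fibre k hbk hπ hmax
  have hproj (y : φ.grass) : φ.grassProj y = projBundleProj E (φ.grassι y) :=
    Scheme.Hom.comp_apply _ _ _
  -- the fibre of the projective bundle is contained in the Higgs Grassmannian
  have hmem (p : projBundle E) (hp : projBundleProj E p = b) : p ∈ Set.range φ.grassι := by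
    have hpπ : projBundleProj E p ∉ X.basicOpen π := by rwa [hp]
    rcases mem_range_chartι k p (by rwa [hp]) with h | h
    · exact mem_range_grassι k h₁ h₂ h₃ h hpπ
    · refine mem_range_grassι (φ := φ) k.swap (π := π) (η₁ := w • ω) (η₂ := - (v • ω)) (η₃ := u • ω)
        ?_ ?_ ?_ h hpπ
      · exact (matrix_swap φ k 1 0).trans h₃
      · rw [matrix_swap, matrix_swap]
        refine (neg_sub _ _).symm.trans ((congrArg Neg.neg h₂).trans (smul_neg _ _).symm)
      · exact (matrix_swap φ k 0 1).trans h₁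
  have hemb := φ.grassι.isClosedEmbedding
  obtain ⟨ξ', hξ'⟩ := hmem ξ hξb
  have hfib : φ.grassProj ⁻¹' {b} = closure {ξ'} := by
    ext y
    rw [← specializes_iff_mem_closure, ← hemb.isInducing.specializes_iff, hξ']
    refine ⟨fun h => hξ _ ((hproj y).symm.trans h), fun h => ?_⟩
    have h' := h.map (projBundleProj E).continuous
    rw [hξb] at h'
    exact (hproj y).trans (h'.mem_closed hb rfl)
  refine ⟨⟨b, hb, ?_, ?_⟩, fun hfin => ?_⟩
  · -- the generic point `ζ` of a larger irreducible set is a generization of the generic point of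
    -- the fibre at which the equations vanish, so that the two points are equal
    rw [hfib]
    refine ⟨isIrreducible_singleton.closure, fun Z hZ hle => ?_⟩
    let ζ := hZ.genericPoint
    have hζ : IsGenericPoint ζ (closure Z) := hZ.isGenericPoint_genericPoint_closure
    have hζξ : φ.grassι ζ ⤳ ξ := by
      rw [← hξ', hemb.isInducing.specializes_iff]
      exact hζ.specializes (subset_closure (hle (subset_closure rfl)))
    obtain ⟨q, hq⟩ : φ.grassι ζ ∈ Set.range (chartι k) :=
      hζξ.mem_open (chartι k).isOpenEmbedding.isOpen_range hξk
    have hqξ : chartι k q = ξ := by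
      refine hgen q (by rwa [hq]) _ _ _ hne fun hqF => ?_
      -- the equation contracted with the vector field dual to `ω` vanishes at `q`
      let x := IsOpenImmersion.lift (chartι k) (φ.grass.fromSpecResidueField ζ ≫ φ.grassι) (by
        rintro _ ⟨s, rfl⟩
        have hs : φ.grass.fromSpecResidueField ζ s = ζ :=
          (Scheme.range_fromSpecResidueField ζ).le ⟨s, rfl⟩
        rw [Scheme.Hom.comp_apply, hs]
        exact ⟨q, hq⟩)
      have hx : x ≫ chartι k = φ.grass.fromSpecResidueField ζ ≫ φ.grassι :=
        IsOpenImmersion.lift_fac _ _ _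
      let t : Spec (φ.grass.residueField ζ) := IsLocalRing.closedPoint _
      have hxq : x t = q := by
        refine (chartι k).isOpenEmbedding.injective ?_
        rw [hq, ← Scheme.Hom.comp_apply, hx, Scheme.Hom.comp_apply]
        exact congrArg φ.grassι ((Scheme.range_fromSpecResidueField ζ).le ⟨t, rfl⟩)
      have hbot := map_equations_eq_bot φ hE k x _ hx.symm
      rw [HiggsField.equations, Ideal.map_span, Ideal.span_eq_bot] at hbot
      obtain ⟨v₀, hv₀⟩ := hω.exists_dual
      have h0 := hbot _ ⟨_, ⟨v₀, rfl⟩, rfl⟩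
      simp only [h₁, h₂, h₃, map_smul, hv₀, smul_eq_mul] at h0
      exact notMem_basicOpen_of_appTop_eq_zero h0 t (by rwa [hxq])
    have : ζ = ξ' := hemb.injective (by rw [← hq, hqξ, hξ'])
    rw [← this]
    exact subset_closure.trans hζ.def.ge
  · ext p
    constructor
    · rintro ⟨y, hy, rfl⟩
      exact (hproj y).symm.trans hy
    · intro hp
      obtain ⟨y, rfl⟩ := hmem p hp
      exact ⟨y, (hproj y).trans hp, rfl⟩
  · -- the fibres of a finite morphism are discrete, but all points of this fibre are
    -- specializations of one point
    have hdis := (Scheme.Hom.isDiscrete_preimage_singleton φ.grassProj b).to_subtype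
    have hsub (p : projBundle E) (hp : projBundleProj E p = b) : p = ξ := by
      obtain ⟨y, rfl⟩ := hmem p hp
      have h1 : φ.grassProj y = b := (hproj y).trans hp
      have h2 : φ.grassProj ξ' = b := (hproj ξ').trans (by rw [hξ', hξb])
      have h3 : (⟨ξ', h2⟩ : φ.grassProj ⁻¹' {b}) ⤳ ⟨y, h1⟩ := by
        rw [← Topology.IsInducing.subtypeVal.specializes_iff,
          ← hemb.isInducing.specializes_iff, hξ']
        exact hξ _ hp
      rw [← hξ', show ξ' = y from congrArg Subtype.val h3.eq]
    obtain ⟨p, p', hp, hp', hne'⟩ := exists_ne_of_fibre k hbk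
    exact hne' ((hsub p hp).trans (hsub p' hp').symm)

end Vertical

end HiggsGrass

end

theorem mainTheorem4 (B : Scheme.{0}) [B.Over (Spec (.of ℂ))]
    [SmoothOfRelativeDimension 1 (B ↘ Spec (.of ℂ))] [IsSeparated (B ↘ Spec (.of ℂ))]
    [QuasiCompact (B ↘ Spec (.of ℂ))] [IrreducibleSpace B]
    (E : B.Modules) (hE : HiggsGrass.IsLocallyFreeOfRank E 2)
    (φ : HiggsGrass.HiggsField E) (hφ : ¬ φ.IsCentral) :
    ((∀ i : HiggsGrass.FramedAffine E, φ.GcdEqOne i) →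
      (IsFinite φ.grassProj ∧ Flat φ.grassProj ∧ ∀ b : B, φ.grassProj.finrank b = 2) ∧
      (¬ φ.DiscEqZero ∧ ¬ φ.DiscIsSquare →
        IrreducibleSpace φ.grass ∧ IsReduced φ.grass ∧
        IsEmpty φ.Sections ∧ IsEmpty φ.LineSubbundles) ∧
      (¬ φ.DiscEqZero ∧ φ.DiscIsSquare →
        ¬ PreirreducibleSpace φ.grass ∧
        Nat.card φ.Sections = 2 ∧ Nat.card φ.LineSubbundles = 2) ∧
      (φ.DiscEqZero →
        ¬ IsReduced φ.grass ∧
        (∀ b : Spec (.of ℂ) ⟶ B, b ≫ (B ↘ Spec (.of ℂ)) = 𝟙 _ →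
          ∃ e : pullback φ.grassProj b ≅
              Spec (.of (Polynomial ℂ ⧸ Ideal.span {(Polynomial.X : Polynomial ℂ) ^ 2})),
            e.hom ≫ Spec.map (CommRingCat.ofHom (algebraMap ℂ
              (Polynomial ℂ ⧸ Ideal.span {(Polynomial.X : Polynomial ℂ) ^ 2}))) =
              pullback.snd φ.grassProj b) ∧
        Nat.card φ.Sections = 1 ∧ Nat.card φ.LineSubbundles = 1)) ∧
    ((∃ i : HiggsGrass.FramedAffine E, ¬ φ.GcdEqOne i) →
      (∃ b : B, IsClosed {b} ∧
        φ.grassProj ⁻¹' {b} ∈ irreducibleComponents φ.grass ∧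
        φ.grassι '' (φ.grassProj ⁻¹' {b}) = HiggsGrass.projBundleProj E ⁻¹' {b}) ∧
      ¬ IsFinite φ.grassProj) := by
  have hsm : Smooth (B ↘ Spec (.of ℂ)) := SmoothOfRelativeDimension.smooth 1 _
  have hint : IsIntegral B := HiggsGrass.isIntegral_of_smooth
  refine ⟨fun hgcd => ⟨⟨HiggsGrass.isFinite_grassProj hE hgcd, HiggsGrass.flat_grassProj hE hgcd,
    HiggsGrass.finrank_grassProj hE hgcd⟩, ?_⟩,
    fun ⟨i, hi⟩ => HiggsGrass.exists_vertical_component hE hφ hi⟩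
  -- any adapted frame with nonempty domain decides the three cases
  obtain ⟨i, α, β, hx, hi⟩ := HiggsGrass.exists_isAdapted φ hE hgcd (genericPoint B)
  have h₀ : (i.U.1 : Set B).Nonempty := ⟨_, hx⟩
  have : Nonempty i.U.1 := h₀.to_subtype
  have h2 : IsUnit (2 : Γ(B, i.U.1)) := HiggsGrass.isUnit_two i.U.1
  let eR := HiggsGrass.rootsEquiv h2 α β
  obtain ⟨eS⟩ := hi.nonempty_roots_equiv_sections hE hgcd h₀
  let eL := Equiv.ofBijective _ (hi.bijective_line hE hgcd h₀)
  have hzero := hi.discEqZero_iff h₀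
  have hsq := hi.discIsSquare_iff hE h₀
  refine ⟨fun ⟨_, hns⟩ => ?_, fun ⟨hne, hs⟩ => ?_, fun h0 => ?_⟩
  · have hR : IsEmpty (HiggsGrass.Roots α β) := ⟨fun τ => hns (hsq.2 ⟨_, (eR τ).2⟩)⟩
    have hS : IsEmpty φ.Sections := eS.symm.isEmpty
    exact ⟨HiggsGrass.irreducibleSpace_grass hE hgcd hS, HiggsGrass.isReduced_grass hE hgcd hS, hS,
      eL.symm.isEmpty⟩
  · obtain ⟨d, hd⟩ := hsq.1 hs
    have hR : Nat.card (HiggsGrass.Roots α β) = 2 :=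
      (Nat.card_congr eR).trans (HiggsGrass.natCard_sqrt h2 hd (fun h => hne (hzero.2 h)))
    obtain ⟨τ, τ', hτ, -⟩ := Nat.card_eq_two_iff.1 hR
    exact ⟨hi.not_preirreducibleSpace hE h₀ hτ, (Nat.card_congr eS).symm.trans hR,
      (Nat.card_congr eL).symm.trans hR⟩
  · have hδ := hzero.1 h0
    have hR : Nat.card (HiggsGrass.Roots α β) = 1 := by
      refine (Nat.card_congr eR).trans ?_
      rw [hδ]
      exact HiggsGrass.natCard_sqrt_zero
    obtain ⟨c, hc⟩ := h2.exists_right_inv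
    refine ⟨hi.not_isReduced (τ := c * α) hE h₀ (by linear_combination α * hc)
      (by linear_combination c ^ 2 * hδ - β * (2 * c + 1) * hc),
      fun b _ => HiggsGrass.exists_fibre_iso hE hgcd h0 b, (Nat.card_congr eS).symm.trans hR,
      (Nat.card_congr eL).symm.trans hR⟩
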